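/- Let $M$ be a compact connected smooth $7$-manifold (without boundary), let $\omega$ be a positive smooth $3$-form on $M$ (that is, a $G_2$ structure: at each point $\omega$ is identified, by a linear isomorphism $T_xM\cong\mathbb R^7$, with the standard $3$-form $e^{123}+e^{145}+e^{167}+e^{246}-e^{257}-e^{347}-e^{356}$), and let $\phi\in C^\infty(M)$. Let $*$ and $d^*$ be the Hodge star operator and the codifferential of the metric and orientation determined by $\omega$. Then $(\omega,\phi)$ is a solution of the system $$ d\omega\wedge\omega=0,\qquad d{*\omega}+4\,d\phi\wedge *\omega=0,\qquad -d\bigl(*(d\omega+4\,d\phi\wedge\omega)\bigr)=0 $$ if and only if $\phi$ is constant and $\omega$ is torsion-free, that is, $d\omega=0$ and $d^*\omega=0$. -/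

import Mathlib

open scoped Manifold ContDiff

noncomputable section

namespace G2

/-! ### Multilinear algebra on a real topological vector space -/

section Algebra

variable {V : Type*} [AddCommGroup V] [Module ℝ V] [TopologicalSpace V]

/-- The tensor product of two alternating forms:
`(v₁, …, vₖ₊ₗ) ↦ α(v₁, …, vₖ) β(vₖ₊₁, …, vₖ₊ₗ)`. -/
def tensor {k l : ℕ} (α : V [⋀^Fin k]→L[ℝ] ℝ) (β : V [⋀^Fin l]→L[ℝ] ℝ) :
    ContinuousMultilinearMap ℝ (fun _ : Fin (k + l) => V) ℝ where
  toFun v := α (fun i => v (Fin.castAdd l i)) * β (fun j => v (Fin.natAdd k j))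
  map_update_add' := by
    intro inst v i x y
    obtain rfl : inst = instDecidableEqFin (k + l) := Subsingleton.elim _ _
    have hl : ∀ (a : Fin k) (z : V), (fun i => Function.update v (Fin.castAdd l a) z
        (Fin.castAdd l i)) = Function.update (fun i => v (Fin.castAdd l i)) a z := by
      intro a z; ext i; simp [Function.update_apply]
    have hl' : ∀ (a : Fin k) (z : V), (fun j => Function.update v (Fin.castAdd l a) z
        (Fin.natAdd k j)) = fun j => v (Fin.natAdd k j) := by
      intro a z; ext j; rw [Function.update_of_ne]; simp [Fin.ext_iff]; omega
    have hr : ∀ (a : Fin l) (z : V), (fun i => Function.update v (Fin.natAdd k a) z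
        (Fin.natAdd k i)) = Function.update (fun i => v (Fin.natAdd k i)) a z := by
      intro a z; ext i; simp [Function.update_apply]
    have hr' : ∀ (a : Fin l) (z : V), (fun j => Function.update v (Fin.natAdd k a) z
        (Fin.castAdd l j)) = fun j => v (Fin.castAdd l j) := by
      intro a z; ext j; rw [Function.update_of_ne]; simp [Fin.ext_iff]; omega
    induction i using Fin.addCases with
    | left a => simp only [hl, hl', α.map_update_add, add_mul]
    | right a => simp only [hr, hr', β.map_update_add, mul_add]
  map_update_smul' := by
    intro inst v i c x
    obtain rfl : inst = instDecidableEqFin (k + l) := Subsingleton.elim _ _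
    have hl : ∀ (a : Fin k) (z : V), (fun i => Function.update v (Fin.castAdd l a) z
        (Fin.castAdd l i)) = Function.update (fun i => v (Fin.castAdd l i)) a z := by
      intro a z; ext i; simp [Function.update_apply]
    have hl' : ∀ (a : Fin k) (z : V), (fun j => Function.update v (Fin.castAdd l a) z
        (Fin.natAdd k j)) = fun j => v (Fin.natAdd k j) := by
      intro a z; ext j; rw [Function.update_of_ne]; simp [Fin.ext_iff]; omega
    have hr : ∀ (a : Fin l) (z : V), (fun i => Function.update v (Fin.natAdd k a) z
        (Fin.natAdd k i)) = Function.update (fun i => v (Fin.natAdd k i)) a z := by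
      intro a z; ext i; simp [Function.update_apply]
    have hr' : ∀ (a : Fin l) (z : V), (fun j => Function.update v (Fin.natAdd k a) z
        (Fin.castAdd l j)) = fun j => v (Fin.castAdd l j) := by
      intro a z; ext j; rw [Function.update_of_ne]; simp [Fin.ext_iff]; omega
    induction i using Fin.addCases with
    | left a => simp only [hl, hl', α.map_update_smul, smul_eq_mul, mul_assoc]
    | right a => simp only [hr, hr', β.map_update_smul, smul_eq_mul, mul_left_comm]
  cont := by
    have h1 : Continuous fun v : Fin (k + l) → V => α (fun i => v (Fin.castAdd l i)) :=
      α.cont.comp (continuous_pi fun i => continuous_apply _)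
    have h2 : Continuous fun v : Fin (k + l) → V => β (fun i => v (Fin.natAdd k i)) :=
      β.cont.comp (continuous_pi fun i => continuous_apply _)
    exact h1.mul h2

/-- The wedge product
`(α ∧ β)(v) = 1/(k! l!) ∑ σ, sgn(σ) α(v_σ(1), …, v_σ(k)) β(v_σ(k+1), …, v_σ(k+l))`,
the normalization for which `dx¹ ∧ ⋯ ∧ dxⁿ` takes the value `1` on the standard basis. -/
def wedge {k l : ℕ} (α : V [⋀^Fin k]→L[ℝ] ℝ) (β : V [⋀^Fin l]→L[ℝ] ℝ) :
    V [⋀^Fin (k + l)]→L[ℝ] ℝ :=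
  ((k.factorial : ℝ) * (l.factorial : ℝ))⁻¹ • (tensor α β).alternatization

/-- Insertion of the vectors `u₁, …, uₖ` into the first `k` slots of an `n`-form, `n = k + l`. -/
def insert {k l n : ℕ} (h : k + l = n) (α : V [⋀^Fin n]→L[ℝ] ℝ) (u : Fin k → V) :
    V [⋀^Fin l]→L[ℝ] ℝ where
  toFun v := α (fun i => Fin.append u v (Fin.cast h.symm i))
  map_update_add' := by
    intro inst v i x y
    subst h
    obtain rfl : inst = instDecidableEqFin l := Subsingleton.elim _ _
    have key : ∀ z : V, (fun j : Fin (k + l) => Fin.append u (Function.update v i z)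
        (Fin.cast rfl j)) = Function.update (Fin.append u v) (Fin.natAdd k i) z := by
      intro z; ext j
      induction j using Fin.addCases with
      | left a =>
        rw [Function.update_of_ne (by simp [Fin.ext_iff]; omega)]; simp
      | right a => simp [Function.update_apply]
    simp only [key, α.map_update_add]
  map_update_smul' := by
    intro inst v i c x
    subst h
    obtain rfl : inst = instDecidableEqFin l := Subsingleton.elim _ _
    have key : ∀ z : V, (fun j : Fin (k + l) => Fin.append u (Function.update v i z)
        (Fin.cast rfl j)) = Function.update (Fin.append u v) (Fin.natAdd k i) z := by
      intro z; ext j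
      induction j using Fin.addCases with
      | left a =>
        rw [Function.update_of_ne (by simp [Fin.ext_iff]; omega)]; simp
      | right a => simp [Function.update_apply]
    simp only [key, α.map_update_smul]
  map_eq_zero_of_eq' := by
    intro v i j hv hij
    subst h
    refine α.map_eq_zero_of_eq _ (i := Fin.natAdd k i) (j := Fin.natAdd k j) ?_ ?_
    · simpa using hv
    · simpa [Fin.ext_iff] using hij
  cont := by
    subst h
    refine α.cont.comp (continuous_pi fun j => ?_)
    induction j using Fin.addCases with
    | left a => simpa using continuous_const
    | right a => simpa using continuous_apply a

end Algebra

/-! ### The model `ℝ⁷` -/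

/-- Euclidean space `ℝ⁷`. -/
abbrev R7 : Type := EuclideanSpace ℝ (Fin 7)

/-- The form `dx^{c₁} ∧ ⋯ ∧ dx^{cₙ}` on `ℝ⁷`, that is `(v₁, …, vₙ) ↦ det ((v_a)_{c_b})`
(coordinates are numbered from `0` to `6`). -/
def dx {n : ℕ} (c : Fin n → Fin 7) : R7 [⋀^Fin n]→L[ℝ] ℝ :=
  { Matrix.detRowAlternating.compLinearMap
      (LinearMap.pi fun b : Fin n => (EuclideanSpace.proj (𝕜 := ℝ) (c b) : R7 →L[ℝ] ℝ).toLinearMap) with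
    cont := by
      change Continuous fun v : Fin n → R7 => Matrix.det (Matrix.of fun a b : Fin n => v a (c b))
      exact Continuous.matrix_det (continuous_matrix fun a b => by
        simp only [Matrix.of_apply]; fun_prop) }

/-- The standard volume form `dx¹ ∧ ⋯ ∧ dx⁷` of `ℝ⁷`. -/
def vol : R7 [⋀^Fin 7]→L[ℝ] ℝ := dx id

/-- The standard `G₂` three-form
`dx¹²³ + dx¹⁴⁵ + dx¹⁶⁷ + dx²⁴⁶ - dx²⁵⁷ - dx³⁴⁷ - dx³⁵⁶` on `ℝ⁷`; its stabilizer in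
`GL(7, ℝ)` is the group `G₂ ⊂ SO(7)`. -/
def phi0 : R7 [⋀^Fin 3]→L[ℝ] ℝ :=
  dx ![0, 1, 2] + dx ![0, 3, 4] + dx ![0, 5, 6] + dx ![1, 3, 5]
    - dx ![1, 4, 6] - dx ![2, 3, 6] - dx ![2, 4, 5]

/-- The Hodge star operator of Euclidean `ℝ⁷` with its standard orientation, from `k`-forms to
`l`-forms, `k + l = 7`, where `e` is the standard basis:
`(⋆β)(v) = 1/k! ∑_{i₁, …, iₖ} β(e_{i₁}, …, e_{iₖ}) vol(e_{i₁}, …, e_{iₖ}, v₁, …, vₗ)`.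
It is the operator with `α ∧ ⋆β = ⟨α, β⟩ vol`. -/
def starR7 {k l : ℕ} (h : k + l = 7) (β : R7 [⋀^Fin k]→L[ℝ] ℝ) : R7 [⋀^Fin l]→L[ℝ] ℝ :=
  ((k.factorial : ℝ))⁻¹ • ∑ i : Fin k → Fin 7,
    β (fun a => EuclideanSpace.single (i a) (1 : ℝ)) •
      insert h vol (fun a => EuclideanSpace.single (i a) (1 : ℝ))

/-! ### Differential forms on a 7-manifold -/

section Manifold

variable (M : Type*) [TopologicalSpace M] [ChartedSpace R7 M]

/-- Differential forms of degree `k` on `M`, without regularity. -/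
abbrev Form (k : ℕ) : Type _ := ∀ x : M, TangentSpace (𝓡 7) x [⋀^Fin k]→L[ℝ] ℝ

variable {M}

/-- The expression of a form in the chart at `x₀`: its pullback by the inverse of the chart. -/
def Form.inChart {k : ℕ} (α : Form M k) (x₀ : M) : R7 → R7 [⋀^Fin k]→L[ℝ] ℝ := fun y =>
  (α ((extChartAt (𝓡 7) x₀).symm y)).compContinuousLinearMap
    (mfderiv 𝓘(ℝ, R7) (𝓡 7) (extChartAt (𝓡 7) x₀).symm y)

/-- A form is smooth if its expressions in the charts are smooth. -/
def Form.Smooth {k : ℕ} (α : Form M k) : Prop :=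
  ∀ x₀ : M, ContDiffOn ℝ ∞ (α.inChart x₀) (extChartAt (𝓡 7) x₀).target

/-- The exterior derivative, computed at `x` in the chart at `x`. -/
def Form.d {k : ℕ} (α : Form M k) : Form M (k + 1) := fun x =>
  (extDeriv (α.inChart x) (extChartAt (𝓡 7) x x)).compContinuousLinearMap
    (mfderiv (𝓡 7) 𝓘(ℝ, R7) (extChartAt (𝓡 7) x) x)

/-- The wedge product of differential forms. -/
def Form.wedge {k l : ℕ} (α : Form M k) (β : Form M l) : Form M (k + l) := fun x =>
  G2.wedge (α x) (β x)

/-- The differential of a function, as a 1-form. -/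
def differential (f : M → ℝ) : Form M 1 := fun x =>
  ContinuousAlternatingMap.ofSubsingleton ℝ (TangentSpace (𝓡 7) x) ℝ (0 : Fin 1)
    (mfderiv (𝓡 7) 𝓘(ℝ, ℝ) f x)

variable (M) in
/-- A `G₂` structure on `M`, given by a positive 3-form: a smooth 3-form which at each point is
the pullback of the standard one by a linear isomorphism of the tangent space with `ℝ⁷`. -/
structure G2Structure where
  /-- the 3-form -/
  form : Form M 3
  smooth : form.Smooth
  positive : ∀ x : M, ∃ e : TangentSpace (𝓡 7) x ≃L[ℝ] R7,
    form x = phi0.compContinuousLinearMap (e : TangentSpace (𝓡 7) x →L[ℝ] R7)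

namespace G2Structure

variable (Ω : G2Structure M)

/-- A frame adapted to the `G₂` structure at `x`. Two such frames differ by an element of
`G₂ ⊂ SO(7)`, so the pullbacks of the Euclidean metric and of the standard orientation
do not depend on the choice: they are the metric and the orientation given by `Ω`. -/
def frame (x : M) : TangentSpace (𝓡 7) x ≃L[ℝ] R7 :=
  Classical.choose (Ω.positive x)

/-- The Hodge star operator on `k`-forms for the metric and the orientation given by `Ω`. -/
def star {k l : ℕ} (h : k + l = 7) (α : Form M k) : Form M l := fun x =>
  (starR7 h ((α x).compContinuousLinearMap
    ((Ω.frame x).symm : R7 →L[ℝ] TangentSpace (𝓡 7) x))).compContinuousLinearMap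
      (Ω.frame x : TangentSpace (𝓡 7) x →L[ℝ] R7)

/-- The codifferential `d* = (-1)^p ⋆ d ⋆` from `p`-forms to `(p - 1)`-forms in dimension 7,
the formal adjoint of `d`; here `p = k + 1`. -/
def codiff {k l : ℕ} (h : k + 1 + l = 7) (α : Form M (k + 1)) : Form M k :=
  (-1 : ℝ) ^ (k + 1) • Ω.star (k := l + 1) (by omega) (Ω.star h α).d

/-- `Ω` is torsion-free: `dΩ = 0` and `d*Ω = 0`. -/
def IsTorsionFree : Prop :=
  Ω.form.d = 0 ∧ Ω.codiff (k := 2) (l := 4) rfl Ω.form = 0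

/-- The system `dΩ ∧ Ω = 0`, `d⋆Ω + 4 dφ ∧ ⋆Ω = 0`, `-d⋆(dΩ + 4 dφ ∧ Ω) = 0`. -/
structure IsSolution (φ : M → ℝ) : Prop where
  cocalibrated : Ω.form.d.wedge Ω.form = 0
  lee : (Ω.star (k := 3) (l := 4) rfl Ω.form).d +
    (4 : ℝ) • (differential φ).wedge (Ω.star (k := 3) (l := 4) rfl Ω.form) = 0
  closed_torsion : -(Ω.star (k := 4) (l := 3) rfl
    (Ω.form.d + (4 : ℝ) • (differential φ).wedge Ω.form)).d = 0

end G2Structure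

end Manifold

end G2

end

open scoped Manifold ContDiff

noncomputable section

namespace G2

/-! Put f = exp(4φ), β = dω + 4 dφ∧ω = exp(-4φ) d(fω) and τ = ⋆β. The heart of the proof is that a
solution satisfies Δf = f |β|², where Δ is the divergence of the gradient. Two facts give this.
First, the equation d⋆ω = -4 dφ∧⋆ω fixes the component of β that ⋆ω detects, so that τ∧ω is a
constant multiple of ⋆dφ (`antisum_torsion`, `antisum_star_eq`), hence f τ∧ω is a constant multiple
of ⋆df. Second, dτ = 0, so d(τ∧fω) = -τ∧d(fω) = -f τ∧β = -f |β|² vol (`divergence_identity`). Thus f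
is subharmonic on a compact connected manifold, and Hopf's strong maximum principle
(`eventually_eq_of_subsolution`) makes it constant. The identity then reads β = 0; since dφ = 0 this
is dω = 0, and the second equation becomes d⋆ω = 0. The converse is substitution. No connection is
used. `antisum_torsion` comes from differentiating algebraic G₂ identities, together with the first
variation of the volume (`first_variation`). Wedge products are handled through `antisum`: for forms
of degrees k₁, …, kᵣ adding up to 7 it returns k₁!⋯kᵣ! times the coefficient of their wedge product,
which explains most numerical constants. Adapted frames are chosen point by point, with no
continuity. What is smooth is the determinant of the frame and the inverse metric `gram F.symm`,
because Bryant's formula recovers both from ω (`bryantForm_pull`, `frameDet_eq_rpow`); all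
derivatives are taken of these or of forms. -/

/-! ### Antisymmetrized sums over the standard basis of `ℝ⁷` -/

/-- The standard basis of `ℝ⁷`. -/
def bvec (j : Fin 7) : R7 := EuclideanSpace.single j (1 : ℝ)

lemma single_eq_bvec (j : Fin 7) : EuclideanSpace.single j (1 : ℝ) = bvec j := by rw [bvec]

lemma bvec_apply (i j : Fin 7) : bvec i j = if j = i then 1 else 0 := by
  simp [bvec, PiLp.single_apply]

/-- The inclusion of the first `k` indices in `Fin 7`, where `k + l = 7`. -/
abbrev fstIdx {k l : ℕ} (h : k + l = 7) (a : Fin k) : Fin 7 := Fin.cast h (Fin.castAdd l a)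

/-- The inclusion of the last `l` indices in `Fin 7`, where `k + l = 7`. -/
abbrev sndIdx {k l : ℕ} (h : k + l = 7) (a : Fin l) : Fin 7 := Fin.cast h (Fin.natAdd k a)

/-- The antisymmetrized sum `∑ π, sgn π G(π)`. -/
def antisum (G : (Fin 7 → Fin 7) → ℝ) : ℝ :=
  ∑ π : Equiv.Perm (Fin 7), ((Equiv.Perm.sign π : ℤ) : ℝ) * G π

lemma dx_apply {n : ℕ} (c : Fin n → Fin 7) (v : Fin n → R7) :
    dx c v = Matrix.det (Matrix.of fun a b : Fin n => v a (c b)) := rfl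

lemma vol_apply (v : Fin 7 → R7) : vol v = Matrix.det (Matrix.of fun a b : Fin 7 => v a b) := by
  rw [vol, dx_apply]; rfl

lemma smul_sum_smul_apply {n : ℕ} {ι : Type*} [Fintype ι] (c : ℝ) (a : ι → ℝ)
    (f : ι → R7 [⋀^Fin n]→L[ℝ] ℝ) (v : Fin n → R7) :
    (c • ∑ i, a i • f i) v = c * ∑ i, a i * f i v := by
  simp [ContinuousAlternatingMap.sum_apply]

lemma insert_apply {k l n : ℕ} (h : k + l = n) (α : R7 [⋀^Fin n]→L[ℝ] ℝ) (u : Fin k → R7)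
    (v : Fin l → R7) : insert h α u v = α (fun i => Fin.append u v (Fin.cast h.symm i)) := by
  unfold insert; exact rfl

/-- Leibniz expansion of a determinant of zeros and ones: the term of π survives only on the tuple
`c ∘ π`. -/
lemma sum_dx_mul {n : ℕ} (c : Fin n → Fin 7) (g : (Fin n → Fin 7) → ℝ) :
    ∑ i : Fin n → Fin 7, dx c (fun a => bvec (i a)) * g i =
      ∑ π : Equiv.Perm (Fin n), ((Equiv.Perm.sign π : ℤ) : ℝ) * g (c ∘ π) := by
  have h : ∀ i : Fin n → Fin 7, dx c (fun a => bvec (i a)) =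
      ∑ π : Equiv.Perm (Fin n), ((Equiv.Perm.sign π : ℤ) : ℝ) * if i = c ∘ π then 1 else 0 := by
    intro i
    rw [dx_apply, ← Matrix.det_transpose, Matrix.det_apply']
    refine Finset.sum_congr rfl fun π _ => ?_
    congr 1
    simp only [Matrix.transpose_apply, Matrix.of_apply, bvec_apply]
    rw [Finset.prod_ite_zero]
    simp [funext_iff, eq_comm]
  simp only [h, Finset.sum_mul]
  rw [Finset.sum_comm]
  refine Finset.sum_congr rfl fun π _ => ?_
  simp [ite_mul]

/-- The volume form kills tuples that are not permutations. A sum over all tuples can be split into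
independent blocks of indices, which a sum over permutations cannot. -/
lemma antisum_eq_sum (G : (Fin 7 → Fin 7) → ℝ) :
    antisum G = ∑ i : Fin 7 → Fin 7, vol (fun a => bvec (i a)) * G i := by
  rw [vol, sum_dx_mul]; rfl

lemma antisum_comp_perm (G : (Fin 7 → Fin 7) → ℝ) (τ : Equiv.Perm (Fin 7)) :
    antisum (fun i => G (i ∘ τ)) = ((Equiv.Perm.sign τ : ℤ) : ℝ) * antisum G := by
  unfold antisum
  rw [Finset.mul_sum, ← Equiv.sum_comp (Equiv.mulRight τ) (fun π : Equiv.Perm (Fin 7) =>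
    ((Equiv.Perm.sign τ : ℤ) : ℝ) * (((Equiv.Perm.sign π : ℤ) : ℝ) * G π))]
  refine Finset.sum_congr rfl fun π _ => ?_
  have : ((Equiv.Perm.sign τ : ℤ) : ℝ) * ((Equiv.Perm.sign τ : ℤ) : ℝ) = 1 := by
    rcases Int.units_eq_one_or (Equiv.Perm.sign τ) with h | h <;> simp [h]
  simp only [Equiv.coe_mulRight, Equiv.Perm.sign_mul, Units.val_mul, Int.cast_mul,
    Equiv.Perm.coe_mul]
  linear_combination (-((Equiv.Perm.sign π : ℤ) : ℝ) * G (π ∘ τ)) * this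

lemma antisum_add (G H : (Fin 7 → Fin 7) → ℝ) :
    antisum (fun i => G i + H i) = antisum G + antisum H := by
  simp [antisum, mul_add, Finset.sum_add_distrib]

lemma antisum_sub (G H : (Fin 7 → Fin 7) → ℝ) :
    antisum (fun i => G i - H i) = antisum G - antisum H := by
  simp [antisum, mul_sub, Finset.sum_sub_distrib]

lemma antisum_mul (c : ℝ) (G : (Fin 7 → Fin 7) → ℝ) :
    antisum (fun i => c * G i) = c * antisum G := by
  simp only [antisum, Finset.mul_sum]
  exact Finset.sum_congr rfl fun _ _ => by ring

lemma antisum_sum {ι : Type*} (s : Finset ι) (G : ι → (Fin 7 → Fin 7) → ℝ) :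
    antisum (fun i => ∑ j ∈ s, G j i) = ∑ j ∈ s, antisum (G j) := by
  simp only [antisum, Finset.mul_sum]
  rw [Finset.sum_comm]

lemma sum_fin_append {ι : Type*} [Fintype ι] {k l : ℕ} (h : k + l = 7) (f : (Fin 7 → ι) → ℝ) :
    ∑ i : Fin 7 → ι, f i = ∑ p : Fin k → ι, ∑ q : Fin l → ι,
      f (fun a => Fin.append p q (Fin.cast h.symm a)) := by
  rw [← Fintype.sum_prod_type']
  refine (Equiv.sum_comp ((Fin.appendEquiv k l).trans
    ((finCongr h).arrowCongr (Equiv.refl ι))) f).symm.trans ?_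
  rfl

lemma det_basis_map (F : R7 →L[ℝ] R7) (η : R7 [⋀^Fin 7]→ₗ[ℝ] ℝ) (v : Fin 7 → R7) :
    η (fun a => F (v a)) = F.det * η v := by
  set b := (EuclideanSpace.basisFun (Fin 7) ℝ).toBasis
  have h := η.eq_smul_basis_det b
  have h2 := b.det_comp F.toLinearMap v
  rw [h]
  simp only [AlternatingMap.smul_apply, smul_eq_mul]
  have h3 : (fun a => F (v a)) = F.toLinearMap ∘ v := rfl
  rw [h3, h2]
  simp only [ContinuousLinearMap.det]
  ring

/-- For multilinear `G` the sum is the alternatization of `G` on the standard basis, a form of top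
degree, so a change of frame multiplies it by the determinant. -/
lemma antisum_frame (G : MultilinearMap ℝ (fun _ : Fin 7 => R7) ℝ) (F : R7 →L[ℝ] R7) :
    antisum (fun i => G (fun a => F (bvec (i a)))) =
      F.det * antisum (fun i => G (fun a => bvec (i a))) := by
  have h : ∀ v : Fin 7 → R7, MultilinearMap.alternatization G v =
      ∑ π : Equiv.Perm (Fin 7), ((Equiv.Perm.sign π : ℤ) : ℝ) * G (fun a => v (π a)) := by
    intro v
    rw [MultilinearMap.alternatization_apply]
    refine Finset.sum_congr rfl fun π _ => ?_
    rcases Int.units_eq_one_or (Equiv.Perm.sign π) with h | h <;> simp [h]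
  have := det_basis_map F (MultilinearMap.alternatization G) bvec
  rw [h, h] at this
  exact this

/-- The product of two multilinear maps with separate arguments. -/
def mulTensor {k l n : ℕ} (h : k + l = n) (f : MultilinearMap ℝ (fun _ : Fin k => R7) ℝ)
    (g : MultilinearMap ℝ (fun _ : Fin l => R7) ℝ) : MultilinearMap ℝ (fun _ : Fin n => R7) ℝ :=
  (LinearMap.mul' ℝ ℝ).compMultilinearMap
    ((f.domCoprod g).domDomCongr (finSumFinEquiv.trans (finCongr h)))

lemma mulTensor_apply {k l n : ℕ} (h : k + l = n) (f : MultilinearMap ℝ (fun _ : Fin k => R7) ℝ)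
    (g : MultilinearMap ℝ (fun _ : Fin l => R7) ℝ) (v : Fin n → R7) :
    mulTensor h f g v = f (fun a => v (Fin.cast h (Fin.castAdd l a))) *
      g (fun a => v (Fin.cast h (Fin.natAdd k a))) := rfl

/-! ### The Hodge star on components and on basis forms. -/

/-- Permuting the columns by σ puts the determinant in block form. When one group of rows consists
of basis vectors indexed by σ, an off-diagonal block vanishes and the determinant factors. -/
lemma vol_append {k l : ℕ} (h : k + l = 7) (σ : Equiv.Perm (Fin 7)) (w : Fin k → R7)
    (w' : Fin l → R7) :
    vol (fun a => Fin.append w w' (Fin.cast h.symm a)) = ((Equiv.Perm.sign σ : ℤ) : ℝ) *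
      (Matrix.fromBlocks (Matrix.of fun a b => w a (σ (fstIdx h b)))
        (Matrix.of fun a b => w a (σ (sndIdx h b)))
        (Matrix.of fun a b => w' a (σ (fstIdx h b)))
        (Matrix.of fun a b => w' a (σ (sndIdx h b)))).det := by
  have h1 := Matrix.det_permute' σ (Matrix.of fun a b : Fin 7 =>
    (Fin.append w w' (Fin.cast h.symm a)) b)
  have h2 : ((Equiv.Perm.sign σ : ℤ) : ℝ) * ((Equiv.Perm.sign σ : ℤ) : ℝ) = 1 := by
    rcases Int.units_eq_one_or (Equiv.Perm.sign σ) with h | h <;> simp [h]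
  rw [← Matrix.det_submatrix_equiv_self (finSumFinEquiv.trans (finCongr h))] at h1
  have h3 : vol (fun a => Fin.append w w' (Fin.cast h.symm a)) =
      (Matrix.of fun a b : Fin 7 => (Fin.append w w' (Fin.cast h.symm a)) b).det := vol_apply _
  rw [h3]
  calc _ = ((Equiv.Perm.sign σ : ℤ) : ℝ) * (((Equiv.Perm.sign σ : ℤ) : ℝ) *
      (Matrix.of fun a b : Fin 7 => (Fin.append w w' (Fin.cast h.symm a)) b).det) := by
        rw [← mul_assoc, h2, one_mul]
    _ = _ := by
        rw [← h1]
        congr 2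
        ext (a | a) (b | b) <;> simp [Matrix.fromBlocks]

lemma vol_append_left {k l : ℕ} (h : k + l = 7) (σ : Equiv.Perm (Fin 7)) (v : Fin l → R7) :
    vol (fun a => Fin.append (fun a => bvec (σ (fstIdx h a))) v (Fin.cast h.symm a)) =
      ((Equiv.Perm.sign σ : ℤ) : ℝ) * dx (fun a => σ (sndIdx h a)) v := by
  rw [vol_append h σ]
  have h1 : (Matrix.of fun a b => (bvec (σ (fstIdx h a)) : R7) (σ (fstIdx h b))) =
      (1 : Matrix (Fin k) (Fin k) ℝ) := by
    ext a b; simp [bvec_apply, Matrix.one_apply, eq_comm]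
  have h2 : (Matrix.of fun (a : Fin k) (b : Fin l) =>
      (bvec (σ (fstIdx h a)) : R7) (σ (sndIdx h b))) = 0 := by
    ext a b
    simp only [Matrix.of_apply, bvec_apply, EmbeddingLike.apply_eq_iff_eq, Matrix.zero_apply,
      ite_eq_right_iff, Fin.ext_iff]
    simp; omega
  rw [h1, h2, Matrix.det_fromBlocks_zero₁₂, Matrix.det_one, one_mul]; rfl

lemma vol_append_right {k l : ℕ} (h : k + l = 7) (σ : Equiv.Perm (Fin 7)) (v : Fin k → R7) :
    vol (fun a => Fin.append v (fun a => bvec (σ (sndIdx h a))) (Fin.cast h.symm a)) =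
      ((Equiv.Perm.sign σ : ℤ) : ℝ) * dx (fun a => σ (fstIdx h a)) v := by
  rw [vol_append h σ]
  have h1 : (Matrix.of fun a b => (bvec (σ (sndIdx h a)) : R7) (σ (sndIdx h b))) =
      (1 : Matrix (Fin l) (Fin l) ℝ) := by
    ext a b; simp [bvec_apply, Matrix.one_apply, eq_comm]
  have h2 : (Matrix.of fun (a : Fin l) (b : Fin k) =>
      (bvec (σ (sndIdx h a)) : R7) (σ (fstIdx h b))) = 0 := by
    ext a b
    simp only [Matrix.of_apply, bvec_apply, EmbeddingLike.apply_eq_iff_eq, Matrix.zero_apply,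
      ite_eq_right_iff, Fin.ext_iff]
    simp; omega
  rw [h1, h2, Matrix.det_fromBlocks_zero₂₁, Matrix.det_one, mul_one]; rfl

lemma sum_dx_mul_alternating {n : ℕ} (c : Fin n → Fin 7) (γ : R7 [⋀^Fin n]→L[ℝ] ℝ) :
    ∑ i : Fin n → Fin 7, dx c (fun a => bvec (i a)) * γ (fun a => bvec (i a)) =
      n.factorial * γ (fun a => bvec (c a)) := by
  rw [sum_dx_mul]
  have : ∀ π : Equiv.Perm (Fin n), ((Equiv.Perm.sign π : ℤ) : ℝ) *
      γ (fun a => bvec ((c ∘ π) a)) = γ (fun a => bvec (c a)) := by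
    intro π
    have := γ.toAlternatingMap.map_perm (fun a => bvec (c a)) π
    simp only [ContinuousAlternatingMap.coe_toAlternatingMap] at this
    have h2 : (fun a => bvec ((c ∘ π) a)) = (fun a => bvec (c a)) ∘ π := rfl
    rw [h2, this]
    rcases Int.units_eq_one_or (Equiv.Perm.sign π) with h | h <;> simp [h]
  rw [Finset.sum_congr rfl fun π _ => this π]
  simp [Fintype.card_perm]

lemma starR7_apply {k l : ℕ} (h : k + l = 7) (β : R7 [⋀^Fin k]→L[ℝ] ℝ) (v : Fin l → R7) :
    starR7 h β v = ((k.factorial : ℝ))⁻¹ * ∑ i : Fin k → Fin 7, β (fun a => bvec (i a)) *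
      vol (fun a => Fin.append (fun a => bvec (i a)) v (Fin.cast h.symm a)) := by
  unfold starR7
  rw [smul_sum_smul_apply]
  simp only [insert_apply, single_eq_bvec]

lemma starR7_perm {k l : ℕ} (h : k + l = 7) (β : R7 [⋀^Fin k]→L[ℝ] ℝ) (σ : Equiv.Perm (Fin 7)) :
    starR7 h β (fun a => bvec (σ (sndIdx h a))) =
      ((Equiv.Perm.sign σ : ℤ) : ℝ) * β (fun a => bvec (σ (fstIdx h a))) := by
  rw [starR7_apply]
  simp only [vol_append_right]
  have := sum_dx_mul_alternating (fun a => σ (fstIdx h a)) β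
  calc _ = ((k.factorial : ℝ))⁻¹ * (((Equiv.Perm.sign σ : ℤ) : ℝ) *
      ∑ i : Fin k → Fin 7, dx (fun a => σ (fstIdx h a)) (fun a => bvec (i a)) *
        β (fun a => bvec (i a))) := by
        congr 1
        rw [Finset.mul_sum]
        exact Finset.sum_congr rfl fun _ _ => by ring
    _ = _ := by rw [this]; field_simp

lemma exists_perm_comp_left {k l : ℕ} (h : k + l = 7) (π : Equiv.Perm (Fin k)) :
    ∃ τ : Equiv.Perm (Fin 7), Equiv.Perm.sign τ = Equiv.Perm.sign π ∧
      (∀ a, τ (fstIdx h a) = fstIdx h (π a)) ∧ ∀ a, τ (sndIdx h a) = sndIdx h a := by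
  refine ⟨(finSumFinEquiv.trans (finCongr h)).permCongr (Equiv.Perm.sumCongr π 1), ?_, ?_, ?_⟩
  · rw [Equiv.Perm.sign_permCongr, Equiv.Perm.sign_sumCongr]; simp
  · intro a; simp [Equiv.permCongr_apply]
  · intro a; simp [Equiv.permCongr_apply]

lemma vol_append_left_perm {k l : ℕ} (h : k + l = 7) (σ : Equiv.Perm (Fin 7))
    (π : Equiv.Perm (Fin k)) (v : Fin l → R7) (i : Fin k → Fin 7)
    (hi : ∀ a, i a = σ (fstIdx h (π a))) :
    vol (fun a => Fin.append (fun a => bvec (i a)) v (Fin.cast h.symm a)) =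
      ((Equiv.Perm.sign π : ℤ) : ℝ) *
        (((Equiv.Perm.sign σ : ℤ) : ℝ) * dx (fun a => σ (sndIdx h a)) v) := by
  obtain ⟨τ, hs, h4, h5⟩ := exists_perm_comp_left h π
  have h3 := vol_append_left h (σ * τ) v
  simp only [Equiv.Perm.mul_apply, h4, h5] at h3
  simp only [hi]
  rw [h3, Equiv.Perm.sign_mul, hs]
  push_cast
  ring

lemma starR7_dx {k l : ℕ} (h : k + l = 7) (σ : Equiv.Perm (Fin 7)) :
    starR7 h (dx (fun a => σ (fstIdx h a))) =
      ((Equiv.Perm.sign σ : ℤ) : ℝ) • dx (fun a => σ (sndIdx h a)) := by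
  ext v
  rw [starR7_apply, ContinuousAlternatingMap.smul_apply, smul_eq_mul]
  obtain ⟨g, hg⟩ : ∃ g : (Fin k → Fin 7) → ℝ, ∀ i, g i =
      vol (fun a => Fin.append (fun a => bvec (i a)) v (Fin.cast h.symm a)) := ⟨_, fun _ => rfl⟩
  simp only [← hg]
  rw [sum_dx_mul]
  have h2 : ∀ π : Equiv.Perm (Fin k), ((Equiv.Perm.sign π : ℤ) : ℝ) *
      g ((fun a => σ (fstIdx h a)) ∘ π) =
        ((Equiv.Perm.sign σ : ℤ) : ℝ) * dx (fun a => σ (sndIdx h a)) v := by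
    intro π
    rw [hg, vol_append_left_perm h σ π v ((fun a => σ (fstIdx h a)) ∘ π) fun _ => rfl]
    rcases Int.units_eq_one_or (Equiv.Perm.sign π) with h | h <;> simp [h]
  rw [Finset.sum_congr rfl fun π _ => h2 π]
  rw [Finset.sum_const, Finset.card_univ, Fintype.card_perm, Fintype.card_fin, nsmul_eq_mul,
    inv_mul_cancel_left₀ (Nat.cast_ne_zero.2 k.factorial_ne_zero)]

/-- Reduces statements about components with distinct indices to the components indexed by a
permutation, where the star is known. -/
lemma exists_perm_extend {l k : ℕ} (h : k + l = 7) (c : Fin k → Fin 7) (hc : Function.Injective c) :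
    ∃ σ : Equiv.Perm (Fin 7), ∀ a, σ (fstIdx h a) = c a := by
  have hinj : Function.Injective (fstIdx h : Fin k → Fin 7) := by
    intro a b hab; simpa [Fin.ext_iff] using hab
  let e0 : {x // x ∈ Set.range (fstIdx h : Fin k → Fin 7)} ≃ {x // x ∈ Set.range c} :=
    (Equiv.ofInjective _ hinj).symm.trans (Equiv.ofInjective c hc)
  refine ⟨e0.extendSubtype, fun a => ?_⟩
  rw [e0.extendSubtype_apply_of_mem _ ⟨a, rfl⟩]
  have : (⟨fstIdx h a, ⟨a, rfl⟩⟩ : {x // x ∈ Set.range (fstIdx h : Fin k → Fin 7)}) =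
    Equiv.ofInjective _ hinj a := rfl
  simp only [e0, Equiv.trans_apply, this, Equiv.symm_apply_apply]
  rfl

lemma sum_fin_cons {ι : Type*} [Fintype ι] {n : ℕ} (f : (Fin (n + 1) → ι) → ℝ) :
    ∑ p : Fin (n + 1) → ι, f p = ∑ a : ι, ∑ q : Fin n → ι, f (Matrix.vecCons a q) := by
  rw [← Fintype.sum_prod_type']
  exact ((Fin.consEquiv fun _ : Fin (n + 1) => ι).sum_comp f).symm

lemma sum_fin_three {ι : Type*} [Fintype ι] (f : (Fin 3 → ι) → ℝ) :
    ∑ p : Fin 3 → ι, f p = ∑ a, ∑ b, ∑ c, f ![a, b, c] := by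
  simp [sum_fin_cons, Matrix.vecEmpty, Subsingleton.elim _ (Fin.elim0 : Fin 0 → ι)]

/-! ### Integer components of the standard 3-form. -/

/-- The integer components of the form `dx^p ∧ dx^q ∧ dx^r`. -/
def dxTable (p q r a b c : Fin 7) : ℤ :=
  let δ : Fin 7 → Fin 7 → ℤ := fun i j => if i = j then 1 else 0
  δ p a * (δ q b * δ r c - δ r b * δ q c) - δ q a * (δ p b * δ r c - δ r b * δ p c) +
    δ r a * (δ p b * δ q c - δ q b * δ p c)

/-- The integer components of the form `phi0`. -/
def phiTable (a b c : Fin 7) : ℤ :=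
  dxTable 0 1 2 a b c + dxTable 0 3 4 a b c + dxTable 0 5 6 a b c + dxTable 1 3 5 a b c -
    dxTable 1 4 6 a b c - dxTable 2 3 6 a b c - dxTable 2 4 5 a b c

lemma dx_bvec (p q r a b c : Fin 7) :
    dx ![p, q, r] ![bvec a, bvec b, bvec c] = (dxTable p q r a b c : ℝ) := by
  rw [dx_apply, Matrix.det_fin_three]
  simp only [Matrix.of_apply, bvec_apply, dxTable, Matrix.cons_val]
  push_cast
  ring

lemma phi0_bvec (a b c : Fin 7) :
    phi0 ![bvec a, bvec b, bvec c] = (phiTable a b c : ℝ) := by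
  simp only [phi0, phiTable, ContinuousAlternatingMap.add_apply, ContinuousAlternatingMap.sub_apply,
    dx_bvec]
  push_cast
  ring

lemma phiTable_contract : ∀ i j : Fin 7, ∑ k, ∑ l, phiTable i k l * phiTable j k l =
    if i = j then 6 else 0 := by
  decide +kernel

/-! ### Star as an involution, and wedge products with a star. -/

/-- Exchanging blocks of lengths k and l has sign (-1)^(kl), and one of k, l is even because their
sum is 7. This is why ⋆⋆ = 1 in every degree. -/
lemma exists_perm_flip {k l : ℕ} (h : k + l = 7) (h' : l + k = 7) :
    ∃ τ : Equiv.Perm (Fin 7), Equiv.Perm.sign τ = 1 ∧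
      (∀ a, τ (fstIdx h' a) = sndIdx h a) ∧ ∀ a, τ (sndIdx h' a) = fstIdx h a := by
  refine ⟨(finCongr h').symm.trans (finAddFlip.trans (finCongr h)), ?_, ?_, ?_⟩
  · have hk : k ≤ 7 := by omega
    obtain rfl : l = 7 - k := by omega
    revert h h'
    interval_cases k <;> decide +kernel
  · intro a; simp
  · intro a; simp

lemma append_bvec {k l : ℕ} (h : k + l = 7) (p : Fin k → Fin 7) (q : Fin l → Fin 7) :
    (fun a : Fin 7 => bvec (Fin.append p q (Fin.cast h.symm a))) =
      fun a => Fin.append (fun a => bvec (p a)) (fun a => bvec (q a)) (Fin.cast h.symm a) := by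
  funext a
  induction Fin.cast h.symm a using Fin.addCases <;> simp

lemma map_comp_perm (η : R7 [⋀^Fin 7]→L[ℝ] ℝ) (f : Fin 7 → R7) (τ : Equiv.Perm (Fin 7))
    (hτ : Equiv.Perm.sign τ = 1) : η (f ∘ τ) = η f := by
  have h := η.toAlternatingMap.map_perm f τ
  rwa [hτ, one_smul] at h

lemma append_comp_perm {k l : ℕ} (h : k + l = 7) (h' : l + k = 7) (w : Fin k → R7)
    (w' : Fin l → R7) (τ : Equiv.Perm (Fin 7)) (h2 : ∀ a, τ (fstIdx h' a) = sndIdx h a)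
    (h3 : ∀ a, τ (sndIdx h' a) = fstIdx h a) :
    (fun a => Fin.append w w' (Fin.cast h.symm a)) ∘ τ =
      fun a => Fin.append w' w (Fin.cast h'.symm a) := by
  funext a
  obtain ⟨b, rfl⟩ : ∃ b : Fin (l + k), a = Fin.cast h' b := ⟨Fin.cast h'.symm a, rfl⟩
  induction b using Fin.addCases with
  | left b => simp only [Function.comp_apply, h2]; simp
  | right b => simp only [Function.comp_apply, h3]; simp

lemma map_append_comm (η : R7 [⋀^Fin 7]→L[ℝ] ℝ) {k l : ℕ} (h : k + l = 7) (h' : l + k = 7)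
    (w : Fin k → R7) (w' : Fin l → R7) : η (fun a => Fin.append w w' (Fin.cast h.symm a)) =
      η (fun a => Fin.append w' w (Fin.cast h'.symm a)) := by
  obtain ⟨τ, h1, h2, h3⟩ := exists_perm_flip h h'
  rw [← append_comp_perm h h' w w' τ h2 h3, map_comp_perm _ _ _ h1]

lemma sum_append_mul (V : (Fin 7 → R7) → ℝ) {k l : ℕ} (h : k + l = 7)
    (X : (Fin k → Fin 7) → ℝ) (Z : (Fin l → Fin 7) → ℝ) :
    ∑ i : Fin 7 → Fin 7, V (fun a => bvec (i a)) *
        (X (fun a => i (fstIdx h a)) * Z (fun a => i (sndIdx h a))) =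
      ∑ p, X p * ∑ q, Z q * V (fun a =>
        Fin.append (fun a => bvec (p a)) (fun a => bvec (q a)) (Fin.cast h.symm a)) := by
  rw [sum_fin_append h]
  refine Finset.sum_congr rfl fun p _ => ?_
  rw [Finset.mul_sum]
  refine Finset.sum_congr rfl fun q _ => ?_
  rw [append_bvec h]
  have h1 : (fun a => Fin.append p q (Fin.cast h.symm (fstIdx h a))) = p := by
    funext a; simp
  have h2 : (fun a => Fin.append p q (Fin.cast h.symm (sndIdx h a))) = q := by
    funext a; simp
  rw [h1, h2]
  ring

lemma antisum_mul_eq {k l : ℕ} (h : k + l = 7) (X : (Fin k → Fin 7) → ℝ)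
    (Z : (Fin l → Fin 7) → ℝ) :
    antisum (fun i => X (fun a => i (fstIdx h a)) * Z (fun a => i (sndIdx h a))) =
      ∑ p, X p * ∑ q, Z q * vol (fun a =>
        Fin.append (fun a => bvec (p a)) (fun a => bvec (q a)) (Fin.cast h.symm a)) := by
  rw [antisum_eq_sum, sum_append_mul (⇑vol) h]

lemma eq_of_perm {k l : ℕ} (h : k + l = 7) {α β : R7 [⋀^Fin k]→L[ℝ] ℝ}
    (H : ∀ σ : Equiv.Perm (Fin 7), α (fun a => bvec (σ (fstIdx h a))) =
      β (fun a => bvec (σ (fstIdx h a)))) : α = β := by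
  apply ContinuousAlternatingMap.toAlternatingMap_injective
  refine (EuclideanSpace.basisFun (Fin 7) ℝ).toBasis.ext_alternating fun c hc => ?_
  obtain ⟨σ, hσ⟩ := exists_perm_extend h c hc
  have := H σ
  simp only [hσ] at this
  simpa [single_eq_bvec] using this

lemma starR7_starR7 {k l : ℕ} (h : k + l = 7) (h' : l + k = 7) (β : R7 [⋀^Fin k]→L[ℝ] ℝ) :
    starR7 h' (starR7 h β) = β := by
  refine eq_of_perm h fun σ => ?_
  obtain ⟨τ, h1, h2, h3⟩ := exists_perm_flip h h'
  have h4 := starR7_perm h' (starR7 h β) (σ * τ)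
  simp only [Equiv.Perm.mul_apply, h2, h3] at h4
  rw [h4, starR7_perm, Equiv.Perm.sign_mul, h1, mul_one]
  rcases Int.units_eq_one_or (Equiv.Perm.sign σ) with h | h <;> simp [h]

lemma starR7_injective {k l : ℕ} (h : k + l = 7) : Function.Injective (starR7 h) := by
  intro α β H
  rw [← starR7_starR7 h ((add_comm _ _).trans h) α, H, starR7_starR7]

/-- The relation X ∧ ⋆γ = ⟨X, γ⟩ vol in components. `X` need not be alternating, since pairing with
γ antisymmetrizes it. -/
lemma antisum_mul_star {k l : ℕ} (h : k + l = 7) (X : (Fin k → Fin 7) → ℝ)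
    (γ : R7 [⋀^Fin k]→L[ℝ] ℝ) :
    antisum (fun i => X (fun a => i (fstIdx h a)) *
        starR7 h γ (fun a => bvec (i (sndIdx h a)))) =
      l.factorial * ∑ p, X p * γ (fun a => bvec (p a)) := by
  have h' : l + k = 7 := (add_comm _ _).trans h
  rw [antisum_mul_eq h X fun q => starR7 h γ (fun a => bvec (q a)), Finset.mul_sum]
  refine Finset.sum_congr rfl fun p _ => ?_
  simp only [map_append_comm vol h h']
  have h1 := starR7_apply h' (starR7 h γ) (fun a => bvec (p a))
  rw [starR7_starR7, eq_inv_mul_iff_mul_eq₀ (Nat.cast_ne_zero.2 l.factorial_ne_zero)] at h1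
  rw [← h1]
  ring

/-- A basis form in the last slots fixes the last indices up to order, so only permutations of the
first block remain. This brings sums over 5040 permutations down to sizes that can be evaluated. -/
lemma antisum_mul_dx {k l : ℕ} (h : k + l = 7) (X : (Fin k → Fin 7) → ℝ)
    (σ : Equiv.Perm (Fin 7)) :
    antisum (fun i => X (fun a => i (fstIdx h a)) *
        dx (fun a => σ (sndIdx h a)) (fun a => bvec (i (sndIdx h a)))) =
      l.factorial * ((Equiv.Perm.sign σ : ℤ) : ℝ) *
        ∑ π : Equiv.Perm (Fin k), ((Equiv.Perm.sign π : ℤ) : ℝ) *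
          X ((fun a => σ (fstIdx h a)) ∘ π) := by
  have h1 := antisum_mul_star h X (dx (fun a => σ (fstIdx h a)))
  rw [starR7_dx] at h1
  simp only [ContinuousAlternatingMap.smul_apply, smul_eq_mul, mul_left_comm (X _)] at h1
  rw [antisum_mul] at h1
  rw [← sum_dx_mul]
  simp only [mul_comm (dx _ _) (X _)]
  rw [mul_right_comm, ← h1]
  rcases Int.units_eq_one_or (Equiv.Perm.sign σ) with h | h <;> simp [h]

/-- The terms of `phi0`: the sign, and a permutation whose last three entries are the indices. -/
def phiTerms : Fin 7 → ℤ × (Fin 7 → Fin 7) × (Fin 7 → Fin 7) :=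
  ![(1, ![3, 4, 5, 6, 0, 1, 2], ![4, 5, 6, 0, 1, 2, 3]),
    (1, ![1, 2, 5, 6, 0, 3, 4], ![4, 0, 1, 5, 6, 2, 3]),
    (1, ![1, 2, 3, 4, 0, 5, 6], ![4, 0, 1, 2, 3, 5, 6]),
    (1, ![0, 2, 4, 6, 1, 3, 5], ![0, 4, 1, 5, 2, 6, 3]),
    (-1, ![0, 2, 3, 5, 1, 4, 6], ![0, 4, 1, 2, 5, 3, 6]),
    (-1, ![0, 1, 4, 5, 2, 3, 6], ![0, 1, 4, 5, 2, 3, 6]),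
    (-1, ![0, 1, 3, 6, 2, 4, 5], ![0, 1, 4, 2, 5, 6, 3])]

/-- The permutation in a term of `phi0`. -/
def phiPerm (t : Fin 7) : Equiv.Perm (Fin 7) where
  toFun := (phiTerms t).2.1
  invFun := (phiTerms t).2.2
  left_inv := by revert t; decide +kernel
  right_inv := by revert t; decide +kernel

lemma phi0_eq_sum : phi0 = ∑ t : Fin 7, ((phiTerms t).1 : ℝ) •
    dx (fun a : Fin 3 => phiPerm t (sndIdx (k := 4) rfl a)) := by
  have h : ∀ t : Fin 7, (fun a : Fin 3 => phiPerm t (sndIdx (k := 4) rfl a)) =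
      ![(phiTerms t).2.1 4, (phiTerms t).2.1 5, (phiTerms t).2.1 6] := by
    intro t; funext a; fin_cases a <;> rfl
  simp only [h, Fin.sum_univ_seven]
  ext v
  simp only [phiTerms, phi0, ContinuousAlternatingMap.add_apply,
    ContinuousAlternatingMap.sub_apply, ContinuousAlternatingMap.smul_apply, smul_eq_mul,
    Matrix.cons_val]
  push_cast
  ring

/-- Finite verification of Bryant's identity ι_u φ₀ ∧ ι_v φ₀ ∧ φ₀ = 6⟨u, v⟩ vol on basis vectors.
Expanding the last factor into its seven monomials leaves 7 · 24 terms for each pair. -/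
lemma phiTable_quadratic : ∀ u v : Fin 7, ∑ t : Fin 7, (phiTerms t).1 *
    ((Equiv.Perm.sign (phiPerm t) : ℤ) * ∑ π : Equiv.Perm (Fin 4), (Equiv.Perm.sign π : ℤ) *
      (phiTable u (phiPerm t (fstIdx (l := 3) rfl (π 0))) (phiPerm t (fstIdx (l := 3) rfl (π 1))) *
      phiTable v (phiPerm t (fstIdx (l := 3) rfl (π 2))) (phiPerm t (fstIdx (l := 3) rfl (π 3))))) =
    if u = v then 24 else 0 := by
  decide +kernel

lemma sum_smul_bvec (u : R7) : ∑ j, u j • bvec j = u := by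
  ext a
  simp [bvec_apply]

lemma vecCons_eq_sum {n : ℕ} (α : R7 [⋀^Fin (n + 1)]→L[ℝ] ℝ) (u : R7) (w : Fin n → R7) :
    α (Matrix.vecCons u w) = ∑ j, u j * α (Matrix.vecCons (bvec j) w) := by
  rw [← ContinuousAlternatingMap.curryLeft_apply_apply]
  conv_lhs => rw [← sum_smul_bvec u]
  simp [ContinuousAlternatingMap.sum_apply]

lemma linear_eq_sum (lam : R7 →L[ℝ] ℝ) (u : R7) : lam u = ∑ j, u j * lam (bvec j) := by
  conv_lhs => rw [← sum_smul_bvec u]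
  simp

/-! ### The exterior derivative under antisymmetrization -/

/-- The k + 1 terms of the alternatization differ by cyclic permutations of the first block, whose
signs cancel the alternating signs. All contribute equally, so inside an antisymmetrized sum an
exterior derivative may be replaced by a plain derivative. -/
lemma antisum_alternatizeUncurryFin {k l : ℕ} (h : k + 1 + l = 7)
    (L : R7 →L[ℝ] R7 [⋀^Fin k]→L[ℝ] ℝ) (Y : (Fin l → Fin 7) → ℝ) :
    antisum (fun i => ContinuousAlternatingMap.alternatizeUncurryFin L
        (fun a => bvec (i (fstIdx h a))) * Y (fun a => i (sndIdx h a))) =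
      (k + 1) * antisum (fun i => L (bvec (i (fstIdx h 0)))
        (fun a => bvec (i (fstIdx h a.succ))) * Y (fun a => i (sndIdx h a))) := by
  simp only [ContinuousAlternatingMap.alternatizeUncurryFin_apply, Finset.sum_mul]
  rw [antisum_sum]
  have key : ∀ p : Fin (k + 1), antisum (fun i => ((-1 : ℤ) ^ (p : ℕ) •
      L (bvec (i (fstIdx h p))) (p.removeNth fun a => bvec (i (fstIdx h a)))) *
        Y (fun a => i (sndIdx h a))) = antisum (fun i => L (bvec (i (fstIdx h 0)))
        (fun a => bvec (i (fstIdx h a.succ))) * Y (fun a => i (sndIdx h a))) := by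
    intro p
    obtain ⟨τ, h1, h2, h3⟩ := exists_perm_comp_left h p.cycleRange.symm
    have h4 := antisum_comp_perm (fun i => L (bvec (i (fstIdx h 0)))
        (fun a => bvec (i (fstIdx h a.succ))) * Y (fun a => i (sndIdx h a))) τ
    simp only [Function.comp_apply, h2, h3, h1, Equiv.Perm.sign_symm, Fin.sign_cycleRange,
      Fin.cycleRange_symm_zero, Fin.cycleRange_symm_succ] at h4
    simp only [zsmul_eq_mul, mul_assoc]
    rw [antisum_mul]
    have h5 : ∀ i : Fin 7 → Fin 7, (p.removeNth fun a => bvec (i (fstIdx h a))) =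
      fun a => bvec (i (fstIdx h (p.succAbove a))) := fun i => rfl
    simp only [h5]
    rw [h4, ← mul_assoc]
    push_cast
    rw [← mul_pow]
    simp
  rw [Finset.sum_congr rfl fun p _ => key p]
  simp

/-- Contraction with `u` in the form variable of a form-valued linear map. -/
def contract {n : ℕ} (u : R7) (L : R7 →L[ℝ] R7 [⋀^Fin (n + 1)]→L[ℝ] ℝ) :
    R7 →L[ℝ] R7 [⋀^Fin n]→L[ℝ] ℝ :=
  (ContinuousLinearMap.apply ℝ _ u).comp
    ((ContinuousAlternatingMap.curryLeftLI (𝕜 := ℝ) (E := R7) (F := ℝ)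
      (n := n)).toContinuousLinearMap.comp L)

lemma contract_apply {n : ℕ} (u : R7) (L : R7 →L[ℝ] R7 [⋀^Fin (n + 1)]→L[ℝ] ℝ) (x : R7)
    (w : Fin n → R7) : contract u L x w = L x (Matrix.vecCons u w) := rfl

/-- Cartan's formula for a constant vector: ι_u d = ∂_u - d ι_u. -/
lemma alternatizeUncurryFin_vecCons {n : ℕ} (L : R7 →L[ℝ] R7 [⋀^Fin (n + 1)]→L[ℝ] ℝ) (u : R7)
    (w : Fin (n + 1) → R7) :
    ContinuousAlternatingMap.alternatizeUncurryFin L (Matrix.vecCons u w) =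
      L u w - ContinuousAlternatingMap.alternatizeUncurryFin (contract u L) w := by
  rw [ContinuousAlternatingMap.alternatizeUncurryFin_apply,
    ContinuousAlternatingMap.alternatizeUncurryFin_apply, Fin.sum_univ_succ, sub_eq_add_neg,
    ← Finset.sum_neg_distrib]
  congr 1
  · simp [Matrix.vecCons]
  · refine Finset.sum_congr rfl fun p _ => ?_
    rw [contract_apply]
    have h1 : Fin.removeNth p.succ (Matrix.vecCons u w) =
        Matrix.vecCons u (Fin.removeNth p w) := by
      funext a
      refine Fin.cases ?_ (fun a => ?_) a <;> simp [Fin.removeNth]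
    rw [h1]
    simp [pow_succ]

/-! ### Contractions in an adapted frame -/

/-- The determinant of a frame. -/
abbrev frameDet (F : R7 ≃L[ℝ] R7) : ℝ := (F : R7 →L[ℝ] R7).det

/-- The pullback of a form by a frame. -/
abbrev pull {n : ℕ} (F : R7 ≃L[ℝ] R7) (α : R7 [⋀^Fin n]→L[ℝ] ℝ) : R7 [⋀^Fin n]→L[ℝ] ℝ :=
  α.compContinuousLinearMap (F : R7 →L[ℝ] R7)

/-- The star pairing moved to an arbitrary frame. The determinant is the volume density, and the
arguments `F.symm (bvec _)` form an orthonormal basis for the pulled back metric. -/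
lemma antisum_mul_star_frame {k l : ℕ} (h : k + l = 7) (F : R7 ≃L[ℝ] R7)
    (f : MultilinearMap ℝ (fun _ : Fin k => R7) ℝ) (γ : R7 [⋀^Fin k]→L[ℝ] ℝ) :
    antisum (fun i => f (fun a => bvec (i (fstIdx h a))) *
        pull F (starR7 h γ) (fun a => bvec (i (sndIdx h a)))) =
      frameDet F * (l.factorial * ∑ p : Fin k → Fin 7, f (fun a => F.symm (bvec (p a))) *
        γ (fun a => bvec (p a))) := by
  have h1 := antisum_frame (mulTensor h
    (f.compLinearMap fun _ => (F.symm : R7 →L[ℝ] R7).toLinearMap)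
    (starR7 h γ).toMultilinearMap) (F : R7 →L[ℝ] R7)
  have h2 := antisum_mul_star h (fun p => f (fun a => F.symm (bvec (p a)))) γ
  simp only [mulTensor_apply, MultilinearMap.compLinearMap_apply] at h1
  rw [← h2]
  refine Eq.trans ?_ h1
  refine congrArg antisum (funext fun i => ?_)
  exact congrArg₂ (· * ·) (congrArg f (funext fun a => (F.symm_apply_apply _).symm)) rfl

lemma eta_three {α : Type*} (g : Fin 3 → α) : g = ![g 0, g 1, g 2] := by
  funext a; fin_cases a <;> rfl

/-- The permutation is given with its inverse as explicit tables so that its sign can be evaluated.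
The swaps below use that blocks of degrees p and q commute up to (-1)^(pq). -/
lemma antisum_reindex (f g : Fin 7 → Fin 7) (hl : Function.LeftInverse g f)
    (hr : Function.RightInverse g f) (s : ℤˣ)
    (hs : Equiv.Perm.sign (⟨f, g, hl, hr⟩ : Equiv.Perm (Fin 7)) = s)
    (G H : (Fin 7 → Fin 7) → ℝ) (h : ∀ i, H i = G fun a => i (f a)) :
    antisum H = ((s : ℤ) : ℝ) * antisum G := by
  rw [← hs, ← antisum_comp_perm G ⟨f, g, hl, hr⟩]
  exact congrArg antisum (funext h)

lemma antisum_swap_four_two (a : Fin 7 → ℝ) (P : Fin 7 → Fin 7 → Fin 7 → Fin 7 → ℝ)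
    (Q : Fin 7 → Fin 7 → ℝ) :
    antisum (fun i => a (i 0) * (P (i 1) (i 2) (i 3) (i 4) * Q (i 5) (i 6))) =
      antisum (fun i => a (i 0) * Q (i 1) (i 2) * P (i 3) (i 4) (i 5) (i 6)) := by
  rw [antisum_reindex ![0, 5, 6, 1, 2, 3, 4] ![0, 3, 4, 5, 6, 1, 2] (by decide) (by decide) 1
    (by decide +kernel) (fun i => a (i 0) * Q (i 1) (i 2) * P (i 3) (i 4) (i 5) (i 6)) _
    (fun i => by simp only [Matrix.cons_val]; ring), Units.val_one, Int.cast_one, one_mul]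

lemma antisum_swap_three_three (a : Fin 7 → ℝ) (P Q : Fin 7 → Fin 7 → Fin 7 → ℝ) :
    antisum (fun i => a (i 0) * (P (i 1) (i 2) (i 3) * Q (i 4) (i 5) (i 6))) =
      -antisum (fun i => a (i 0) * Q (i 1) (i 2) (i 3) * P (i 4) (i 5) (i 6)) := by
  rw [antisum_reindex ![0, 4, 5, 6, 1, 2, 3] ![0, 4, 5, 6, 1, 2, 3] (by decide) (by decide) (-1)
    (by decide +kernel) (fun i => a (i 0) * Q (i 1) (i 2) (i 3) * P (i 4) (i 5) (i 6)) _
    (fun i => by simp only [Matrix.cons_val]; ring)]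
  simp

lemma antisum_swap_three_four (P : Fin 7 → Fin 7 → Fin 7 → ℝ)
    (Q : Fin 7 → Fin 7 → Fin 7 → Fin 7 → ℝ) :
    antisum (fun i => P (i 0) (i 1) (i 2) * Q (i 3) (i 4) (i 5) (i 6)) =
      antisum (fun i => Q (i 0) (i 1) (i 2) (i 3) * P (i 4) (i 5) (i 6)) := by
  rw [antisum_reindex ![3, 4, 5, 6, 0, 1, 2] ![4, 5, 6, 0, 1, 2, 3] (by decide) (by decide) 1
    (by decide +kernel) (fun i => Q (i 0) (i 1) (i 2) (i 3) * P (i 4) (i 5) (i 6)) _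
    (fun i => by simp only [Matrix.cons_val]; ring), Units.val_one, Int.cast_one, one_mul]

/-! ### Contraction identities of the standard 3-form. -/

lemma phi0_contract_bvec (i j : Fin 7) :
    ∑ b, ∑ c, phi0 ![bvec i, bvec b, bvec c] * phi0 ![bvec j, bvec b, bvec c] =
      if i = j then 6 else 0 := by
  have := phiTable_contract i j
  simp only [phi0_bvec]
  exact_mod_cast this

lemma phi0_contract (u : R7) (j : Fin 7) :
    ∑ b, ∑ c, phi0 ![u, bvec b, bvec c] * phi0 ![bvec j, bvec b, bvec c] = 6 * u j := by
  simp only [vecCons_eq_sum phi0 u, Finset.sum_mul]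
  have h : ∀ b : Fin 7, ∑ c, ∑ i, u i * phi0 ![bvec i, bvec b, bvec c] *
      phi0 ![bvec j, bvec b, bvec c] = ∑ i, ∑ c, u i * phi0 ![bvec i, bvec b, bvec c] *
      phi0 ![bvec j, bvec b, bvec c] := fun b => Finset.sum_comm
  simp only [h]
  rw [Finset.sum_comm]
  simp only [mul_assoc, ← Finset.mul_sum, phi0_contract_bvec]
  simp [mul_comm]

/-- The squared norm is 7, counted over ordered triples: 42 = 3! · 7. -/
lemma phi0_norm_sq : ∑ p : Fin 3 → Fin 7, phi0 (fun a => bvec (p a)) *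
    phi0 (fun a => bvec (p a)) = 42 := by
  rw [sum_fin_three]
  have h : ∀ a b c : Fin 7, (fun x => bvec (![a, b, c] x)) = ![bvec a, bvec b, bvec c] := by
    intro a b c; exact eta_three _
  simp only [h, phi0_contract_bvec]
  norm_num

/-- Bryant's identity with its factor 6 and the normalization 2! · 2! · 3! = 24, which gives 144. -/
lemma antisum_phi0_quadratic (u v : R7) :
    antisum (fun i => phi0 ![u, bvec (i 0), bvec (i 1)] * phi0 ![v, bvec (i 2), bvec (i 3)] *
      phi0 ![bvec (i 4), bvec (i 5), bvec (i 6)]) = 144 * ∑ j, u j * v j := by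
  have key : ∀ j k : Fin 7, antisum (fun i => phi0 ![bvec j, bvec (i 0), bvec (i 1)] *
      phi0 ![bvec k, bvec (i 2), bvec (i 3)] * phi0 ![bvec (i 4), bvec (i 5), bvec (i 6)]) =
      if j = k then 144 else 0 := by
    intro j k
    have h1 : ∀ i : Fin 7 → Fin 7, phi0 ![bvec (i 4), bvec (i 5), bvec (i 6)] =
        ∑ t : Fin 7, ((phiTerms t).1 : ℝ) *
        dx (fun a : Fin 3 => phiPerm t (sndIdx (k := 4) rfl a))
          (fun a => bvec (i (sndIdx (k := 4) rfl a))) := by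
      intro i
      have h0 : ![bvec (i 4), bvec (i 5), bvec (i 6)] =
          fun a => bvec (i (sndIdx (k := 4) rfl a)) := by funext a; fin_cases a <;> rfl
      rw [h0]
      conv_lhs => rw [phi0_eq_sum]
      simp [ContinuousAlternatingMap.sum_apply]
    simp only [h1, Finset.mul_sum]
    rw [antisum_sum]
    have h2 : ∀ t : Fin 7, antisum (fun i => phi0 ![bvec j, bvec (i 0), bvec (i 1)] *
        phi0 ![bvec k, bvec (i 2), bvec (i 3)] * (((phiTerms t).1 : ℝ) *
        dx (fun a : Fin 3 => phiPerm t (sndIdx (k := 4) rfl a))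
          (fun a => bvec (i (sndIdx (k := 4) rfl a))))) = (6 * ((phiTerms t).1 *
    ((Equiv.Perm.sign (phiPerm t) : ℤ) * ∑ π : Equiv.Perm (Fin 4), (Equiv.Perm.sign π : ℤ) *
      (phiTable j (phiPerm t (fstIdx (l := 3) rfl (π 0))) (phiPerm t (fstIdx (l := 3) rfl (π 1))) *
      phiTable k (phiPerm t (fstIdx (l := 3) rfl (π 2)))
        (phiPerm t (fstIdx (l := 3) rfl (π 3)))))) : ℤ) := by
      -- The factor 6 is 3!, from the block filled by the monomial.
      intro t
      have h3 := antisum_mul_dx (k := 4) (l := 3) rfl (fun p : Fin 4 → Fin 7 =>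
        phi0 ![bvec j, bvec (p 0), bvec (p 1)] * phi0 ![bvec k, bvec (p 2), bvec (p 3)])
        (phiPerm t)
      simp only [mul_left_comm _ ((phiTerms t).1 : ℝ)]
      rw [antisum_mul]
      refine (congrArg _ h3).trans ?_
      simp only [phi0_bvec, Function.comp_apply]
      push_cast
      rw [show (Nat.factorial 3 : ℝ) = 6 by norm_num [Nat.factorial]]
      ring
    rw [Finset.sum_congr rfl fun t _ => h2 t, ← Int.cast_sum, ← Finset.mul_sum,
      phiTable_quadratic]
    split_ifs <;> norm_num
  have h1 : ∀ i : Fin 7 → Fin 7, phi0 ![u, bvec (i 0), bvec (i 1)] *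
      phi0 ![v, bvec (i 2), bvec (i 3)] * phi0 ![bvec (i 4), bvec (i 5), bvec (i 6)] =
      ∑ j, ∑ k, (u j * v k) * (phi0 ![bvec j, bvec (i 0), bvec (i 1)] *
      phi0 ![bvec k, bvec (i 2), bvec (i 3)] * phi0 ![bvec (i 4), bvec (i 5), bvec (i 6)]) := by
    intro i
    rw [vecCons_eq_sum phi0 u, vecCons_eq_sum phi0 v, Finset.sum_mul_sum, Finset.sum_mul]
    refine Finset.sum_congr rfl fun j _ => ?_
    rw [Finset.sum_mul]
    exact Finset.sum_congr rfl fun k _ => by ring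
  simp only [h1]
  rw [antisum_sum, Finset.mul_sum]
  refine Finset.sum_congr rfl fun j _ => ?_
  rw [antisum_sum]
  simp only [antisum_mul, key]
  simp
  ring

/-! ### The same identities in an arbitrary adapted frame. -/

section Frame

variable (F : R7 ≃L[ℝ] R7)

lemma antisum_mul_psi (α : R7 [⋀^Fin 3]→L[ℝ] ℝ) :
    antisum (fun i => α ![bvec (i 0), bvec (i 1), bvec (i 2)] *
      pull F (starR7 (k := 3) (l := 4) rfl phi0)
        ![bvec (i 3), bvec (i 4), bvec (i 5), bvec (i 6)]) =
      24 * frameDet F * ∑ p : Fin 3 → Fin 7, α (fun a => F.symm (bvec (p a))) *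
        phi0 (fun a => bvec (p a)) := by
  have h := antisum_mul_star_frame (k := 3) (l := 4) rfl F α.toMultilinearMap phi0
  rw [show (Nat.factorial 4 : ℝ) = 24 by norm_num [Nat.factorial]] at h
  rw [mul_comm (24 : ℝ), mul_assoc]
  refine Eq.trans (congrArg antisum (funext fun i => ?_)) h
  exact congrArg₂ (· * ·) (congrArg α (by funext a; fin_cases a <;> rfl)) (congrArg _ (by funext a; fin_cases a <;> rfl))

lemma antisum_phi_mul_psi :
    antisum (fun i => pull F phi0 ![bvec (i 0), bvec (i 1), bvec (i 2)] *
      pull F (starR7 (k := 3) (l := 4) rfl phi0)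
        ![bvec (i 3), bvec (i 4), bvec (i 5), bvec (i 6)]) = 1008 * frameDet F := by
  rw [antisum_mul_psi]
  simp only [ContinuousAlternatingMap.compContinuousLinearMap_apply, Function.comp_def,
    ContinuousLinearEquiv.coe_coe, ContinuousLinearEquiv.apply_symm_apply]
  rw [phi0_norm_sq]
  ring

/-- A linear form as a multilinear map in one variable. -/
def multiOne (lam : R7 →L[ℝ] ℝ) : MultilinearMap ℝ (fun _ : Fin 1 => R7) ℝ :=
  MultilinearMap.ofSubsingleton ℝ R7 ℝ (0 : Fin 1) lam.toLinearMap

/-- The identity λ ∧ ⋆ω ∧ ι_u ω = 3 λ(u) vol; here 144 = 3 · 1! · 4! · 2!. The left side equals ⟨λ ∧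
ι_u ω, ω⟩ vol, which the contraction `phi0_contract` evaluates. -/
lemma antisum_linear_psi_phi (lam : R7 →L[ℝ] ℝ) (u : R7) :
    antisum (fun i => lam (bvec (i 0)) * (pull F (starR7 (k := 3) (l := 4) rfl phi0)
        ![bvec (i 1), bvec (i 2), bvec (i 3), bvec (i 4)] *
          pull F phi0 ![u, bvec (i 5), bvec (i 6)])) = 144 * frameDet F * lam u := by
  have h := antisum_mul_star_frame (k := 3) (l := 4) rfl F (mulTensor (k := 1) (l := 2) rfl
    (multiOne lam) ((pull F phi0).curryLeft u).toMultilinearMap) phi0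
  rw [antisum_swap_four_two (fun a => lam (bvec a)) (fun a b c d =>
    pull F (starR7 (k := 3) (l := 4) rfl phi0) ![bvec a, bvec b, bvec c, bvec d])
    (fun a b => pull F phi0 ![u, bvec a, bvec b])]
  have h4 : ∀ i : Fin 7 → Fin 7, lam (bvec (i 0)) * pull F phi0 ![u, bvec (i 1), bvec (i 2)] *
      pull F (starR7 (k := 3) (l := 4) rfl phi0)
        ![bvec (i 3), bvec (i 4), bvec (i 5), bvec (i 6)] =
      (mulTensor (k := 1) (l := 2) rfl (multiOne lam) ((pull F phi0).curryLeft u).toMultilinearMap)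
        (fun a => bvec (i (fstIdx (k := 3) (l := 4) rfl a))) *
        pull F (starR7 (k := 3) (l := 4) rfl phi0)
          (fun a => bvec (i (sndIdx (k := 3) (l := 4) rfl a))) := by
    intro i
    rw [mulTensor_apply]
    exact congrArg₂ (· * ·) (congrArg₂ (· * ·) rfl (congrArg _ (by funext a; fin_cases a <;> rfl)))
      (congrArg _ (by funext a; fin_cases a <;> rfl))
  simp only [h4]
  rw [h, sum_fin_three]
  have h5 : ∀ a b c : Fin 7, (mulTensor (k := 1) (l := 2) rfl (multiOne lam)
      ((pull F phi0).curryLeft u).toMultilinearMap) (fun x => F.symm (bvec (![a, b, c] x))) *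
      phi0 (fun x => bvec (![a, b, c] x)) = lam (F.symm (bvec a)) *
        (phi0 ![F u, bvec b, bvec c] * phi0 ![bvec a, bvec b, bvec c]) := by
    intro a b c
    rw [mulTensor_apply, ← mul_assoc]
    refine congrArg₂ (· * ·) (congrArg₂ (· * ·) rfl (congrArg phi0 ?_))
      (congrArg phi0 (eta_three _))
    funext x
    fin_cases x
    · rfl
    · exact F.apply_symm_apply _
    · exact F.apply_symm_apply _
  simp only [h5, ← Finset.mul_sum, phi0_contract]
  rw [show (Nat.factorial 4 : ℝ) = 24 by norm_num [Nat.factorial]]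
  have h6 := linear_eq_sum (lam.comp (F.symm : R7 →L[ℝ] R7)) (F u)
  simp only [ContinuousLinearMap.comp_apply, ContinuousLinearEquiv.coe_coe,
    ContinuousLinearEquiv.symm_apply_apply] at h6
  rw [h6, Finset.mul_sum, Finset.mul_sum, Finset.mul_sum]
  exact Finset.sum_congr rfl fun _ _ => by ring

/-- The form `⋆β` for the metric and orientation pulled back by the frame. -/
abbrev frameStar {k l : ℕ} (h : k + l = 7) (β : R7 [⋀^Fin k]→L[ℝ] ℝ) : R7 [⋀^Fin l]→L[ℝ] ℝ :=
  pull F (starR7 h (pull F.symm β))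

lemma antisum_star_mul (β : R7 [⋀^Fin 4]→L[ℝ] ℝ) :
    antisum (fun i => frameStar F (k := 4) (l := 3) rfl β ![bvec (i 0), bvec (i 1), bvec (i 2)] *
      β ![bvec (i 3), bvec (i 4), bvec (i 5), bvec (i 6)]) =
      6 * frameDet F * ∑ p : Fin 4 → Fin 7, β (fun a => F.symm (bvec (p a))) ^ 2 := by
  rw [antisum_swap_three_four (fun a b c => frameStar F (k := 4) (l := 3) rfl β
    ![bvec a, bvec b, bvec c]) (fun a b c d => β ![bvec a, bvec b, bvec c, bvec d])]
  have h := antisum_mul_star_frame (k := 4) (l := 3) rfl F β.toMultilinearMap (pull F.symm β)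
  rw [show (Nat.factorial 3 : ℝ) = 6 by norm_num [Nat.factorial]] at h
  refine (congrArg antisum (funext fun i => ?_)).trans (h.trans ?_)
  · exact congrArg₂ (· * ·) (congrArg β (by funext a; fin_cases a <;> rfl))
      (congrArg _ (by funext a; fin_cases a <;> rfl))
  · have h1 : ∀ p : Fin 4 → Fin 7, β.toMultilinearMap (fun a => F.symm (bvec (p a))) *
        pull F.symm β (fun a => bvec (p a)) = β (fun a => F.symm (bvec (p a))) ^ 2 :=
      fun p => (sq _).symm
    rw [Finset.sum_congr rfl fun p _ => h1 p]
    ring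

/-- Since ⋆β and ω are odd, λ∧⋆β∧ω = -(λ∧ω)∧⋆β = -⟨λ∧ω, β⟩ vol = -⟨ω, ι_{λ♯} β⟩ vol. The explicit
vector is λ♯, and 1/4 is the ratio of the normalizations 3! · 3! and 3! · 4!. -/
lemma antisum_linear_star_phi (lam : R7 →L[ℝ] ℝ) (β : R7 [⋀^Fin 4]→L[ℝ] ℝ) :
    antisum (fun i => lam (bvec (i 0)) * (frameStar F (k := 4) (l := 3) rfl β
        ![bvec (i 1), bvec (i 2), bvec (i 3)] *
          pull F phi0 ![bvec (i 4), bvec (i 5), bvec (i 6)])) =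
      -(1 / 4) * antisum (fun i =>
        β ![∑ a, lam (F.symm (bvec a)) • F.symm (bvec a), bvec (i 0), bvec (i 1), bvec (i 2)] *
        pull F (starR7 (k := 3) (l := 4) rfl phi0)
          ![bvec (i 3), bvec (i 4), bvec (i 5), bvec (i 6)]) := by
  rw [antisum_swap_three_three (fun a => lam (bvec a))
    (fun a b c => frameStar F (k := 4) (l := 3) rfl β ![bvec a, bvec b, bvec c])
    (fun a b c => pull F phi0 ![bvec a, bvec b, bvec c])]
  have h := antisum_mul_star_frame (k := 4) (l := 3) rfl F (mulTensor (k := 1) (l := 3) rfl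
    (multiOne lam) (pull F phi0).toMultilinearMap) (pull F.symm β)
  have h4 : ∀ i : Fin 7 → Fin 7, lam (bvec (i 0)) *
      pull F phi0 ![bvec (i 1), bvec (i 2), bvec (i 3)] *
        frameStar F (k := 4) (l := 3) rfl β ![bvec (i 4), bvec (i 5), bvec (i 6)] =
      (mulTensor (k := 1) (l := 3) rfl (multiOne lam) (pull F phi0).toMultilinearMap)
        (fun a => bvec (i (fstIdx (k := 4) (l := 3) rfl a))) *
        pull F (starR7 (k := 4) (l := 3) rfl (pull F.symm β))
          (fun a => bvec (i (sndIdx (k := 4) (l := 3) rfl a))) := by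
    intro i
    rw [mulTensor_apply]
    exact congrArg₂ (· * ·) (congrArg₂ (· * ·) rfl
      (congrArg _ (by funext a; fin_cases a <;> rfl)))
      (congrArg _ (by funext a; fin_cases a <;> rfl))
  rw [funext h4, h, sum_fin_cons]
  have h2 := antisum_mul_psi F
    (β.curryLeft (∑ a, lam (F.symm (bvec a)) • F.symm (bvec a)))
  simp only [ContinuousAlternatingMap.curryLeft_apply_apply] at h2
  rw [h2, show (Nat.factorial 3 : ℝ) = 6 by norm_num [Nat.factorial]]
  have h5 : ∀ (a : Fin 7) (q : Fin 3 → Fin 7), (mulTensor (k := 1) (l := 3) rfl (multiOne lam)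
      (pull F phi0).toMultilinearMap) (fun x => F.symm (bvec (Matrix.vecCons a q x))) *
      pull F.symm β (fun x => bvec (Matrix.vecCons a q x)) = lam (F.symm (bvec a)) *
        (β (Matrix.vecCons (F.symm (bvec a)) fun x => F.symm (bvec (q x))) *
          phi0 (fun x => bvec (q x))) := by
    intro a q
    rw [mulTensor_apply, mul_assoc, mul_comm (β _)]
    refine congrArg₂ (· * ·) rfl (congrArg₂ (· * ·) (congrArg phi0 ?_) (congrArg β ?_))
    · funext x
      fin_cases x <;> exact F.apply_symm_apply _
    · funext x
      refine Fin.cases rfl (fun x => rfl) x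
  simp only [h5]
  have h6 : ∀ w : Fin 3 → R7, β (Matrix.vecCons
      (∑ a, lam (F.symm (bvec a)) • F.symm (bvec a)) w) =
      ∑ a, lam (F.symm (bvec a)) * β (Matrix.vecCons (F.symm (bvec a)) w) := by
    intro w
    rw [← ContinuousAlternatingMap.curryLeft_apply_apply]
    simp [ContinuousAlternatingMap.sum_apply]
  simp only [h6, Finset.sum_mul]
  rw [Finset.sum_comm]
  simp only [mul_assoc]
  ring

lemma antisum_phi_quadratic (u v : R7) :
    antisum (fun i => pull F phi0 ![u, bvec (i 0), bvec (i 1)] *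
      pull F phi0 ![v, bvec (i 2), bvec (i 3)] *
      pull F phi0 ![bvec (i 4), bvec (i 5), bvec (i 6)]) =
      144 * frameDet F * ∑ j, F u j * F v j := by
  have h := antisum_frame (mulTensor (k := 4) (l := 3) rfl (mulTensor (k := 2) (l := 2) rfl
    (phi0.curryLeft (F u)).toMultilinearMap (phi0.curryLeft (F v)).toMultilinearMap)
    phi0.toMultilinearMap) (F : R7 →L[ℝ] R7)
  have h2 := antisum_phi0_quadratic (F u) (F v)
  rw [mul_comm (144 : ℝ), mul_assoc, ← h2]
  refine (congrArg antisum (funext fun i => ?_)).trans (h.trans (congrArg _ (congrArg antisum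
    (funext fun i => ?_))))
  · rw [mulTensor_apply, mulTensor_apply]
    refine congrArg₂ (· * ·) (congrArg₂ (· * ·) (congrArg phi0 ?_) (congrArg phi0 ?_))
      (congrArg phi0 ?_) <;> (funext a; fin_cases a <;> rfl)
  · rw [mulTensor_apply, mulTensor_apply]
    refine congrArg₂ (· * ·) (congrArg₂ (· * ·) (congrArg phi0 ?_) (congrArg phi0 ?_))
      (congrArg phi0 ?_) <;> (funext a; fin_cases a <;> rfl)

end Frame

/-! ### The coordinate expression of the star operator -/

lemma toMultilinearMap_apply {k : ℕ} (α : R7 [⋀^Fin k]→L[ℝ] ℝ) (w : Fin k → R7) :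
    α.toMultilinearMap w = α w := rfl

lemma pull_apply {k : ℕ} (F : R7 ≃L[ℝ] R7) (α : R7 [⋀^Fin k]→L[ℝ] ℝ) (v : Fin k → R7) :
    pull F α v = α (fun a => F (v a)) := Eq.trans rfl rfl

lemma map_eq_sum {k : ℕ} (f : MultilinearMap ℝ (fun _ : Fin k => R7) ℝ) (v : Fin k → R7) :
    f v = ∑ p : Fin k → Fin 7, (∏ a, v a (p a)) * f (fun a => bvec (p a)) := by
  have h : v = fun a => ∑ j, v a j • bvec j := by funext a; exact (sum_smul_bvec _).symm
  conv_lhs => rw [h]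
  rw [MultilinearMap.map_sum]
  exact Finset.sum_congr rfl fun p _ => by rw [MultilinearMap.map_smul_univ, smul_eq_mul]

/-- The components `∑ₐ vₐⁱ vₐʲ` for the columns `vₐ = G eₐ`. -/
def gram (G : R7 ≃L[ℝ] R7) (i j : Fin 7) : ℝ := ∑ a, G (bvec a) i * G (bvec a) j

/-- Expanding both factors in the standard basis, the sum over the frame factors into one Gram entry
for each slot. Contractions therefore depend on the frame only through its metric. -/
lemma sum_map_mul_map {k : ℕ} (f g : MultilinearMap ℝ (fun _ : Fin k => R7) ℝ)
    (G : R7 ≃L[ℝ] R7) :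
    ∑ i : Fin k → Fin 7, f (fun a => G (bvec (i a))) * g (fun a => G (bvec (i a))) =
      ∑ p : Fin k → Fin 7, ∑ q : Fin k → Fin 7, (∏ a, gram G (p a) (q a)) *
        (f (fun a => bvec (p a)) * g (fun a => bvec (q a))) := by
  have h1 : ∀ i : Fin k → Fin 7, f (fun a => G (bvec (i a))) * g (fun a => G (bvec (i a))) =
      ∑ p : Fin k → Fin 7, ∑ q : Fin k → Fin 7,
        (∏ a, G (bvec (i a)) (p a) * G (bvec (i a)) (q a)) *
        (f (fun a => bvec (p a)) * g (fun a => bvec (q a))) := by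
    intro i
    rw [map_eq_sum f, map_eq_sum g, Finset.sum_mul_sum]
    refine Finset.sum_congr rfl fun p _ => Finset.sum_congr rfl fun q _ => ?_
    rw [Finset.prod_mul_distrib]
    ring
  simp only [h1]
  rw [Finset.sum_comm]
  refine Finset.sum_congr rfl fun p _ => ?_
  rw [Finset.sum_comm]
  refine Finset.sum_congr rfl fun q _ => ?_
  rw [← Finset.sum_mul]
  congr 1
  simp only [gram]
  rw [Finset.prod_univ_sum]
  simp

lemma map_append_frame (η : R7 [⋀^Fin 7]→L[ℝ] ℝ) {k l : ℕ} (h : k + l = 7) (F : R7 ≃L[ℝ] R7)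
    (w w' : Fin k → R7) (v : Fin l → R7) (hw : ∀ b, w' b = F.symm (w b)) :
    η (fun a => Fin.append w (fun b => F (v b)) (Fin.cast h.symm a)) =
      frameDet F * η (fun a => Fin.append w' v (Fin.cast h.symm a)) := by
  obtain rfl : w' = fun b => F.symm (w b) := funext hw
  have h1 := det_basis_map (F : R7 →L[ℝ] R7) η.toAlternatingMap
    (fun a => Fin.append (fun b => F.symm (w b)) v (Fin.cast h.symm a))
  refine Eq.trans (congrArg η (funext fun a => ?_)) h1
  obtain ⟨b, rfl⟩ : ∃ b : Fin (k + l), a = Fin.cast h b := ⟨Fin.cast h.symm a, rfl⟩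
  induction b using Fin.addCases with
  | left b => simp
  | right b => simp

/-- The coordinate formula of the star, in which the frame enters only through its determinant and
the inverse metric; this is what makes the star smooth. -/
lemma frameStar_eq_sum {k l : ℕ} (h : k + l = 7) (F : R7 ≃L[ℝ] R7) (β : R7 [⋀^Fin k]→L[ℝ] ℝ) :
    frameStar F h β = ((k.factorial : ℝ)⁻¹ * frameDet F) •
      ∑ p : Fin k → Fin 7, ∑ q : Fin k → Fin 7,
        ((∏ a, gram F.symm (p a) (q a)) * β (fun a => bvec (p a))) •
          insert h vol (fun a => bvec (q a)) := by
  ext v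
  have h' : l + k = 7 := (add_comm _ _).trans h
  have h1 : frameStar F h β v = (k.factorial : ℝ)⁻¹ * ∑ i : Fin k → Fin 7,
      β (fun a => F.symm (bvec (i a))) * vol (fun a => Fin.append (fun a => bvec (i a))
        (fun b => F (v b)) (Fin.cast h.symm a)) := by
    rw [frameStar, pull_apply, starR7_apply]
    simp only [pull_apply]
  rw [h1]
  obtain ⟨g, hg⟩ : ∃ g : MultilinearMap ℝ (fun _ : Fin k => R7) ℝ, ∀ w : Fin k → R7,
      vol (fun a => Fin.append w v (Fin.cast h.symm a)) = g w :=
    ⟨(insert h' vol v).toMultilinearMap, fun w => by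
      rw [toMultilinearMap_apply, insert_apply, map_append_comm vol h h']⟩
  have h2 := sum_map_mul_map β.toMultilinearMap g F.symm
  have h5 : ∀ i : Fin k → Fin 7, vol (fun a => Fin.append (fun a => bvec (i a))
      (fun b => F (v b)) (Fin.cast h.symm a)) = frameDet F * g (fun a => F.symm (bvec (i a))) :=
    fun i => by rw [map_append_frame vol h F (fun a => bvec (i a))
      (fun a => F.symm (bvec (i a))) v (fun _ => rfl), hg]
  simp only [h5]
  simp only [ContinuousAlternatingMap.smul_apply, ContinuousAlternatingMap.sum_apply, smul_eq_mul,
    insert_apply, hg]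
  simp only [toMultilinearMap_apply] at h2
  simp only [mul_assoc]
  rw [← h2]
  simp only [Finset.mul_sum]
  exact Finset.sum_congr rfl fun _ _ => by ring

lemma pull_symm_pull {n : ℕ} (F : R7 ≃L[ℝ] R7) (α : R7 [⋀^Fin n]→L[ℝ] ℝ) :
    pull F.symm (pull F α) = α := by
  ext v
  exact congrArg α (funext fun a => F.apply_symm_apply _)

lemma frameStar_pull {k l : ℕ} (h : k + l = 7) (F : R7 ≃L[ℝ] R7) (α : R7 [⋀^Fin k]→L[ℝ] ℝ) :
    frameStar F h (pull F α) = pull F (starR7 h α) := by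
  rw [frameStar, pull_symm_pull]

/-! ### Regularity of the metric -/

/-- The matrix of a frame. -/
def frameMatrix (F : R7 ≃L[ℝ] R7) : Matrix (Fin 7) (Fin 7) ℝ := Matrix.of fun i j => F (bvec j) i

lemma frameMatrix_mul_symm (F : R7 ≃L[ℝ] R7) : frameMatrix F * frameMatrix F.symm = 1 := by
  ext i j
  have h : F (F.symm (bvec j)) i = bvec j i := by rw [F.apply_symm_apply]
  conv_lhs at h => rw [← sum_smul_bvec (F.symm (bvec j))]
  simp only [map_sum, map_smul, WithLp.ofLp_sum, Finset.sum_apply,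
    WithLp.ofLp_smul, Pi.smul_apply, smul_eq_mul, bvec_apply] at h
  rw [Matrix.mul_apply, Matrix.one_apply]
  simp only [frameMatrix, Matrix.of_apply]
  rw [← h]
  exact Finset.sum_congr rfl fun _ _ => mul_comm _ _

lemma det_frameMatrix (F : R7 ≃L[ℝ] R7) : (frameMatrix F).det = frameDet F := by
  have h := LinearMap.det_toMatrix (EuclideanSpace.basisFun (Fin 7) ℝ).toBasis
    (F : R7 →L[ℝ] R7).toLinearMap
  rw [frameDet, ContinuousLinearMap.det, ← h]
  refine congrArg Matrix.det ?_
  ext i j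
  simp [frameMatrix, LinearMap.toMatrix_apply, single_eq_bvec]

lemma gram_eq (G : R7 ≃L[ℝ] R7) :
    Matrix.of (gram G) = frameMatrix G * (frameMatrix G).transpose := by
  ext i j
  simp [gram, Matrix.mul_apply, frameMatrix]

lemma det_gram (G : R7 ≃L[ℝ] R7) : (Matrix.of (gram G)).det = frameDet G ^ 2 := by
  rw [gram_eq, Matrix.det_mul, Matrix.det_transpose, det_frameMatrix, sq]

lemma frameDet_ne_zero (F : R7 ≃L[ℝ] R7) : frameDet F ≠ 0 := by
  have h := congrArg Matrix.det (frameMatrix_mul_symm F)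
  rw [Matrix.det_mul, Matrix.det_one, det_frameMatrix] at h
  exact left_ne_zero_of_mul_eq_one h

/-- The quadratic expression in a 3-form which for `pull F phi0` is `det F` times the metric. -/
def bryantForm (θ : R7 [⋀^Fin 3]→L[ℝ] ℝ) : Matrix (Fin 7) (Fin 7) ℝ := Matrix.of fun j k =>
  (144 : ℝ)⁻¹ * antisum (fun i => θ ![bvec j, bvec (i 0), bvec (i 1)] *
    θ ![bvec k, bvec (i 2), bvec (i 3)] * θ ![bvec (i 4), bvec (i 5), bvec (i 6)])

lemma bryantForm_pull (F : R7 ≃L[ℝ] R7) : bryantForm (pull F phi0) =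
    frameDet F • ((frameMatrix F).transpose * frameMatrix F) := by
  ext j k
  simp only [bryantForm, Matrix.of_apply, antisum_phi_quadratic, Matrix.smul_apply,
    Matrix.mul_apply, Matrix.transpose_apply, frameMatrix, smul_eq_mul]
  ring

lemma det_bryantForm (F : R7 ≃L[ℝ] R7) : (bryantForm (pull F phi0)).det = frameDet F ^ 9 := by
  rw [bryantForm_pull, Matrix.det_smul, Matrix.det_mul, Matrix.det_transpose, det_frameMatrix]
  simp
  ring

/-- The matrix `bryantForm` is det F times the metric, so its inverse recovers the inverse metric.
-/
lemma gram_symm_eq (F : R7 ≃L[ℝ] R7) :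
    Matrix.of (gram F.symm) = frameDet F • (bryantForm (pull F phi0))⁻¹ := by
  have h0 := frameDet_ne_zero F
  have h1 := frameMatrix_mul_symm F
  have h2 : (bryantForm (pull F phi0))⁻¹ = (frameDet F)⁻¹ • Matrix.of (gram F.symm) := by
    apply Matrix.inv_eq_right_inv
    rw [bryantForm_pull, gram_eq, Matrix.smul_mul, Matrix.mul_smul, smul_smul,
      mul_inv_cancel₀ h0, one_smul, Matrix.mul_assoc, ← Matrix.mul_assoc (frameMatrix F), h1,
      Matrix.one_mul, ← Matrix.transpose_mul]
    rw [mul_eq_one_comm.1 h1, Matrix.transpose_one]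
  rw [h2, smul_smul, mul_inv_cancel₀ h0, one_smul]

/-- With D = (det F)⁹, one has D (D²)^(-4/9) = (det F)⁹ (det F)⁻⁸. Squaring before the real power
allows det F to be negative, as happens in a chart of the opposite orientation. -/
lemma frameDet_eq_rpow (F : R7 ≃L[ℝ] R7) : frameDet F =
    (bryantForm (pull F phi0)).det * ((bryantForm (pull F phi0)).det ^ 2) ^ (-(4 / 9) : ℝ) := by
  have h0 := frameDet_ne_zero F
  rw [det_bryantForm]
  have h1 : (frameDet F ^ 9) ^ 2 = (frameDet F ^ 2) ^ (9 : ℝ) := by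
    rw [show (9 : ℝ) = ((9 : ℕ) : ℝ) by norm_num, Real.rpow_natCast]; ring
  rw [h1, ← Real.rpow_mul (by positivity), show (9 : ℝ) * -(4 / 9) = -((4 : ℕ) : ℝ) by norm_num,
    Real.rpow_neg (by positivity), Real.rpow_natCast]
  field_simp

/-! ### Smooth dependence of volume density, metric and star on the 3-form. -/

section Smooth

variable {E : Type*} [NormedAddCommGroup E] [NormedSpace ℝ E] {s : Set E} {n : WithTop ℕ∞}

lemma contDiffOn_det {m : ℕ} {A : E → Matrix (Fin m) (Fin m) ℝ}
    (hA : ∀ i j, ContDiffOn ℝ n (fun y => A y i j) s) : ContDiffOn ℝ n (fun y => (A y).det) s := by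
  simp only [Matrix.det_apply']
  exact ContDiffOn.sum fun π _ => contDiffOn_const.mul (contDiffOn_prod fun i _ => hA _ _)

lemma contDiffOn_inv_apply {m : ℕ} {A : E → Matrix (Fin m) (Fin m) ℝ}
    (hA : ∀ i j, ContDiffOn ℝ n (fun y => A y i j) s) (h0 : ∀ y ∈ s, (A y).det ≠ 0)
    (i j : Fin m) : ContDiffOn ℝ n (fun y => (A y)⁻¹ i j) s := by
  simp only [Matrix.inv_def, Ring.inverse_eq_inv', Matrix.smul_apply, smul_eq_mul,
    Matrix.adjugate_apply]
  refine ((contDiffOn_det hA).inv h0).mul (contDiffOn_det fun a b => ?_)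
  by_cases h : a = j
  · subst h; simpa using contDiffOn_const
  · simpa [Matrix.updateRow_ne h] using hA a b

lemma contDiffOn_antisum {g : (Fin 7 → Fin 7) → E → ℝ} (hg : ∀ i, ContDiffOn ℝ n (g i) s) :
    ContDiffOn ℝ n (fun y => antisum (fun i => g i y)) s := by
  unfold antisum
  exact ContDiffOn.sum fun π _ => contDiffOn_const.mul (hg _)

lemma contDiffOn_apply {k : ℕ} {α : E → R7 [⋀^Fin k]→L[ℝ] ℝ} (hα : ContDiffOn ℝ n α s)
    (v : Fin k → R7) : ContDiffOn ℝ n (fun y => α y v) s :=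
  (ContinuousAlternatingMap.apply ℝ R7 ℝ v).contDiff.comp_contDiffOn hα

variable {θ : E → R7 [⋀^Fin 3]→L[ℝ] ℝ} {F : E → R7 ≃L[ℝ] R7}

lemma contDiffOn_bryantForm (hθ : ContDiffOn ℝ n θ s) (j k : Fin 7) :
    ContDiffOn ℝ n (fun y => bryantForm (θ y) j k) s := by
  simp only [bryantForm, Matrix.of_apply]
  exact contDiffOn_const.mul (contDiffOn_antisum fun i =>
    ((contDiffOn_apply hθ _).mul (contDiffOn_apply hθ _)).mul (contDiffOn_apply hθ _))

lemma contDiffOn_frameDet (hθ : ContDiffOn ℝ n θ s) (hF : ∀ y ∈ s, θ y = pull (F y) phi0) :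
    ContDiffOn ℝ n (fun y => frameDet (F y)) s := by
  have h1 : ContDiffOn ℝ n (fun y => (bryantForm (θ y)).det) s :=
    contDiffOn_det (contDiffOn_bryantForm hθ)
  refine (h1.mul ((h1.pow 2).rpow_const_of_ne (p := -(4 / 9)) fun y hy => ?_)).congr fun y hy => ?_
  · rw [hF y hy, det_bryantForm]
    exact pow_ne_zero _ (pow_ne_zero _ (frameDet_ne_zero _))
  · rw [hF y hy]
    exact frameDet_eq_rpow _

lemma contDiffOn_gram (hθ : ContDiffOn ℝ n θ s) (hF : ∀ y ∈ s, θ y = pull (F y) phi0)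
    (i j : Fin 7) : ContDiffOn ℝ n (fun y => gram (F y).symm i j) s := by
  refine ((contDiffOn_frameDet hθ hF).mul (contDiffOn_inv_apply (contDiffOn_bryantForm hθ)
    (fun y hy => ?_) i j)).congr fun y hy => ?_
  · rw [hF y hy, det_bryantForm]
    exact pow_ne_zero _ (frameDet_ne_zero _)
  · rw [hF y hy]
    exact congrFun (congrFun (gram_symm_eq (F y)) i) j

/-- Nothing is assumed about how `F y` varies with y: the coordinate expression of the star contains
only smooth functions of θ and β. -/
lemma contDiffOn_frameStar {k l : ℕ} (h : k + l = 7) (hθ : ContDiffOn ℝ n θ s)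
    (hF : ∀ y ∈ s, θ y = pull (F y) phi0) {β : E → R7 [⋀^Fin k]→L[ℝ] ℝ}
    (hβ : ContDiffOn ℝ n β s) : ContDiffOn ℝ n (fun y => frameStar (F y) h (β y)) s := by
  simp only [frameStar_eq_sum]
  refine (contDiffOn_const.mul (contDiffOn_frameDet hθ hF)).smul ?_
  refine ContDiffOn.sum fun p _ => ContDiffOn.sum fun q _ =>
    ContDiffOn.smul (f := fun y => (∏ a, gram (F y).symm (p a) (q a)) *
      β y (fun a => bvec (p a))) ?_ contDiffOn_const
  exact (contDiffOn_prod fun a _ => contDiffOn_gram hθ hF _ _).mul (contDiffOn_apply hβ _)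

end Smooth

/-! ### The first variation of the volume form -/

lemma frameMatrix_trans (G H : R7 ≃L[ℝ] R7) :
    frameMatrix (G.trans H) = frameMatrix H * frameMatrix G := by
  ext i j
  have h : H (G (bvec j)) i = ∑ k, G (bvec j) k * H (bvec k) i := by
    conv_lhs => rw [← sum_smul_bvec (G (bvec j))]
    simp
  rw [Matrix.mul_apply]
  simp only [frameMatrix, Matrix.of_apply]
  exact h.trans (Finset.sum_congr rfl fun _ _ => mul_comm _ _)

lemma gram_trans (G H : R7 ≃L[ℝ] R7) (i j : Fin 7) :
    gram (G.trans H) i j = ∑ k, ∑ l, frameMatrix H i k * frameMatrix H j l * gram G k l := by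
  have h := congrFun (congrFun (gram_eq (G.trans H)) i) j
  rw [frameMatrix_trans, Matrix.transpose_mul, Matrix.mul_assoc, ← Matrix.mul_assoc _ _
    (frameMatrix H).transpose, ← gram_eq, Matrix.mul_apply] at h
  refine h.trans (Finset.sum_congr rfl fun k _ => ?_)
  rw [Matrix.mul_apply, Finset.mul_sum]
  refine Finset.sum_congr rfl fun l _ => ?_
  simp only [Matrix.of_apply, Matrix.transpose_apply]
  ring

lemma gram_refl (i j : Fin 7) :
    gram (ContinuousLinearEquiv.refl ℝ R7) i j = if i = j then 1 else 0 := by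
  simp [gram, bvec_apply]

lemma phiTable_contract_second : ∀ i j : Fin 7, ∑ k, ∑ l, phiTable k i l * phiTable k j l =
    if i = j then 6 else 0 := by
  decide +kernel

lemma phiTable_contract_third : ∀ i j : Fin 7, ∑ k, ∑ l, phiTable k l i * phiTable k l j =
    if i = j then 6 else 0 := by
  decide +kernel

/-- Jacobi's formula at the identity. A permutation other than 1 moves at least two indices, so a
zero factor remains after one factor has been differentiated. -/
lemma hasDerivAt_det {n : ℕ} {A : ℝ → Matrix (Fin n) (Fin n) ℝ} {A' : Matrix (Fin n) (Fin n) ℝ}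
    {t : ℝ} (hA : ∀ i j, HasDerivAt (fun s => A s i j) (A' i j) t) (h1 : A t = 1) :
    HasDerivAt (fun s => (A s).det) A'.trace t := by
  simp only [Matrix.det_apply']
  have h : ∀ π : Equiv.Perm (Fin n), HasDerivAt
      (fun s => ((Equiv.Perm.sign π : ℤ) : ℝ) * ∏ i, A s (π i) i)
      (if π = 1 then A'.trace else 0) t := by
    intro π
    have h2 := (HasDerivAt.fun_finsetProd (u := Finset.univ)
      (fun i _ => hA (π i) i)).const_mul ((Equiv.Perm.sign π : ℤ) : ℝ)
    refine h2.congr_deriv ?_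
    have h1' : ∀ i j, A t i j = if i = j then 1 else 0 := fun i j => by
      rw [h1, Matrix.one_apply]
    simp only [smul_eq_mul, h1']
    split_ifs with hπ
    · subst hπ
      simp [Matrix.trace]
    · rw [mul_eq_zero]
      right
      refine Finset.sum_eq_zero fun i _ => ?_
      rw [mul_eq_zero]
      left
      have h3 : ∃ j, π j ≠ j ∧ j ≠ i := by
        by_contra hcon
        push Not at hcon
        apply hπ
        ext1 j
        by_cases hj : π j = j
        · exact hj
        · obtain rfl := hcon j hj
          by_contra hne
          have h4 : π (π j) ≠ π j := fun h => hne (π.injective h)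
          exact hne (hcon _ h4)
      obtain ⟨j, hj, hji⟩ := h3
      exact Finset.prod_eq_zero (i := j) (by simp [hji]) (by simp [hj])
  have h3 := HasDerivAt.fun_sum (u := Finset.univ) (fun π _ => h π)
  simpa using h3

lemma sum_comm_one {R : Type*} [AddCommMonoid R] (f : Fin 7 → Fin 7 → Fin 7 → Fin 7 → R) :
    ∑ a, ∑ b, ∑ c, ∑ d, f a b c d = ∑ a, ∑ d, ∑ b, ∑ c, f a b c d := by
  refine Finset.sum_congr rfl fun a _ => ?_
  rw [Finset.sum_comm (f := fun d b => ∑ c, f a b c d)]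
  exact Finset.sum_congr rfl fun b _ => Finset.sum_comm

lemma sum_comm_two {R : Type*} [AddCommMonoid R] (f : Fin 7 → Fin 7 → Fin 7 → Fin 7 → R) :
    ∑ a, ∑ b, ∑ c, ∑ d, f a b c d = ∑ c, ∑ d, ∑ a, ∑ b, f a b c d := by
  rw [← sum_comm_one fun c a b d => f a b c d,
    Finset.sum_comm (f := fun c a => ∑ b, ∑ d, f a b c d)]
  exact Finset.sum_congr rfl fun a _ => Finset.sum_comm

/-- The differentiated full contraction of the 3-form with itself, evaluated where the metric is the
identity. Each of the three metric slots contributes 6 tr s', from φ_{ikl} φ_{jkl} = 6 δ_{ij} and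
its analogues. -/
lemma sum_deriv_norm (s' : Fin 7 → Fin 7 → ℝ) (w' : Fin 7 → Fin 7 → Fin 7 → ℝ) :
    (∑ a, ∑ b, ∑ c, ∑ a', ∑ b', ∑ c',
      (((s' a a' * (if b = b' then 1 else 0) + (if a = a' then 1 else 0) * s' b b') *
        (if c = c' then 1 else 0) + (if a = a' then 1 else 0) * (if b = b' then 1 else 0) *
          s' c c') * ((phiTable a b c : ℝ) * phiTable a' b' c') +
      (if a = a' then 1 else 0) * (if b = b' then 1 else 0) * (if c = c' then 1 else 0) *
        (w' a b c * phiTable a' b' c' + phiTable a b c * w' a' b' c'))) =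
    18 * ∑ a, s' a a + 2 * ∑ a, ∑ b, ∑ c, w' a b c * phiTable a b c := by
  have e1 : ∀ i j : Fin 7, ∑ k, ∑ l, (phiTable i k l : ℝ) * phiTable j k l =
      if i = j then 6 else 0 := fun i j => by exact_mod_cast phiTable_contract i j
  have e2 : ∀ i j : Fin 7, ∑ k, ∑ l, (phiTable k i l : ℝ) * phiTable k j l =
      if i = j then 6 else 0 := fun i j => by exact_mod_cast phiTable_contract_second i j
  have e3 : ∀ i j : Fin 7, ∑ k, ∑ l, (phiTable k l i : ℝ) * phiTable k l j =
      if i = j then 6 else 0 := fun i j => by exact_mod_cast phiTable_contract_third i j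
  have e0 : ∑ a, ∑ a', s' a a' * (if a = a' then 6 else 0) = 6 * ∑ a, s' a a := by
    rw [Finset.mul_sum]
    refine Finset.sum_congr rfl fun a _ => ?_
    simp [mul_comm]
  have t1 : ∑ a, ∑ b, ∑ c, ∑ a', s' a a' * ((phiTable a b c : ℝ) * phiTable a' b c) =
      6 * ∑ a, s' a a := by
    rw [sum_comm_one, ← e0]
    simp only [← Finset.mul_sum, e1]
  have t2 : ∑ a, ∑ b, ∑ c, ∑ b', s' b b' * ((phiTable a b c : ℝ) * phiTable a b' c) =
      6 * ∑ a, s' a a := by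
    rw [Finset.sum_comm, sum_comm_one, ← e0]
    simp only [← Finset.mul_sum, e2]
  have t3 : ∑ a, ∑ b, ∑ c, ∑ c', s' c c' * ((phiTable a b c : ℝ) * phiTable a b c') =
      6 * ∑ a, s' a a := by
    rw [sum_comm_two, ← e0]
    simp only [← Finset.mul_sum, e3]
  simp only [add_mul, mul_add, Finset.sum_add_distrib, ite_mul, mul_ite, one_mul, zero_mul,
    mul_one, mul_zero, Finset.sum_ite_eq, Finset.mem_univ, if_true, Finset.sum_ite_irrel,
    Finset.sum_const_zero]
  simp only [t1, t2, t3, mul_comm ((phiTable _ _ _ : ℤ) : ℝ) (w' _ _ _)]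
  ring

lemma frameDet_trans (G H : R7 ≃L[ℝ] R7) : frameDet (G.trans H) = frameDet H * frameDet G := by
  rw [← det_frameMatrix, frameMatrix_trans, Matrix.det_mul, det_frameMatrix, det_frameMatrix]

/-- The squared norm of a positive form in its own metric is always 42, here written in a second,
fixed frame. -/
lemma sum_gram_mul_mul (F F₀ : R7 ≃L[ℝ] R7) :
    ∑ a, ∑ b, ∑ c, ∑ a', ∑ b', ∑ c', (gram (F.symm.trans F₀) a a' * gram (F.symm.trans F₀) b b' *
      gram (F.symm.trans F₀) c c') *
      (pull F phi0 ![F₀.symm (bvec a), F₀.symm (bvec b), F₀.symm (bvec c)] *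
        pull F phi0 ![F₀.symm (bvec a'), F₀.symm (bvec b'), F₀.symm (bvec c')]) = 42 := by
  have h := sum_map_mul_map (pull F₀.symm (pull F phi0)).toMultilinearMap
    (pull F₀.symm (pull F phi0)).toMultilinearMap (F.symm.trans F₀)
  simp only [toMultilinearMap_apply, pull_apply, ContinuousLinearEquiv.trans_apply,
    ContinuousLinearEquiv.symm_apply_apply, ContinuousLinearEquiv.apply_symm_apply,
    phi0_norm_sq] at h
  simp only [sum_fin_three, Fin.prod_univ_three] at h
  rw [h]
  have e : ∀ a b c : Fin 7, (fun x => F (F₀.symm (bvec (![a, b, c] x)))) =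
      fun x => F (![F₀.symm (bvec a), F₀.symm (bvec b), F₀.symm (bvec c)] x) := by
    intro a b c; funext x; fin_cases x <;> rfl
  simp only [pull_apply, e]
  rfl

lemma hasDerivAt_apply {n : ℕ} {α : ℝ → R7 [⋀^Fin n]→L[ℝ] ℝ} {α' : R7 [⋀^Fin n]→L[ℝ] ℝ} {t : ℝ}
    (h : HasDerivAt α α' t) (v : Fin n → R7) : HasDerivAt (fun s => α s v) (α' v) t := by
  have := (ContinuousAlternatingMap.apply ℝ R7 ℝ v).hasFDerivAt.comp_hasDerivAt t h
  exact this

/-- First variation of the volume, ⟨θ', θ⟩ = 3 m'/m for the usual norm, hence 18 = 3 · 3! over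
ordered triples. It follows by differentiating |θ|² = 42, where the variation of the inverse metric
enters only through its trace, -2 m'/m. -/
lemma first_variation {θ : ℝ → R7 [⋀^Fin 3]→L[ℝ] ℝ} {F : ℝ → R7 ≃L[ℝ] R7}
    {θ' : R7 [⋀^Fin 3]→L[ℝ] ℝ} {m' : ℝ} (hθ : HasDerivAt θ θ' 0)
    (hm : HasDerivAt (fun t => frameDet (F t)) m' 0)
    (hS : ∀ i j, DifferentiableAt ℝ (fun t => gram (F t).symm i j) 0)
    (hF : ∀ᶠ t in nhds 0, θ t = pull (F t) phi0) :
    (∑ p : Fin 3 → Fin 7, θ' (fun a => (F 0).symm (bvec (p a))) * phi0 (fun a => bvec (p a))) *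
      frameDet (F 0) = 18 * m' := by
  -- The inverse metric at time t, written in the frame of time 0, so that it is the identity at t =
  -- 0.
  set s : ℝ → Fin 7 → Fin 7 → ℝ := fun t i j => gram ((F t).symm.trans (F 0)) i j with hs_def
  have hs0 : ∀ i j, s 0 i j = if i = j then 1 else 0 := fun i j => by
    simp only [hs_def, ContinuousLinearEquiv.symm_trans_self, gram_refl]
  have hs1 : ∀ i j, DifferentiableAt ℝ (fun t => s t i j) 0 := by
    intro i j
    simp only [hs_def, gram_trans]
    exact DifferentiableAt.fun_sum fun k _ => DifferentiableAt.fun_sum fun l _ =>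
      (hS k l).const_mul _
  set s' : Fin 7 → Fin 7 → ℝ := fun i j => deriv (fun t => s t i j) 0 with hs'_def
  have hs : ∀ i j, HasDerivAt (fun t => s t i j) (s' i j) 0 := fun i j => (hs1 i j).hasDerivAt
  -- Differentiating det s · m² = m(0)² at t = 0.
  have htrace : (∑ a, s' a a) * frameDet (F 0) = -2 * m' := by
    have h1 := hasDerivAt_det (A := fun t => Matrix.of (s t)) (A' := Matrix.of s') (t := 0)
      (fun i j => hs i j) (by ext i j; simp [hs0, Matrix.one_apply])
    have h2 := h1.mul (hm.pow 2)
    have h3 : ∀ t, (Matrix.of (s t)).det * frameDet (F t) ^ 2 = frameDet (F 0) ^ 2 := by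
      intro t
      have h4 : (F t).trans ((F t).symm.trans (F 0)) = F 0 := by
        refine ContinuousLinearEquiv.ext (funext fun v => ?_)
        simp
      rw [hs_def, det_gram, ← mul_pow, ← frameDet_trans, h4]
    have h4 := h2.unique ((hasDerivAt_const (0 : ℝ) (frameDet (F 0) ^ 2)).congr_of_eventuallyEq
      (Filter.Eventually.of_forall h3))
    have h5 : (Matrix.of (s 0)).det = 1 := by
      rw [show Matrix.of (s 0) = 1 by ext i j; simp [hs0, Matrix.one_apply], Matrix.det_one]
    simp only [h5, Matrix.trace, Matrix.diag, Matrix.of_apply, Pi.pow_apply] at h4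
    have h6 := frameDet_ne_zero (F 0)
    have h7 : frameDet (F 0) * ((∑ a, s' a a) * frameDet (F 0) + 2 * m') = 0 := by
      linear_combination h4
    linear_combination (mul_eq_zero.1 h7).resolve_left h6
  set w : ℝ → Fin 7 → Fin 7 → Fin 7 → ℝ := fun t a b c =>
    θ t ![(F 0).symm (bvec a), (F 0).symm (bvec b), (F 0).symm (bvec c)] with hw_def
  set w' : Fin 7 → Fin 7 → Fin 7 → ℝ := fun a b c =>
    θ' ![(F 0).symm (bvec a), (F 0).symm (bvec b), (F 0).symm (bvec c)] with hw'_def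
  have hw : ∀ a b c, HasDerivAt (fun t => w t a b c) (w' a b c) 0 := fun a b c =>
    hasDerivAt_apply hθ _
  have hw0 : ∀ a b c, w 0 a b c = phiTable a b c := by
    intro a b c
    rw [hw_def, ← phi0_bvec]
    simp only [hF.self_of_nhds, pull_apply]
    refine congrArg phi0 ?_
    funext x
    fin_cases x <;> exact (F 0).apply_symm_apply _
  have hd := HasDerivAt.fun_sum (u := Finset.univ) fun a _ => HasDerivAt.fun_sum
    (u := Finset.univ) fun b _ => HasDerivAt.fun_sum (u := Finset.univ) fun c _ =>
    HasDerivAt.fun_sum (u := Finset.univ) fun a' _ => HasDerivAt.fun_sum (u := Finset.univ)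
    fun b' _ => HasDerivAt.fun_sum (u := Finset.univ) fun c' _ =>
    (((hs a a').mul (hs b b')).mul (hs c c')).mul ((hw a b c).mul (hw a' b' c'))
  have h42 : ∀ᶠ t in nhds 0, (∑ a, ∑ b, ∑ c, ∑ a', ∑ b', ∑ c',
      s t a a' * s t b b' * s t c c' * (w t a b c * w t a' b' c')) = (42 : ℝ) := by
    filter_upwards [hF] with t ht
    simp only [hs_def, hw_def, ht]
    exact sum_gram_mul_mul (F t) (F 0)
  have h0 := hd.unique ((hasDerivAt_const (0 : ℝ) (42 : ℝ)).congr_of_eventuallyEq h42)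
  have h1 := sum_deriv_norm s' w'
  simp only [Pi.mul_apply, hs0, hw0] at h0
  rw [h0] at h1
  have h2 : ∑ p : Fin 3 → Fin 7, θ' (fun a => (F 0).symm (bvec (p a))) *
      phi0 (fun a => bvec (p a)) = ∑ a, ∑ b, ∑ c, w' a b c * phiTable a b c := by
    rw [sum_fin_three]
    refine Finset.sum_congr rfl fun a _ => Finset.sum_congr rfl fun b _ =>
      Finset.sum_congr rfl fun c _ => ?_
    rw [hw'_def, ← phi0_bvec]
    refine congrArg₂ (· * ·) (congrArg θ' ?_) (congrArg phi0 ?_)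
    · funext x; fin_cases x <;> rfl
    · funext x; fin_cases x <;> rfl
  rw [h2]
  linear_combination -(frameDet (F 0) / 2) * h1 - 9 * htrace

/-! ### Pointwise identities for the torsion -/

lemma antisum_swap_four_two' (P : Fin 7 → Fin 7 → Fin 7 → Fin 7 → ℝ)
    (Q : Fin 7 → Fin 7 → Fin 7 → ℝ) :
    antisum (fun i => P (i 1) (i 2) (i 3) (i 4) * Q (i 0) (i 5) (i 6)) =
      antisum (fun i => Q (i 0) (i 1) (i 2) * P (i 3) (i 4) (i 5) (i 6)) := by
  rw [antisum_reindex ![0, 5, 6, 1, 2, 3, 4] ![0, 3, 4, 5, 6, 1, 2] (by decide) (by decide) 1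
    (by decide +kernel) (fun i => Q (i 0) (i 1) (i 2) * P (i 3) (i 4) (i 5) (i 6)) _
    (fun i => by simp only [Matrix.cons_val]; ring), Units.val_one, Int.cast_one, one_mul]

lemma antisum_swap_three_three' (P : Fin 7 → Fin 7 → Fin 7 → ℝ)
    (Q : Fin 7 → Fin 7 → Fin 7 → Fin 7 → ℝ) :
    antisum (fun i => P (i 1) (i 2) (i 3) * Q (i 0) (i 4) (i 5) (i 6)) =
      -antisum (fun i => Q (i 0) (i 1) (i 2) (i 3) * P (i 4) (i 5) (i 6)) := by
  rw [antisum_reindex ![0, 4, 5, 6, 1, 2, 3] ![0, 4, 5, 6, 1, 2, 3] (by decide) (by decide) (-1)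
    (by decide +kernel) (fun i => Q (i 0) (i 1) (i 2) (i 3) * P (i 4) (i 5) (i 6)) _
    (fun i => by simp only [Matrix.cons_val]; ring)]
  simp

lemma antisum_alternatize_three (L : R7 →L[ℝ] R7 [⋀^Fin 3]→L[ℝ] ℝ)
    (Y : Fin 7 → Fin 7 → Fin 7 → ℝ) :
    antisum (fun i => ContinuousAlternatingMap.alternatizeUncurryFin L
        ![bvec (i 0), bvec (i 1), bvec (i 2), bvec (i 3)] * Y (i 4) (i 5) (i 6)) =
      4 * antisum (fun i => L (bvec (i 0)) ![bvec (i 1), bvec (i 2), bvec (i 3)] *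
        Y (i 4) (i 5) (i 6)) := by
  have h := antisum_alternatizeUncurryFin (k := 3) (l := 3) rfl L
    (fun p => Y (p 0) (p 1) (p 2))
  refine Eq.trans (congrArg antisum (funext fun i => ?_))
    (h.trans (congrArg₂ (· * ·) ?_ (congrArg antisum (funext fun i => ?_))))
  · exact congrArg₂ (· * ·) (congrArg _ (by funext a; fin_cases a <;> rfl)) rfl
  · norm_num
  · exact congrArg₂ (· * ·) (congrArg _ (by funext a; fin_cases a <;> rfl)) rfl

lemma antisum_alternatize_four (L : R7 →L[ℝ] R7 [⋀^Fin 4]→L[ℝ] ℝ) (Y : Fin 7 → Fin 7 → ℝ) :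
    antisum (fun i => ContinuousAlternatingMap.alternatizeUncurryFin L
        ![bvec (i 0), bvec (i 1), bvec (i 2), bvec (i 3), bvec (i 4)] * Y (i 5) (i 6)) =
      5 * antisum (fun i => L (bvec (i 0)) ![bvec (i 1), bvec (i 2), bvec (i 3), bvec (i 4)] *
        Y (i 5) (i 6)) := by
  have h := antisum_alternatizeUncurryFin (k := 4) (l := 2) rfl L (fun p => Y (p 0) (p 1))
  refine Eq.trans (congrArg antisum (funext fun i => ?_))
    (h.trans (congrArg₂ (· * ·) ?_ (congrArg antisum (funext fun i => ?_))))
  · exact congrArg₂ (· * ·) (congrArg _ (by funext a; fin_cases a <;> rfl)) rfl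
  · norm_num
  · exact congrArg₂ (· * ·) (congrArg _ (by funext a; fin_cases a <;> rfl)) rfl

lemma antisum_alternatize_contract (L : R7 →L[ℝ] R7 [⋀^Fin 3]→L[ℝ] ℝ) (u : R7)
    (Y : Fin 7 → Fin 7 → Fin 7 → Fin 7 → ℝ) :
    antisum (fun i => ContinuousAlternatingMap.alternatizeUncurryFin L
        ![u, bvec (i 0), bvec (i 1), bvec (i 2)] * Y (i 3) (i 4) (i 5) (i 6)) =
      antisum (fun i => L u ![bvec (i 0), bvec (i 1), bvec (i 2)] * Y (i 3) (i 4) (i 5) (i 6)) -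
      3 * antisum (fun i => L (bvec (i 0)) ![u, bvec (i 1), bvec (i 2)] *
        Y (i 3) (i 4) (i 5) (i 6)) := by
  have h := antisum_alternatizeUncurryFin (k := 2) (l := 4) rfl (contract u L)
    (fun p => Y (p 0) (p 1) (p 2) (p 3))
  have h2 : antisum (fun i => ContinuousAlternatingMap.alternatizeUncurryFin (contract u L)
      ![bvec (i 0), bvec (i 1), bvec (i 2)] * Y (i 3) (i 4) (i 5) (i 6)) =
      3 * antisum (fun i => L (bvec (i 0)) ![u, bvec (i 1), bvec (i 2)] *
        Y (i 3) (i 4) (i 5) (i 6)) := by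
    refine Eq.trans (congrArg antisum (funext fun i => ?_))
      (h.trans (congrArg₂ (· * ·) ?_ (congrArg antisum (funext fun i => ?_))))
    · exact congrArg₂ (· * ·) (congrArg _ (by funext a; fin_cases a <;> rfl)) rfl
    · norm_num
    · refine congrArg₂ (· * ·) ?_ rfl
      rw [contract_apply]
      exact congrArg _ (by funext a; fin_cases a <;> rfl)
  rw [← h2, ← antisum_sub]
  refine congrArg antisum (funext fun i => ?_)
  rw [alternatizeUncurryFin_vecCons, sub_mul]

lemma exists_antisum_eq : ∃ c : Equiv.Perm (Fin 7) → ℝ, ∀ G, antisum G = ∑ π, c π * G π :=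
  ⟨_, fun _ => by unfold antisum; rfl⟩

lemma exists_hasFDerivAt_antisum {g : (Fin 7 → Fin 7) → R7 → ℝ}
    {g' : (Fin 7 → Fin 7) → R7 →L[ℝ] ℝ} {y : R7} (hg : ∀ i, HasFDerivAt (g i) (g' i) y) :
    ∃ L : R7 →L[ℝ] ℝ, HasFDerivAt (fun z => antisum (fun i => g i z)) L y ∧
      ∀ u, L u = antisum (fun i => g' i u) := by
  obtain ⟨c, hc⟩ := exists_antisum_eq
  simp only [hc]
  refine ⟨∑ π : Equiv.Perm (Fin 7), c π • g' π,
    HasFDerivAt.fun_sum fun π _ => (hg π).const_mul _, fun u => ?_⟩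
  simp

lemma antisum_zero {G : (Fin 7 → Fin 7) → ℝ} (h : ∀ i, G i = 0) : antisum G = 0 := by
  unfold antisum
  exact Finset.sum_eq_zero fun π _ => by rw [h, mul_zero]

/-- Exterior derivative of a 6-form as a divergence: pairing with dx^j extracts the j-th component
of the associated vector density, and summing ∂_j of it antisymmetrizes the full derivative. -/
lemma sum_fderiv_antisum {g : (Fin 7 → Fin 7) → R7 → ℝ} {g' : (Fin 7 → Fin 7) → R7 →L[ℝ] ℝ}
    {y : R7} (hg : ∀ i, HasFDerivAt (g i) (g' i) y) :
    ∑ j, fderiv ℝ (fun z => antisum (fun i => bvec (i 0) j * g i z)) y (bvec j) =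
      antisum (fun i => g' i (bvec (i 0))) := by
  have h1 : ∀ j, fderiv ℝ (fun z => antisum (fun i => bvec (i 0) j * g i z)) y (bvec j) =
      antisum (fun i => bvec (i 0) j * g' i (bvec j)) := by
    intro j
    obtain ⟨L, hL, hL'⟩ := exists_hasFDerivAt_antisum fun i => (hg i).const_mul (bvec (i 0) j)
    rw [hL.fderiv, hL']
    exact congrArg antisum (funext fun i => by simp)
  simp only [h1]
  rw [← antisum_sum]
  refine congrArg antisum (funext fun i => ?_)
  simp [bvec_apply]

/-! ### Torsion identities on an open set of ℝ⁷, with θ the 3-form and ψ its dual. -/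

section Local

variable {s : Set R7} {θ : R7 → R7 [⋀^Fin 3]→L[ℝ] ℝ} {ψ : R7 → R7 [⋀^Fin 4]→L[ℝ] ℝ}
  {F : R7 → R7 ≃L[ℝ] R7} {φ : R7 → ℝ}

lemma contDiffOn_dual {n : WithTop ℕ∞} (hθ : ContDiffOn ℝ n θ s)
    (hF : ∀ y ∈ s, θ y = pull (F y) phi0) 
    (hψ : ∀ y ∈ s, ψ y = pull (F y) (starR7 (k := 3) (l := 4) rfl phi0)) :
    ContDiffOn ℝ n ψ s := by
  refine (contDiffOn_frameStar (k := 3) (l := 4) rfl hθ hF hθ).congr fun y hy => ?_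
  rw [hψ y hy, hF y hy, frameStar_pull]

lemma dual_antisum_mul {G : R7 ≃L[ℝ] R7} {η : R7 [⋀^Fin 4]→L[ℝ] ℝ} 
    (h : η = pull G (starR7 (k := 3) (l := 4) rfl phi0))
    (α : R7 [⋀^Fin 3]→L[ℝ] ℝ) :
    antisum (fun i => α ![bvec (i 0), bvec (i 1), bvec (i 2)] *
      η ![bvec (i 3), bvec (i 4), bvec (i 5), bvec (i 6)]) =
      24 * frameDet G * ∑ p : Fin 3 → Fin 7, α (fun a => G.symm (bvec (p a))) *
        phi0 (fun a => bvec (p a)) := by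
  rw [h, antisum_mul_psi G α]

lemma dual_antisum_phi_mul {G : R7 ≃L[ℝ] R7} {η : R7 [⋀^Fin 4]→L[ℝ] ℝ} 
    (h : η = pull G (starR7 (k := 3) (l := 4) rfl phi0))
    {α : R7 [⋀^Fin 3]→L[ℝ] ℝ} (hα : α = pull G phi0) :
    antisum (fun i => α ![bvec (i 0), bvec (i 1), bvec (i 2)] *
      η ![bvec (i 3), bvec (i 4), bvec (i 5), bvec (i 6)]) = 1008 * frameDet G := by
  rw [h, hα, antisum_phi_mul_psi G]

lemma dual_antisum_linear_phi {G : R7 ≃L[ℝ] R7} {η : R7 [⋀^Fin 4]→L[ℝ] ℝ} 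
    (h : η = pull G (starR7 (k := 3) (l := 4) rfl phi0))
    {α : R7 [⋀^Fin 3]→L[ℝ] ℝ} (hα : α = pull G phi0) {c : Fin 7 → ℝ} {u : R7} {z : ℝ}
    (lam : R7 →L[ℝ] ℝ) (hc : ∀ a, lam (bvec a) = c a) (hz : lam u = z) :
    antisum (fun i => c (i 0) *
      (η ![bvec (i 1), bvec (i 2), bvec (i 3), bvec (i 4)] * α ![u, bvec (i 5), bvec (i 6)])) =
      144 * frameDet G * z := by
  obtain rfl : (fun a => lam (bvec a)) = c := funext hc
  rw [h, hα, ← hz, antisum_linear_psi_phi G lam u]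

/-- The first variation along the line y + t u; 432 = 24 · 18, equivalently ∂_u θ ∧ ψ = 3 ∂_u m in
the normalization 3! · 4!. -/
lemma antisum_fderiv_mul_psi (hs : IsOpen s) (hθ : ContDiffOn ℝ ∞ θ s)
    (hF : ∀ y ∈ s, θ y = pull (F y) phi0) 
    (hψ : ∀ y ∈ s, ψ y = pull (F y) (starR7 (k := 3) (l := 4) rfl phi0)) {y : R7} (hy : y ∈ s) (u : R7) :
    antisum (fun i => fderiv ℝ θ y u ![bvec (i 0), bvec (i 1), bvec (i 2)] *
      ψ y ![bvec (i 3), bvec (i 4), bvec (i 5), bvec (i 6)]) =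
      432 * fderiv ℝ (fun z => frameDet (F z)) y u := by
  have hsy := hs.mem_nhds hy
  have hline : HasDerivAt (fun t : ℝ => y + t • u) u 0 := by
    simpa using ((hasDerivAt_id (0 : ℝ)).smul_const u).const_add y
  have hy0 : y + (0 : ℝ) • u = y := by simp
  have hcomp : ∀ {E : Type} [NormedAddCommGroup E] [NormedSpace ℝ E] {f : R7 → E},
      ContDiffOn ℝ ∞ f s → HasDerivAt (fun t : ℝ => f (y + t • u)) (fderiv ℝ f y u) 0 := by
    intro E _ _ f hf
    have h1 : HasFDerivAt f (fderiv ℝ f y) (y + (0 : ℝ) • u) := by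
      rw [hy0]
      exact ((hf.contDiffAt hsy).differentiableAt (by simp)).hasFDerivAt
    exact h1.comp_hasDerivAt (0 : ℝ) hline
  have h := first_variation (hcomp hθ) (hcomp (contDiffOn_frameDet hθ hF))
    (fun i j => (hcomp (contDiffOn_gram hθ hF i j)).differentiableAt) (by
      have h2 : Filter.Tendsto (fun t : ℝ => y + t • u) (nhds 0) (nhds y) := by
        simpa using hline.continuousAt.tendsto
      exact (h2.eventually hsy).mono fun t ht => hF _ ht)
  simp only [hy0] at h
  rw [dual_antisum_mul (hψ y hy)]
  linear_combination 24 * h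

lemma hasFDerivAt_apply_const {n : ℕ} {α : R7 → R7 [⋀^Fin n]→L[ℝ] ℝ} {y : R7}
    (h : DifferentiableAt ℝ α y) (v : Fin n → R7) :
    HasFDerivAt (fun z => α z v)
      ((ContinuousAlternatingMap.apply ℝ R7 ℝ v).comp (fderiv ℝ α y)) y := by
  exact (ContinuousAlternatingMap.apply ℝ R7 ℝ v).hasFDerivAt.comp y h.hasFDerivAt

/-- The derivative of `α` twisted by the function `φ`. -/
def twisted {n : ℕ} (φ : R7 → ℝ) (α : R7 → R7 [⋀^Fin n]→L[ℝ] ℝ) (y : R7) :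
    R7 →L[ℝ] R7 [⋀^Fin n]→L[ℝ] ℝ :=
  fderiv ℝ α y + (4 : ℝ) • (fderiv ℝ φ y).smulRight (α y)

lemma twisted_apply {n : ℕ} (φ : R7 → ℝ) (α : R7 → R7 [⋀^Fin n]→L[ℝ] ℝ) (y u : R7)
    (v : Fin n → R7) :
    twisted φ α y u v = fderiv ℝ α y u v + 4 * fderiv ℝ φ y u * α y v := by
  simp [twisted, mul_assoc]

/-- The identity ι_u β ∧ ψ = 4 dφ(u) vol, in the normalization 3! · 4!. Taking the divergence of
dx^j ∧ ψ ∧ ι_u θ = 3 u^j vol ties d ι_u θ ∧ ψ to dψ, which `hN` gives as -4 dφ∧ψ. Cartan's formula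
and the first variation then determine ι_u dθ ∧ ψ, and the derivatives of the volume density cancel.
-/
lemma antisum_torsion (hs : IsOpen s) (hθ : ContDiffOn ℝ ∞ θ s)
    (hF : ∀ y ∈ s, θ y = pull (F y) phi0) 
    (hψ : ∀ y ∈ s, ψ y = pull (F y) (starR7 (k := 3) (l := 4) rfl phi0))
    (hN : ∀ y ∈ s, ContinuousAlternatingMap.alternatizeUncurryFin
      (twisted φ ψ y) = 0) {y : R7} (hy : y ∈ s) (u : R7) :
    antisum (fun i => ContinuousAlternatingMap.alternatizeUncurryFin (twisted φ θ y)
      ![u, bvec (i 0), bvec (i 1), bvec (i 2)] *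
      ψ y ![bvec (i 3), bvec (i 4), bvec (i 5), bvec (i 6)]) =
      576 * frameDet (F y) * fderiv ℝ φ y u := by
  have hsy := hs.mem_nhds hy
  have cψ := contDiffOn_dual hθ hF hψ
  have dθ : DifferentiableAt ℝ θ y := (hθ.contDiffAt hsy).differentiableAt (by simp)
  have dψ : DifferentiableAt ℝ ψ y :=
    (cψ.contDiffAt hsy).differentiableAt (by simp)
  have dm : DifferentiableAt ℝ (fun y => frameDet (F y)) y :=
    ((contDiffOn_frameDet hθ hF).contDiffAt hsy).differentiableAt (by simp)
  set m := frameDet (F y)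
  set m' := fderiv ℝ (fun z => frameDet (F z)) y u with hm'
  have hg : ∀ i : Fin 7 → Fin 7, HasFDerivAt (fun z =>
      ψ z ![bvec (i 1), bvec (i 2), bvec (i 3), bvec (i 4)] * θ z ![u, bvec (i 5), bvec (i 6)])
      _ y := fun i => (hasFDerivAt_apply_const dψ _).mul (hasFDerivAt_apply_const dθ _)
  have h1 := sum_fderiv_antisum hg
  have h2 : ∀ j, (fun z => antisum (fun i => bvec (i 0) j *
      (ψ z ![bvec (i 1), bvec (i 2), bvec (i 3), bvec (i 4)] *
        θ z ![u, bvec (i 5), bvec (i 6)]))) =ᶠ[nhds y] fun z => frameDet (F z) * (144 * u j) := by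
    intro j
    filter_upwards [hsy] with z hz
    refine (dual_antisum_linear_phi (hψ z hz) (hF z hz) (c := fun a => bvec a j) (z := u j)
      (EuclideanSpace.proj j) (fun _ => rfl) rfl).trans (?_)
    ring
  have h3 : ∑ j, fderiv ℝ (fun z => antisum (fun i => bvec (i 0) j *
      (ψ z ![bvec (i 1), bvec (i 2), bvec (i 3), bvec (i 4)] *
        θ z ![u, bvec (i 5), bvec (i 6)]))) y (bvec j) = 144 * m' := by
    have h4 : ∀ j, fderiv ℝ (fun z => antisum (fun i => bvec (i 0) j *
      (ψ z ![bvec (i 1), bvec (i 2), bvec (i 3), bvec (i 4)] *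
        θ z ![u, bvec (i 5), bvec (i 6)]))) y (bvec j) =
        144 * (u j * fderiv ℝ (fun z => frameDet (F z)) y (bvec j)) := by
      intro j
      rw [(h2 j).fderiv_eq, (dm.hasFDerivAt.mul_const _).fderiv]
      simp
      ring
    simp only [h4, ← Finset.mul_sum]
    rw [hm', ← linear_eq_sum]
  rw [h3] at h1
  set a₁ := antisum (fun i => fderiv ℝ ψ y (bvec (i 0))
    ![bvec (i 1), bvec (i 2), bvec (i 3), bvec (i 4)] * θ y ![u, bvec (i 5), bvec (i 6)]) with ha₁
  set a₂ := antisum (fun i => fderiv ℝ θ y (bvec (i 0)) ![u, bvec (i 1), bvec (i 2)] *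
    ψ y ![bvec (i 3), bvec (i 4), bvec (i 5), bvec (i 6)]) with ha₂
  -- The product rule for ψ ∧ ι_u θ, whose antisymmetrized derivative is the divergence of 144 m u.
  have h5 : 144 * m' = a₂ + a₁ := by
    rw [h1, ha₁, ha₂, ← antisum_swap_four_two' (fun a b c d => ψ y
      ![bvec a, bvec b, bvec c, bvec d]) (fun a b c => fderiv ℝ θ y (bvec a) ![u, bvec b, bvec c]),
      ← antisum_add]
    refine congrArg antisum (funext fun i => ?_)
    simp
    ring
  have hc1 : antisum (fun i => fderiv ℝ φ y (bvec (i 0)) *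
      (ψ y ![bvec (i 1), bvec (i 2), bvec (i 3), bvec (i 4)] *
        θ y ![u, bvec (i 5), bvec (i 6)])) = 144 * m * fderiv ℝ φ y u := by
    exact dual_antisum_linear_phi (hψ y hy) (hF y hy) (c := fun a => fderiv ℝ φ y (bvec a))
      (fderiv ℝ φ y) (fun _ => rfl) rfl
  have hc2 : antisum (fun i => (fderiv ℝ φ y (bvec (i 0)) * θ y ![u, bvec (i 1), bvec (i 2)]) *
      ψ y ![bvec (i 3), bvec (i 4), bvec (i 5), bvec (i 6)]) =
      144 * m * fderiv ℝ φ y u := by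
    rw [← hc1, ← antisum_swap_four_two' (fun a b c d => ψ y
      ![bvec a, bvec b, bvec c, bvec d])
      (fun a b c => fderiv ℝ φ y (bvec a) * θ y ![u, bvec b, bvec c])]
    exact congrArg antisum (funext fun i => by ring)
  -- The twisted closedness of ψ, wedged with ι_u θ: a₁ = -4 · 144 m dφ(u).
  have h6 : a₁ = -576 * m * fderiv ℝ φ y u := by
    have h7 := antisum_alternatize_four (twisted φ ψ y)
      (fun a b => θ y ![u, bvec a, bvec b])
    rw [hN y hy] at h7
    replace h7 := (antisum_zero fun i => zero_mul (θ y ![u, bvec (i 5), bvec (i 6)])).symm.trans h7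
    simp only [twisted_apply, add_mul] at h7
    rw [antisum_add] at h7
    simp only [mul_assoc] at h7
    rw [antisum_mul, hc1] at h7
    linear_combination -(1 / 5) * h7
  rw [antisum_alternatize_contract (twisted φ θ y) u (fun a b c d => ψ y
      ![bvec a, bvec b, bvec c, bvec d])]
  have h9 : antisum (fun i => twisted φ θ y u ![bvec (i 0), bvec (i 1), bvec (i 2)] *
      ψ y ![bvec (i 3), bvec (i 4), bvec (i 5), bvec (i 6)]) =
      432 * m' + 4 * fderiv ℝ φ y u * (1008 * m) := by
    rw [← dual_antisum_phi_mul (hψ y hy) (hF y hy), ← antisum_fderiv_mul_psi hs hθ hF hψ hy u, ← antisum_mul, ← antisum_add]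
    refine congrArg antisum (funext fun i => ?_)
    rw [twisted_apply]
    ring
  have h11 : antisum (fun i => twisted φ θ y (bvec (i 0)) ![u, bvec (i 1), bvec (i 2)] *
      ψ y ![bvec (i 3), bvec (i 4), bvec (i 5), bvec (i 6)]) =
      a₂ + 4 * (144 * m * fderiv ℝ φ y u) := by
    rw [← hc2, ← antisum_mul, ha₂, ← antisum_add]
    refine congrArg antisum (funext fun i => ?_)
    rw [twisted_apply]
    ring
  -- The two occurrences of 432 m' cancel, leaving (4032 + 1728 - 1728 · 3 + …) reduced by `h5` and
  -- `h6` to 576 m dφ(u).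
  rw [h9, h11]
  linear_combination 3 * h5 + 3 * h6

lemma star_antisum_mul {G : R7 ≃L[ℝ] R7} {β : R7 [⋀^Fin 4]→L[ℝ] ℝ} {τ : R7 [⋀^Fin 3]→L[ℝ] ℝ}
    (h : τ = frameStar G (k := 4) (l := 3) rfl β) :
    antisum (fun i => τ ![bvec (i 0), bvec (i 1), bvec (i 2)] *
      β ![bvec (i 3), bvec (i 4), bvec (i 5), bvec (i 6)]) =
      6 * frameDet G * ∑ p : Fin 4 → Fin 7, β (fun a => G.symm (bvec (p a))) ^ 2 := by
  rw [h, antisum_star_mul G β]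

lemma star_antisum_linear {G : R7 ≃L[ℝ] R7} {β η : R7 [⋀^Fin 4]→L[ℝ] ℝ}
    {τ α : R7 [⋀^Fin 3]→L[ℝ] ℝ} (h : τ = frameStar G (k := 4) (l := 3) rfl β)
    (hα : α = pull G phi0) (hη : η = pull G (starR7 (k := 3) (l := 4) rfl phi0))
    {c : Fin 7 → ℝ} {u : R7} (lam : R7 →L[ℝ] ℝ) (hc : ∀ a, lam (bvec a) = c a)
    (hu : ∑ a, lam (G.symm (bvec a)) • G.symm (bvec a) = u) :
    antisum (fun i => c (i 0) *
      (τ ![bvec (i 1), bvec (i 2), bvec (i 3)] * α ![bvec (i 4), bvec (i 5), bvec (i 6)])) =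
      -(1 / 4) * antisum (fun i => β ![u, bvec (i 0), bvec (i 1), bvec (i 2)] *
        η ![bvec (i 3), bvec (i 4), bvec (i 5), bvec (i 6)]) := by
  obtain rfl : (fun a => lam (bvec a)) = c := funext hc
  rw [h, hα, hη, ← hu, antisum_linear_star_phi G lam β]

/-- States that τ∧ω is a negative multiple of ⋆dφ. It combines `star_antisum_linear` for λ = dx^j
with `antisum_torsion` for u = λ♯; the constant is 576/4. -/
lemma antisum_star_eq (hs : IsOpen s) (hθ : ContDiffOn ℝ ∞ θ s)
    (hF : ∀ y ∈ s, θ y = pull (F y) phi0)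
    (hψ : ∀ y ∈ s, ψ y = pull (F y) (starR7 (k := 3) (l := 4) rfl phi0))
    (hN : ∀ y ∈ s, ContinuousAlternatingMap.alternatizeUncurryFin (twisted φ ψ y) = 0)
    {β : R7 [⋀^Fin 4]→L[ℝ] ℝ} {τ : R7 [⋀^Fin 3]→L[ℝ] ℝ} {y : R7} (hy : y ∈ s)
    (hβ : β = ContinuousAlternatingMap.alternatizeUncurryFin (twisted φ θ y))
    (hτ : τ = frameStar (F y) (k := 4) (l := 3) rfl β) (j : Fin 7) :
    antisum (fun i => bvec (i 0) j *
      (τ ![bvec (i 1), bvec (i 2), bvec (i 3)] * θ y ![bvec (i 4), bvec (i 5), bvec (i 6)])) =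
      -(144 * (frameDet (F y) * ∑ k, gram (F y).symm j k * fderiv ℝ φ y (bvec k))) := by
  rw [star_antisum_linear hτ (hF y hy) (hψ y hy) (c := fun a => bvec a j)
    (EuclideanSpace.proj j) (fun _ => rfl) rfl, hβ, antisum_torsion hs hθ hF hψ hN hy,
    linear_eq_sum (fderiv ℝ φ y)]
  have h : ∀ k, (∑ a, (EuclideanSpace.proj j : R7 →L[ℝ] ℝ) ((F y).symm (bvec a)) •
      (F y).symm (bvec a)) k = gram (F y).symm j k := by
    intro k
    simp [gram]
  simp only [h]
  ring

/-- Coordinate form of √g Δf = √g f |β|²: the left side is, up to -1/36, the derivative of fτ∧ω, and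
closedness of τ leaves only -τ∧fβ. The 24 turns the sum over ordered quadruples into |β|². -/
lemma divergence_identity (hs : IsOpen s) (hθ : ContDiffOn ℝ ∞ θ s)
    (hF : ∀ y ∈ s, θ y = pull (F y) phi0)
    (hψ : ∀ y ∈ s, ψ y = pull (F y) (starR7 (k := 3) (l := 4) rfl phi0))
    (hN : ∀ y ∈ s, ContinuousAlternatingMap.alternatizeUncurryFin (twisted φ ψ y) = 0)
    {β : R7 → R7 [⋀^Fin 4]→L[ℝ] ℝ} {τ : R7 → R7 [⋀^Fin 3]→L[ℝ] ℝ}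
    (hβ : ∀ y ∈ s, β y = ContinuousAlternatingMap.alternatizeUncurryFin (twisted φ θ y))
    (hτ : ∀ y ∈ s, τ y = frameStar (F y) (k := 4) (l := 3) rfl (β y))
    (hφ : DifferentiableOn ℝ φ s) (dτ : DifferentiableOn ℝ τ s)
    (hτ' : ∀ y ∈ s, ContinuousAlternatingMap.alternatizeUncurryFin (fderiv ℝ τ y) = 0)
    {y : R7} (hy : y ∈ s) :
    ∑ j, fderiv ℝ (fun z => frameDet (F z) * ∑ k, gram (F z).symm j k *
        fderiv ℝ (fun x => Real.exp (4 * φ x)) z (bvec k)) y (bvec j) =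
      Real.exp (4 * φ y) * frameDet (F y) / 24 *
        ∑ p : Fin 4 → Fin 7, β y (fun a => (F y).symm (bvec (p a))) ^ 2 := by
  have hsy := hs.mem_nhds hy
  have hf : ∀ z ∈ s, HasFDerivAt (fun x => Real.exp (4 * φ x))
      (Real.exp (4 * φ z) • ((4 : ℝ) • fderiv ℝ φ z)) z := fun z hz =>
    (((hφ z hz).differentiableAt (hs.mem_nhds hz)).hasFDerivAt.const_mul 4).exp
  have dθ : DifferentiableAt ℝ θ y := (hθ.contDiffAt hsy).differentiableAt (by simp)
  have dτy : DifferentiableAt ℝ τ y := (dτ y hy).differentiableAt hsy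
  have hg : ∀ i : Fin 7 → Fin 7, HasFDerivAt (fun z => Real.exp (4 * φ z) *
      (τ z ![bvec (i 1), bvec (i 2), bvec (i 3)] * θ z ![bvec (i 4), bvec (i 5), bvec (i 6)]))
      _ y := fun i => (hf y hy).mul
    ((hasFDerivAt_apply_const dτy _).mul (hasFDerivAt_apply_const dθ _))
  have h1 := sum_fderiv_antisum hg
  -- Here df = 4f dφ, so the factor is -4/144 = -1/36.
  have h2 : ∀ j, (fun z => frameDet (F z) * ∑ k, gram (F z).symm j k *
        fderiv ℝ (fun x => Real.exp (4 * φ x)) z (bvec k)) =ᶠ[nhds y] fun z =>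
      -(1 / 36) * antisum (fun i => bvec (i 0) j * (Real.exp (4 * φ z) *
      (τ z ![bvec (i 1), bvec (i 2), bvec (i 3)] *
        θ z ![bvec (i 4), bvec (i 5), bvec (i 6)]))) := by
    intro j
    filter_upwards [hsy] with z hz
    simp only [mul_left_comm _ (Real.exp (4 * φ z)) _]
    rw [antisum_mul, antisum_star_eq hs hθ hF hψ hN hz (hβ z hz) (hτ z hz) j, (hf z hz).fderiv]
    have h5 : ∑ k, gram (F z).symm j k *
        (Real.exp (4 * φ z) • ((4 : ℝ) • fderiv ℝ φ z)) (bvec k) =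
        4 * Real.exp (4 * φ z) * ∑ k, gram (F z).symm j k * fderiv ℝ φ z (bvec k) := by
      rw [Finset.mul_sum]
      refine Finset.sum_congr rfl fun k _ => ?_
      rw [_root_.smul_apply, _root_.smul_apply, smul_eq_mul, smul_eq_mul]
      ring
    rw [h5]
    ring
  have h3 : ∀ j, fderiv ℝ (fun z => frameDet (F z) * ∑ k, gram (F z).symm j k *
        fderiv ℝ (fun x => Real.exp (4 * φ x)) z (bvec k)) y (bvec j) = -(1 / 36) *
      fderiv ℝ (fun z => antisum (fun i => bvec (i 0) j * (Real.exp (4 * φ z) *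
      (τ z ![bvec (i 1), bvec (i 2), bvec (i 3)] *
        θ z ![bvec (i 4), bvec (i 5), bvec (i 6)])))) y (bvec j) := by
    intro j
    obtain ⟨L, hL, -⟩ := exists_hasFDerivAt_antisum fun i => (hg i).const_mul (bvec (i 0) j)
    rw [(h2 j).fderiv_eq, (hL.const_mul _).fderiv, hL.fderiv]
    rfl
  simp only [h3]
  rw [← Finset.mul_sum, h1]
  have h4 : antisum (fun i => fderiv ℝ τ y (bvec (i 0)) ![bvec (i 1), bvec (i 2), bvec (i 3)] *
      θ y ![bvec (i 4), bvec (i 5), bvec (i 6)]) = 0 := by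
    have h5 := antisum_alternatize_three (fderiv ℝ τ y)
      (fun a b c => θ y ![bvec a, bvec b, bvec c])
    rw [hτ' y hy] at h5
    replace h5 := (antisum_zero fun i =>
      zero_mul (θ y ![bvec (i 4), bvec (i 5), bvec (i 6)])).symm.trans h5
    linarith
  have h6 : antisum (fun i => τ y ![bvec (i 1), bvec (i 2), bvec (i 3)] *
      twisted φ θ y (bvec (i 0)) ![bvec (i 4), bvec (i 5), bvec (i 6)]) =
      -(3 / 2) * (frameDet (F y) *
        ∑ p : Fin 4 → Fin 7, β y (fun a => (F y).symm (bvec (p a))) ^ 2) := by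
    have h7 := antisum_alternatize_three (twisted φ θ y)
      (fun a b c => τ y ![bvec a, bvec b, bvec c])
    rw [← hβ y hy, ← antisum_swap_three_four (fun a b c => τ y ![bvec a, bvec b, bvec c])
      (fun a b c d => β y ![bvec a, bvec b, bvec c, bvec d]), star_antisum_mul (hτ y hy)] at h7
    rw [antisum_swap_three_three' (fun a b c => τ y ![bvec a, bvec b, bvec c])
      (fun a b c d => twisted φ θ y (bvec a) ![bvec b, bvec c, bvec d])]
    linear_combination (1 / 4) * h7
  -- The product rule as produced by `hg`: the derivative of the exponential, 4f dφ, joins ∂θ to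
  -- form the twisted derivative.
  have h8 : antisum (fun i => (Real.exp (4 * φ y) •
      (τ y ![bvec (i 1), bvec (i 2), bvec (i 3)] •
        (ContinuousAlternatingMap.apply ℝ R7 ℝ ![bvec (i 4), bvec (i 5), bvec (i 6)]).comp
          (fderiv ℝ θ y) + θ y ![bvec (i 4), bvec (i 5), bvec (i 6)] •
        (ContinuousAlternatingMap.apply ℝ R7 ℝ ![bvec (i 1), bvec (i 2), bvec (i 3)]).comp
          (fderiv ℝ τ y)) + (τ y ![bvec (i 1), bvec (i 2), bvec (i 3)] *
            θ y ![bvec (i 4), bvec (i 5), bvec (i 6)]) •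
        Real.exp (4 * φ y) • ((4 : ℝ) • fderiv ℝ φ y)) (bvec (i 0))) =
      Real.exp (4 * φ y) * (antisum (fun i =>
        τ y ![bvec (i 1), bvec (i 2), bvec (i 3)] *
          twisted φ θ y (bvec (i 0)) ![bvec (i 4), bvec (i 5), bvec (i 6)]) +
        antisum (fun i => fderiv ℝ τ y (bvec (i 0)) ![bvec (i 1), bvec (i 2), bvec (i 3)] *
          θ y ![bvec (i 4), bvec (i 5), bvec (i 6)])) := by
    rw [← antisum_add, ← antisum_mul]
    refine congrArg antisum (funext fun i => ?_)
    rw [twisted_apply]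
    simp
    ring
  rw [h8, h6, h4]
  ring

end Local

/-! ### The strong maximum principle -/

/-- If c were positive, the second derivative test would make 0 a local minimum as well; then W
would be locally constant and c would vanish. -/
lemma second_deriv_nonpos_of_isLocalMax {W W' : ℝ → ℝ} {c : ℝ}
    (h1 : ∀ᶠ t in nhds (0 : ℝ), HasDerivAt W (W' t) t) (h2 : HasDerivAt W' c 0)
    (hmax : IsLocalMax W 0) : W' 0 = 0 ∧ c ≤ 0 := by
  have h0 : W' 0 = 0 := hmax.hasDerivAt_eq_zero h1.self_of_nhds
  refine ⟨h0, ?_⟩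
  by_contra! hc
  have hd : deriv W =ᶠ[nhds 0] W' := h1.mono fun t ht => ht.deriv
  have hdd : deriv (deriv W) 0 = c := by rw [hd.deriv_eq, h2.deriv]
  have hmin : IsLocalMin W 0 := isLocalMin_of_deriv_deriv_pos (by rwa [hdd])
    (by rw [h1.self_of_nhds.deriv, h0]) h1.self_of_nhds.continuousAt
  have hconst : W =ᶠ[nhds 0] fun _ => W 0 := by
    filter_upwards [hmax, hmin] with t ht1 ht2 using le_antisymm ht1 ht2
  have h3 : deriv (deriv W) 0 = 0 := by
    have : deriv W =ᶠ[nhds 0] fun _ => (0 : ℝ) := hconst.deriv.trans (by simp)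
    rw [this.deriv_eq]
    simp
  linarith

section MaximumPrinciple

variable {n : ℕ} {ι : Type*} [Fintype ι]

lemma barrier_hasDerivAt (α ρ A B C t : ℝ) :
    HasDerivAt (fun t : ℝ => Real.exp (-α * (A + 2 * t * B + t ^ 2 * C)) - ρ)
      (Real.exp (-α * (A + 2 * t * B + t ^ 2 * C)) * (-α * (2 * B + 2 * t * C))) t := by
  have h : HasDerivAt (fun t : ℝ => -α * (A + 2 * t * B + t ^ 2 * C))
      (-α * (2 * B + 2 * t * C)) t := by
    have h1 := (((((hasDerivAt_id t).const_mul 2).mul_const B).const_add A).add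
      (((hasDerivAt_id t).pow 2).mul_const C)).const_mul (-α)
    refine h1.congr_deriv ?_
    simp
  exact h.exp.sub_const _

lemma barrier_hasDerivAt_second (α A B C : ℝ) :
    HasDerivAt (fun t : ℝ => Real.exp (-α * (A + 2 * t * B + t ^ 2 * C)) *
        (-α * (2 * B + 2 * t * C)))
      (Real.exp (-α * A) * (4 * α ^ 2 * B ^ 2 - 2 * α * C)) 0 := by
  have h1 : HasDerivAt (fun t : ℝ => -α * (2 * B + 2 * t * C)) (-α * (2 * C)) 0 := by
    have := (((((hasDerivAt_id (0 : ℝ)).const_mul 2).mul_const C).const_add (2 * B))).const_mul (-α)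
    refine this.congr_deriv ?_
    simp
  have h2 := ((barrier_hasDerivAt α 0 A B C 0).fun_mul h1)
  simp only [sub_zero] at h2
  refine h2.congr_deriv ?_
  simp
  ring

/-- At an interior maximum of `f` plus a multiple of a Gaussian barrier, the first derivative
vanishes and the second derivative is nonpositive, in every direction. -/
lemma barrier_test {U : Set (EuclideanSpace ℝ (Fin n))} (hU : IsOpen U) {f : EuclideanSpace ℝ (Fin n) → ℝ} (hf : ContDiffOn ℝ 2 f U) {z p : EuclideanSpace ℝ (Fin n)}
    (hz : z ∈ U) {δ α c : ℝ}
    (hmax : IsLocalMax (fun x => f x + δ * (Real.exp (-α * ‖x - p‖ ^ 2) - c)) z) (u : EuclideanSpace ℝ (Fin n)) :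
    fderiv ℝ f z u + δ * (Real.exp (-α * ‖z - p‖ ^ 2) * (-2 * α * inner ℝ (z - p) u)) = 0 ∧
    fderiv ℝ (fderiv ℝ f) z u u + δ * (Real.exp (-α * ‖z - p‖ ^ 2) *
      (4 * α ^ 2 * inner ℝ (z - p) u ^ 2 - 2 * α * ‖u‖ ^ 2)) ≤ 0 := by
  have hline : ∀ t : ℝ, HasDerivAt (fun t : ℝ => z + t • u) u t := fun t => by
    simpa using ((hasDerivAt_id t).smul_const u).const_add z
  have hz0 : z + (0 : ℝ) • u = z := by simp
  have htend : Filter.Tendsto (fun t : ℝ => z + t • u) (nhds 0) (nhds z) := by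
    simpa using (hline 0).continuousAt.tendsto
  have hnorm : ∀ t : ℝ, ‖z + t • u - p‖ ^ 2 =
      ‖z - p‖ ^ 2 + 2 * t * inner ℝ (z - p) u + t ^ 2 * ‖u‖ ^ 2 := fun t => by
    rw [show z + t • u - p = (z - p) + t • u by abel, norm_add_sq_real, inner_smul_right, norm_smul,
      mul_pow, Real.norm_eq_abs, sq_abs]
    ring
  have hmax' : IsLocalMax (fun t : ℝ => f (z + t • u) + δ * (Real.exp (-α *
      (‖z - p‖ ^ 2 + 2 * t * inner ℝ (z - p) u + t ^ 2 * ‖u‖ ^ 2)) - c)) 0 := by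
    have h := htend.eventually hmax
    refine h.mono fun t ht => ?_
    simpa only [hnorm, hz0, mul_zero, zero_mul, add_zero, ne_eq, OfNat.ofNat_ne_zero,
      not_false_eq_true, zero_pow] using ht
  have hd : ∀ᶠ t in nhds (0 : ℝ), HasDerivAt (fun t : ℝ => f (z + t • u) + δ * (Real.exp (-α *
      (‖z - p‖ ^ 2 + 2 * t * inner ℝ (z - p) u + t ^ 2 * ‖u‖ ^ 2)) - c))
      (fderiv ℝ f (z + t • u) u + δ * (Real.exp (-α *
        (‖z - p‖ ^ 2 + 2 * t * inner ℝ (z - p) u + t ^ 2 * ‖u‖ ^ 2)) *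
          (-α * (2 * inner ℝ (z - p) u + 2 * t * ‖u‖ ^ 2)))) t := by
    filter_upwards [htend.eventually (hU.mem_nhds hz)] with t ht
    have h1 : HasFDerivAt f (fderiv ℝ f (z + t • u)) (z + t • u) :=
      ((hf.contDiffAt (hU.mem_nhds ht)).differentiableAt (by simp)).hasFDerivAt
    exact (h1.comp_hasDerivAt t (hline t)).add ((barrier_hasDerivAt _ _ _ _ _ _).const_mul _)
  have hd2 : HasDerivAt (fun t : ℝ => fderiv ℝ f (z + t • u) u + δ * (Real.exp (-α *
        (‖z - p‖ ^ 2 + 2 * t * inner ℝ (z - p) u + t ^ 2 * ‖u‖ ^ 2)) *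
          (-α * (2 * inner ℝ (z - p) u + 2 * t * ‖u‖ ^ 2))))
      (fderiv ℝ (fderiv ℝ f) z u u + δ * (Real.exp (-α * ‖z - p‖ ^ 2) *
      (4 * α ^ 2 * inner ℝ (z - p) u ^ 2 - 2 * α * ‖u‖ ^ 2))) 0 := by
    have h1 : HasFDerivAt (fderiv ℝ f) (fderiv ℝ (fderiv ℝ f) z) (z + (0 : ℝ) • u) := by
      rw [hz0]
      exact (((hf.contDiffAt (hU.mem_nhds hz)).fderiv_right (m := 1)
        (by norm_num)).differentiableAt (by simp)).hasFDerivAt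
    have h2 : HasDerivAt (fun t : ℝ => fderiv ℝ f (z + t • u) u)
        (fderiv ℝ (fderiv ℝ f) z u u) 0 :=
      (ContinuousLinearMap.apply ℝ ℝ u).hasFDerivAt.comp_hasDerivAt (0 : ℝ)
        (h1.comp_hasDerivAt (0 : ℝ) (hline 0))
    exact h2.add ((barrier_hasDerivAt_second _ _ _ _).const_mul _)
  have h := second_deriv_nonpos_of_isLocalMax hd hd2 hmax'
  refine ⟨?_, h.2⟩
  have h1 := h.1
  simp only [hz0, mul_zero, zero_mul, add_zero, ne_eq, OfNat.ofNat_ne_zero,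
      not_false_eq_true, zero_pow] at h1
  rw [← h1]
  ring

/-- Rewrites the quadratic form through the Gram matrix of the vectors, the only quantity assumed
continuous; the individual vectors may jump. -/
lemma sum_inner_sq_eq (e : ι → EuclideanSpace ℝ (Fin n)) (X : EuclideanSpace ℝ (Fin n)) :
    ∑ a, inner ℝ X (e a) ^ 2 = ∑ j, ∑ k, X j * X k * ∑ a, e a j * e a k := by
  have h : ∀ a, inner ℝ X (e a) ^ 2 = ∑ j, ∑ k, X j * X k * (e a j * e a k) := by
    intro a
    rw [PiLp.inner_apply, sq, Finset.sum_mul_sum]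
    refine Finset.sum_congr rfl fun j _ => Finset.sum_congr rfl fun k _ => ?_
    simp
    ring
  simp only [h, Finset.mul_sum]
  rw [Finset.sum_comm]
  refine Finset.sum_congr rfl fun j _ => ?_
  rw [Finset.sum_comm]

lemma sum_norm_sq_eq (e : ι → EuclideanSpace ℝ (Fin n)) : ∑ a, ‖e a‖ ^ 2 = ∑ j, ∑ a, e a j * e a j := by
  rw [Finset.sum_comm]
  refine Finset.sum_congr rfl fun a _ => ?_
  rw [EuclideanSpace.norm_sq_eq]
  refine Finset.sum_congr rfl fun j _ => ?_
  rw [Real.norm_eq_abs, sq_abs, sq]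

/-- The barrier `exp (-α ‖x - p‖²)` is a strict subsolution for large `α`. -/
lemma exists_barrier {K : Set (EuclideanSpace ℝ (Fin n))} (hK : IsCompact K) {p : EuclideanSpace ℝ (Fin n)} (hp : p ∉ K) {e : ι → EuclideanSpace ℝ (Fin n) → EuclideanSpace ℝ (Fin n)} {b : EuclideanSpace ℝ (Fin n) → EuclideanSpace ℝ (Fin n)}
    (he : ∀ j k, ContinuousOn (fun y => ∑ a, e a y j * e a y k) K) (hb : ContinuousOn b K)
    (hnd : ∀ y ∈ K, ∀ v : EuclideanSpace ℝ (Fin n), (∀ a, inner ℝ v (e a y) = 0) → v = 0) :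
    ∃ α > 0, ∀ y ∈ K, 0 < ∑ a, (4 * α ^ 2 * inner ℝ (y - p) (e a y) ^ 2 - 2 * α * ‖e a y‖ ^ 2) +
      -2 * α * inner ℝ (y - p) (b y) := by
  have hQc : ContinuousOn (fun y => ∑ a, inner ℝ (y - p) (e a y) ^ 2) K := by
    simp only [sum_inner_sq_eq]
    fun_prop
  have hNc : ContinuousOn (fun y => ∑ a, ‖e a y‖ ^ 2 + inner ℝ (y - p) (b y)) K := by
    simp only [sum_norm_sq_eq]
    refine ContinuousOn.add (continuousOn_finsetSum _ fun j _ => he j j) ?_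
    exact ContinuousOn.inner (𝕜 := ℝ) (by fun_prop) hb
  have hpos : ∀ y ∈ K, 0 < ∑ a, inner ℝ (y - p) (e a y) ^ 2 := by
    intro y hy
    by_contra! h
    have h0 : ∑ a, inner ℝ (y - p) (e a y) ^ 2 = 0 :=
      le_antisymm h (Finset.sum_nonneg fun a _ => sq_nonneg _)
    rw [Finset.sum_eq_zero_iff_of_nonneg fun a _ => sq_nonneg _] at h0
    have h1 := hnd y hy (y - p) fun a => pow_eq_zero_iff (two_ne_zero) |>.1 (h0 a (Finset.mem_univ _))
    exact hp (sub_eq_zero.1 h1 ▸ hy)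
  rcases K.eq_empty_or_nonempty with rfl | hne
  · exact ⟨1, one_pos, by simp⟩
  obtain ⟨y1, hy1, hmin⟩ := hK.exists_isMinOn hne hQc
  obtain ⟨y2, hy2, hmax⟩ := hK.exists_isMaxOn hne hNc
  set q := ∑ a, inner ℝ (y1 - p) (e a y1) ^ 2 with hq
  have hq0 : 0 < q := hpos y1 hy1
  set N := ∑ a, ‖e a y2‖ ^ 2 + inner ℝ (y2 - p) (b y2) with hN
  -- Here q is the minimum of the principal term and N the maximum of the remaining terms, so that
  -- 2αq = 2(|N| + 1) exceeds N.
  refine ⟨(|N| + 1) / q, by positivity, fun y hy => ?_⟩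
  have h1 : q ≤ ∑ a, inner ℝ (y - p) (e a y) ^ 2 := hmin hy
  have h2 : ∑ a, ‖e a y‖ ^ 2 + inner ℝ (y - p) (b y) ≤ N := hmax hy
  have h3 : ((|N| + 1) / q) * q = |N| + 1 := by field_simp
  set α := (|N| + 1) / q with hα
  have hα0 : 0 < α := by positivity
  rw [Finset.sum_sub_distrib, ← Finset.mul_sum, ← Finset.mul_sum]
  have h4 : α * q ≤ α * ∑ a, inner ℝ (y - p) (e a y) ^ 2 := by gcongr
  have h5 := le_abs_self N
  have h6 : 0 < α * (2 * (α * ∑ a, inner ℝ (y - p) (e a y) ^ 2) -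
      (∑ a, ‖e a y‖ ^ 2 + inner ℝ (y - p) (b y))) := by
    refine mul_pos hα0 ?_
    have := abs_nonneg N
    linarith
  linarith

/-- A nearest-point configuration for the Hopf boundary argument. -/
lemma exists_touching_ball {U : Set (EuclideanSpace ℝ (Fin n))} (hU : IsOpen U) {f : EuclideanSpace ℝ (Fin n) → ℝ} (hf : ContinuousOn f U) {M : ℝ}
    (hM : ∀ y ∈ U, f y ≤ M) {y₀ : EuclideanSpace ℝ (Fin n)} (hy₀ : y₀ ∈ U) (h0 : f y₀ = M)
    (hne : ¬ ∀ᶠ y in nhds y₀, f y = M) :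
    ∃ p q : EuclideanSpace ℝ (Fin n), p ≠ q ∧ q ∈ U ∧ f q = M ∧
      ∀ x ∈ Metric.closedBall p ‖q - p‖, x ∈ U ∧ (x ≠ q → f x < M) := by
  obtain ⟨R, hR, hRU⟩ := Metric.nhds_basis_closedBall.mem_iff.1 (hU.mem_nhds hy₀)
  -- The point is so close to y₀ that the ball about it reaching the nearest maximum point stays
  -- inside the ball of radius R.
  have h1 : ∃ p₀ ∈ Metric.ball y₀ (R / 4), f p₀ ≠ M := by
    by_contra! h
    exact hne (Filter.mem_of_superset (Metric.ball_mem_nhds y₀ (by positivity)) h)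
  obtain ⟨p₀, hp₀, hfp⟩ := h1
  rw [Metric.mem_ball] at hp₀
  have hK : IsCompact {x | x ∈ Metric.closedBall y₀ R ∧ f x = M} := by
    refine (isCompact_closedBall y₀ R).of_isClosed_subset ?_ fun x hx => hx.1
    have := (hf.mono hRU).preimage_isClosed_of_isClosed Metric.isClosed_closedBall
      (isClosed_singleton (x := M))
    exact this
  obtain ⟨q, hq, hqmin⟩ := hK.exists_isMinOn ⟨y₀, by simp [hR.le], h0⟩
    (continuous_id.dist (continuous_const (y := p₀))).continuousOn
  have hqd : dist q p₀ ≤ dist y₀ p₀ := hqmin ⟨by simp [hR.le], h0⟩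
  rw [dist_comm y₀] at hqd
  have hpq : p₀ ≠ q := fun h => hfp (h ▸ hq.2)
  have hlt : ∀ x, dist x p₀ < dist q p₀ → x ∈ U ∧ f x < M := by
    intro x hx
    have hxR : x ∈ Metric.closedBall y₀ R := by
      rw [Metric.mem_closedBall]
      linarith [dist_triangle x p₀ y₀]
    refine ⟨hRU hxR, (hM x (hRU hxR)).lt_of_ne fun h => ?_⟩
    exact absurd (hqmin ⟨hxR, h⟩ : dist q p₀ ≤ dist x p₀) (not_le.2 hx)
  have hqU : q ∈ U := hRU hq.1
  -- Halving the ball towards q leaves q as the only contact point with the maximum set.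
  refine ⟨midpoint ℝ p₀ q, q, ?_, hqU, hq.2, fun x hx => ?_⟩
  · rw [ne_eq, midpoint_eq_right_iff]
    exact hpq
  · by_cases hxq : x = q
    · exact ⟨hxq ▸ hqU, fun h => absurd hxq h⟩
    have h2 : dist x p₀ < dist q p₀ := by
      have hxp : ‖x - midpoint ℝ p₀ q‖ ≤ ‖q - midpoint ℝ p₀ q‖ := by
        rwa [Metric.mem_closedBall, dist_eq_norm] at hx
      have e1 : x - p₀ = (x - midpoint ℝ p₀ q) + (q - midpoint ℝ p₀ q) := by
        rw [midpoint_eq_smul_add, invOf_eq_inv]; module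
      have e2 : x - q = (x - midpoint ℝ p₀ q) - (q - midpoint ℝ p₀ q) := by abel
      have e3 : q - p₀ = (2 : ℝ) • (q - midpoint ℝ p₀ q) := by
        rw [midpoint_eq_smul_add, invOf_eq_inv]; module
      have e4 := parallelogram_law_with_norm ℝ (x - midpoint ℝ p₀ q) (q - midpoint ℝ p₀ q)
      rw [← e1, ← e2] at e4
      have e5 : ‖q - p₀‖ = 2 * ‖q - midpoint ℝ p₀ q‖ := by rw [e3, norm_smul]; simp
      rw [dist_eq_norm, dist_eq_norm]
      have e6 : 0 < ‖x - q‖ := norm_pos_iff.2 (sub_ne_zero.2 hxq)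
      refine lt_of_pow_lt_pow_left₀ 2 (norm_nonneg _) ?_
      have e7 : ‖x - midpoint ℝ p₀ q‖ * ‖x - midpoint ℝ p₀ q‖ ≤
          ‖q - midpoint ℝ p₀ q‖ * ‖q - midpoint ℝ p₀ q‖ := by gcongr
      rw [e5]
      nlinarith
    exact ⟨(hlt x h2).1, fun _ => (hlt x h2).2⟩

/-- Hopf's strong maximum principle for the operator `∑ₐ D²f(eₐ, eₐ) + Df(b)`. -/
theorem eventually_eq_of_subsolution {U : Set (EuclideanSpace ℝ (Fin n))} (hU : IsOpen U) {f : EuclideanSpace ℝ (Fin n) → ℝ}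
    (hf : ContDiffOn ℝ 2 f U) {e : ι → EuclideanSpace ℝ (Fin n) → EuclideanSpace ℝ (Fin n)} {b : EuclideanSpace ℝ (Fin n) → EuclideanSpace ℝ (Fin n)}
    (he : ∀ j k, ContinuousOn (fun y => ∑ a, e a y j * e a y k) U) (hb : ContinuousOn b U)
    (hnd : ∀ y ∈ U, ∀ v : EuclideanSpace ℝ (Fin n), (∀ a, inner ℝ v (e a y) = 0) → v = 0)
    (hL : ∀ y ∈ U, 0 ≤ ∑ a, fderiv ℝ (fderiv ℝ f) y (e a y) (e a y) + fderiv ℝ f y (b y))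
    {M : ℝ} (hM : ∀ y ∈ U, f y ≤ M) {y₀ : EuclideanSpace ℝ (Fin n)} (hy₀ : y₀ ∈ U) (h0 : f y₀ = M) :
    ∀ᶠ y in nhds y₀, f y = M := by
  by_contra hne
  obtain ⟨p, q, hpq, hqU, hfq, hball⟩ := exists_touching_ball hU hf.continuousOn hM hy₀ h0 hne
  set ρ := ‖q - p‖ with hρ
  have hρ0 : 0 < ρ := norm_pos_iff.2 (sub_ne_zero.2 hpq.symm)
  obtain ⟨σ', hσ', hσU⟩ := Metric.nhds_basis_closedBall.mem_iff.1 (hU.mem_nhds hqU)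
  -- The bound ρ/2 keeps out the centre p, near which the barrier is not a subsolution.
  set σ := min σ' (ρ / 2) with hσ
  have hσ0 : 0 < σ := by positivity
  have hKU : Metric.closedBall q σ ⊆ U :=
    (Metric.closedBall_subset_closedBall (min_le_left _ _)).trans hσU
  have hpK : p ∉ Metric.closedBall q σ := by
    rw [Metric.mem_closedBall, dist_comm, dist_eq_norm, not_le, ← hρ]
    exact (min_le_right _ _).trans_lt (by linarith)
  obtain ⟨α, hα, hLv⟩ := exists_barrier (isCompact_closedBall q σ) hpK
    (fun j k => (he j k).mono hKU) (hb.mono hKU) (fun y hy => hnd y (hKU hy))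
  have hS : IsCompact (Metric.sphere q σ ∩ Metric.closedBall p ρ) :=
    (isCompact_sphere q σ).inter_right Metric.isClosed_closedBall
  have hgap : ∃ δ > 0, ∀ x ∈ Metric.sphere q σ ∩ Metric.closedBall p ρ, f x < M - δ := by
    rcases (Metric.sphere q σ ∩ Metric.closedBall p ρ).eq_empty_or_nonempty with h | h
    · exact ⟨1, one_pos, by simp [h]⟩
    obtain ⟨x0, hx0, hmax⟩ := hS.exists_isMaxOn h
      (hf.continuousOn.mono fun x hx => hKU (Metric.sphere_subset_closedBall hx.1))
    have hlt : f x0 < M := by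
      refine (hball x0 hx0.2).2 ?_
      rintro rfl
      have := hx0.1
      rw [Metric.mem_sphere, dist_self] at this
      exact hσ0.ne this
    refine ⟨(M - f x0) / 2, by linarith, fun x hx => ?_⟩
    have : f x ≤ f x0 := hmax hx
    linarith
  obtain ⟨δ, hδ, hgap⟩ := hgap
  set w : EuclideanSpace ℝ (Fin n) → ℝ := fun x => f x + δ * (Real.exp (-α * ‖x - p‖ ^ 2) - Real.exp (-α * ρ ^ 2)) with hw
  have hwc : ContinuousOn w (Metric.closedBall q σ) := by
    have := hf.continuousOn.mono hKU
    fun_prop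
  obtain ⟨z, hz, hzmax⟩ := (isCompact_closedBall q σ).exists_isMaxOn
    ⟨q, Metric.mem_closedBall_self hσ0.le⟩ hwc
  have hwq : w q = M := by simp [hw, hfq, ← hρ]
  have hwz : M ≤ w z := hwq ▸ hzmax (Metric.mem_closedBall_self hσ0.le)
  -- On the sphere either f lies below M by more than δ, while the added term is less than δ, or the
  -- point is outside the touching ball and the added term is negative.
  have hzint : z ∈ Metric.ball q σ := by
    by_contra hzb
    have hzs : z ∈ Metric.sphere q σ := by
      rw [Metric.mem_sphere]
      exact le_antisymm hz (not_lt.1 hzb)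
    have hlt : w z < M := by
      by_cases hzp : z ∈ Metric.closedBall p ρ
      · have h1 := hgap z ⟨hzs, hzp⟩
        have h2 : Real.exp (-α * ‖z - p‖ ^ 2) ≤ 1 := by
          rw [Real.exp_le_one_iff]
          nlinarith [sq_nonneg ‖z - p‖]
        have h3 := Real.exp_pos (-α * ρ ^ 2)
        simp only [hw]
        nlinarith
      · rw [Metric.mem_closedBall, dist_eq_norm, not_le] at hzp
        have h1 : Real.exp (-α * ‖z - p‖ ^ 2) < Real.exp (-α * ρ ^ 2) := by
          rw [Real.exp_lt_exp]
          have : ρ ^ 2 < ‖z - p‖ ^ 2 := by gcongr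
          nlinarith
        have h2 := hM z (hKU hz)
        simp only [hw]
        nlinarith
    linarith
  have hloc : IsLocalMax w z :=
    hzmax.isLocalMax (Filter.mem_of_superset (Metric.isOpen_ball.mem_nhds hzint)
      Metric.ball_subset_closedBall)
  -- At the interior maximum z the operator applied to w is nonpositive, although it is nonnegative
  -- on f and positive on the barrier.
  have htest := fun u => barrier_test hU hf (hKU hz) hloc u
  have h1 := (htest (b z)).1
  have h2 : ∑ a, (fderiv ℝ (fderiv ℝ f) z (e a z) (e a z) + δ * (Real.exp (-α * ‖z - p‖ ^ 2) *
      (4 * α ^ 2 * inner ℝ (z - p) (e a z) ^ 2 - 2 * α * ‖e a z‖ ^ 2))) ≤ 0 :=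
    Finset.sum_nonpos fun a _ => (htest (e a z)).2
  rw [Finset.sum_add_distrib, ← Finset.mul_sum, ← Finset.mul_sum] at h2
  have h3 := hL z (hKU hz)
  have h4 := mul_pos (mul_pos hδ (Real.exp_pos (-α * ‖z - p‖ ^ 2))) (hLv z hz)
  linarith

end MaximumPrinciple

/-! ### The wedge product with a 1-form -/

section Wedge

variable {V : Type*} [NormedAddCommGroup V] [NormedSpace ℝ V]

/-- Antisymmetrizing the alternatization a second time can be evaluated in two ways: it is already
alternating, and each of its k + 1 terms gives the same signed sum. -/
lemma sum_sign_alternatizeUncurryFin {k : ℕ} (L : V →L[ℝ] V [⋀^Fin k]→L[ℝ] ℝ)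
    (v : Fin (k + 1) → V) :
    ∑ σ : Equiv.Perm (Fin (k + 1)), (Equiv.Perm.sign σ : ℤ) •
        L (v (σ 0)) (fun a => v (σ a.succ)) =
      k.factorial * ContinuousAlternatingMap.alternatizeUncurryFin L v := by
  have h1 : ∑ σ : Equiv.Perm (Fin (k + 1)), (Equiv.Perm.sign σ : ℤ) •
      ContinuousAlternatingMap.alternatizeUncurryFin L (v ∘ σ) =
      (k + 1).factorial * ContinuousAlternatingMap.alternatizeUncurryFin L v := by
    have h2 : ∀ σ : Equiv.Perm (Fin (k + 1)), (Equiv.Perm.sign σ : ℤ) •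
        ContinuousAlternatingMap.alternatizeUncurryFin L (v ∘ σ) =
        ContinuousAlternatingMap.alternatizeUncurryFin L v := by
      intro σ
      have h := (ContinuousAlternatingMap.alternatizeUncurryFin L).toAlternatingMap.map_perm v σ
      rw [ContinuousAlternatingMap.coe_toAlternatingMap] at h
      rw [h, Units.smul_def, smul_smul, ← Units.val_mul,
        Int.units_mul_self, Units.val_one, one_smul]
    simp [h2, Fintype.card_perm]
  have h3 : ∑ σ : Equiv.Perm (Fin (k + 1)), (Equiv.Perm.sign σ : ℤ) •
      ContinuousAlternatingMap.alternatizeUncurryFin L (v ∘ σ) =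
      (k + 1) * ∑ σ : Equiv.Perm (Fin (k + 1)), (Equiv.Perm.sign σ : ℤ) •
        L (v (σ 0)) (fun a => v (σ a.succ)) := by
    simp only [ContinuousAlternatingMap.alternatizeUncurryFin_apply, Finset.smul_sum]
    rw [Finset.sum_comm]
    have h4 : ∀ p : Fin (k + 1), ∑ σ : Equiv.Perm (Fin (k + 1)), (Equiv.Perm.sign σ : ℤ) •
        ((-1 : ℤ) ^ (p : ℕ) • L ((v ∘ σ) p) (p.removeNth (v ∘ σ))) =
        ∑ σ : Equiv.Perm (Fin (k + 1)), (Equiv.Perm.sign σ : ℤ) •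
          L (v (σ 0)) (fun a => v (σ a.succ)) := by
      intro p
      rw [← Equiv.sum_comp (Equiv.mulRight p.cycleRange.symm)
        (fun σ => (Equiv.Perm.sign σ : ℤ) • L (v (σ 0)) (fun a => v (σ a.succ)))]
      refine Finset.sum_congr rfl fun σ _ => ?_
      simp only [Equiv.coe_mulRight, Equiv.Perm.sign_mul, Equiv.Perm.sign_symm,
        Fin.sign_cycleRange, Equiv.Perm.mul_apply, Fin.cycleRange_symm_zero,
        Fin.cycleRange_symm_succ, smul_smul]
      push_cast
      rfl
    rw [Finset.sum_congr rfl fun p _ => h4 p]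
    simp
  rw [h3, Nat.factorial_succ] at h1
  have h5 : ((k : ℝ) + 1) ≠ 0 := by positivity
  refine mul_left_cancel₀ h5 (h1.trans ?_)
  push_cast
  ring

/-- Brings λ∧α and the exterior derivative to one common form, the alternatization of a linear map
into forms, so that dα + 4 dφ∧α is the alternatization of `twisted`. The cast reconciles the degrees
1 + k and k + 1. -/
lemma wedge_ofSubsingleton {k : ℕ} (lam : V →L[ℝ] ℝ) (α : V [⋀^Fin k]→L[ℝ] ℝ)
    (v : Fin (k + 1) → V) :
    wedge (ContinuousAlternatingMap.ofSubsingleton ℝ V ℝ (0 : Fin 1) lam) α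
      (fun a => v (Fin.cast (add_comm 1 k) a)) =
      ContinuousAlternatingMap.alternatizeUncurryFin (lam.smulRight α) v := by
  have h1 := sum_sign_alternatizeUncurryFin (lam.smulRight α) v
  have h2 : (tensor (ContinuousAlternatingMap.ofSubsingleton ℝ V ℝ (0 : Fin 1) lam)
      α).alternatization (fun a => v (Fin.cast (add_comm 1 k) a)) =
      ∑ σ : Equiv.Perm (Fin (k + 1)), (Equiv.Perm.sign σ : ℤ) •
        (lam.smulRight α) (v (σ 0)) (fun a => v (σ a.succ)) := by
    rw [ContinuousMultilinearMap.alternatization_apply_apply,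
      ← Equiv.sum_comp (finCongr (add_comm 1 k)).permCongr]
    refine Finset.sum_congr rfl fun σ _ => ?_
    rw [Equiv.Perm.sign_permCongr, Units.smul_def]
    refine congrArg _ ?_
    have h3 : ∀ a : Fin k, (finCongr (add_comm 1 k)).permCongr σ a.succ =
        Fin.cast (add_comm 1 k) (σ (Fin.natAdd 1 a)) := by
      intro a
      rw [Equiv.permCongr_apply]
      refine congrArg _ (congrArg σ ?_)
      ext
      simp [add_comm]
    have h4 : (finCongr (add_comm 1 k)).permCongr σ 0 =
        Fin.cast (add_comm 1 k) (σ (Fin.castAdd k 0)) := by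
      rw [Equiv.permCongr_apply]
      refine congrArg _ (congrArg σ ?_)
      ext
      simp
    simp only [h3, h4]
    rfl
  unfold wedge
  rw [ContinuousAlternatingMap.smul_apply, h2, h1]
  simp only [Nat.factorial_one, Nat.cast_one, one_mul, smul_eq_mul]
  rw [← mul_assoc, inv_mul_cancel₀ (by positivity), one_mul]

end Wedge

/-! ### Forms in charts -/

section Charts

variable {M : Type*} [TopologicalSpace M] [ChartedSpace R7 M]

/-- The value of a form at a point, as a form on the model space. -/
def Form.val {k : ℕ} (α : Form M k) (x : M) : R7 [⋀^Fin k]→L[ℝ] ℝ := α x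

/-- The derivative of the inverse of a chart. -/
def chartInv (x₀ : M) (y : R7) : R7 →L[ℝ] R7 :=
  mfderiv 𝓘(ℝ, R7) (𝓡 7) (extChartAt (𝓡 7) x₀).symm y

/-- The derivative of a chart. -/
def chartDeriv (x₀ x : M) : R7 →L[ℝ] R7 := mfderiv (𝓡 7) 𝓘(ℝ, R7) (extChartAt (𝓡 7) x₀) x

lemma Form.inChart_eq {k : ℕ} (α : Form M k) (x₀ : M) (y : R7) :
    α.inChart x₀ y = (α.val ((extChartAt (𝓡 7) x₀).symm y)).compContinuousLinearMap
      (chartInv x₀ y) := rfl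

lemma Form.d_val {k : ℕ} (α : Form M k) (x : M) :
    α.d.val x = (extDeriv (α.inChart x) (extChartAt (𝓡 7) x x)).compContinuousLinearMap
      (chartDeriv x x) := rfl

variable [IsManifold (𝓡 7) ∞ M]

lemma chartDeriv_comp_chartInv {x₀ : M} {y : R7} (hy : y ∈ (extChartAt (𝓡 7) x₀).target) :
    (chartDeriv x₀ ((extChartAt (𝓡 7) x₀).symm y)).comp (chartInv x₀ y) =
      ContinuousLinearMap.id ℝ R7 := by
  have : IsManifold (𝓡 7) 1 M := IsManifold.of_le (n := ∞) (by simp)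
  have h := mfderiv_extChartAt_comp_mfderivWithin_extChartAt_symm (I := 𝓡 7) hy
  rw [ModelWithCorners.range_eq_univ, mfderivWithin_univ] at h
  exact h

lemma chartInv_comp_chartDeriv {x₀ : M} {y : R7} (hy : y ∈ (extChartAt (𝓡 7) x₀).target) :
    (chartInv x₀ y).comp (chartDeriv x₀ ((extChartAt (𝓡 7) x₀).symm y)) =
      ContinuousLinearMap.id ℝ R7 := by
  have : IsManifold (𝓡 7) 1 M := IsManifold.of_le (n := ∞) (by simp)
  have h := mfderivWithin_extChartAt_symm_comp_mfderiv_extChartAt (I := 𝓡 7) hy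
  rw [ModelWithCorners.range_eq_univ, mfderivWithin_univ] at h
  exact h

lemma contMDiffAt_chartInv {x₀ : M} {y : R7} (hy : y ∈ (extChartAt (𝓡 7) x₀).target) :
    ContMDiffAt 𝓘(ℝ, R7) (𝓡 7) ∞ (extChartAt (𝓡 7) x₀).symm y :=
  (contMDiffOn_extChartAt_symm x₀).contMDiffAt ((isOpen_extChartAt_target x₀).mem_nhds hy)

lemma contDiffAt_transition {x₀ x : M} {y : R7} (hy : y ∈ (extChartAt (𝓡 7) x₀).target)
    (hx : (extChartAt (𝓡 7) x₀).symm y ∈ (extChartAt (𝓡 7) x).source) :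
    ContDiffAt ℝ ∞ (fun z => extChartAt (𝓡 7) x ((extChartAt (𝓡 7) x₀).symm z)) y := by
  rw [extChartAt_source] at hx
  exact ((contMDiffAt_extChartAt' hx).comp y (contMDiffAt_chartInv hy)).contDiffAt

lemma fderiv_transition {x₀ x : M} {y : R7} (hy : y ∈ (extChartAt (𝓡 7) x₀).target)
    (hx : (extChartAt (𝓡 7) x₀).symm y ∈ (extChartAt (𝓡 7) x).source) :
    fderiv ℝ (fun z => extChartAt (𝓡 7) x ((extChartAt (𝓡 7) x₀).symm z)) y =
      (chartDeriv x ((extChartAt (𝓡 7) x₀).symm y)).comp (chartInv x₀ y) := by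
  rw [extChartAt_source] at hx
  have h := mfderiv_comp y
    ((contMDiffAt_extChartAt' (I := 𝓡 7) (n := ∞) hx).mdifferentiableAt (by simp))
    ((contMDiffAt_chartInv hy).mdifferentiableAt (by simp))
  rw [mfderiv_eq_fderiv] at h
  exact h

/-- The exterior derivative may be computed in any chart. -/
lemma Form.inChart_d {k : ℕ} {α : Form M k} (hα : α.Smooth) (x₀ : M) {y : R7}
    (hy : y ∈ (extChartAt (𝓡 7) x₀).target) :
    α.d.inChart x₀ y = extDeriv (α.inChart x₀) y := by
  set x := (extChartAt (𝓡 7) x₀).symm y with hx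
  set τ := fun z => extChartAt (𝓡 7) x ((extChartAt (𝓡 7) x₀).symm z) with hτ
  have hxs : x ∈ (extChartAt (𝓡 7) x).source := mem_extChartAt_source x
  have hτy : τ y = extChartAt (𝓡 7) x x := rfl
  have hopen := isOpen_extChartAt_target (I := 𝓡 7) x₀
  have hev : ∀ᶠ z in nhds y, z ∈ (extChartAt (𝓡 7) x₀).target ∧
      (extChartAt (𝓡 7) x₀).symm z ∈ (extChartAt (𝓡 7) x).source := by
    refine (hopen.eventually_mem hy).and ?_
    exact (contMDiffAt_chartInv hy).continuousAt.eventually_mem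
      ((isOpen_extChartAt_source x).mem_nhds hxs)
  have hcongr : α.inChart x₀ =ᶠ[nhds y]
      fun z => (α.inChart x (τ z)).compContinuousLinearMap (fderiv ℝ τ z) := by
    filter_upwards [hev] with z hz
    rw [fderiv_transition hz.1 hz.2, Form.inChart_eq, Form.inChart_eq]
    have h1 : (extChartAt (𝓡 7) x).symm (τ z) = (extChartAt (𝓡 7) x₀).symm z :=
      (extChartAt (𝓡 7) x).left_inv hz.2
    have h2 : τ z ∈ (extChartAt (𝓡 7) x).target := (extChartAt (𝓡 7) x).map_source hz.2
    have h3 := chartInv_comp_chartDeriv h2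
    rw [h1] at h3 ⊢
    ext v
    simp only [ContinuousAlternatingMap.compContinuousLinearMap_apply]
    refine congrArg _ (funext fun a => ?_)
    exact (congrArg (fun L : R7 →L[ℝ] R7 => L (chartInv x₀ z (v a))) h3).symm
  have hd : DifferentiableAt ℝ (α.inChart x) (τ y) := by
    rw [hτy]
    exact ((hα x).contDiffAt ((isOpen_extChartAt_target x).mem_nhds
      (mem_extChartAt_target x))).differentiableAt (by simp)
  -- Naturality of the exterior derivative under the transition to the chart at x, the one used to
  -- define the derivative at x.
  have h1 := extDeriv_pullback (r := ∞) hd (contDiffAt_transition hy hxs)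
    (by rw [minSmoothness_of_isRCLikeNormedField]; exact WithTop.coe_le_coe.2 (le_top : (2 : ℕ∞) ≤ ⊤))
  rw [hcongr.extDeriv_eq]
  rw [h1, fderiv_transition hy hxs, Form.inChart_eq, Form.d_val]
  rfl

end Charts

/-! ### The Hodge star in charts -/

lemma pull_comp_eq {n : ℕ} {F G : R7 ≃L[ℝ] R7} {A : R7 →L[ℝ] R7} (h : ∀ v, F v = G (A v))
    (η : R7 [⋀^Fin n]→L[ℝ] ℝ) : (pull G η).compContinuousLinearMap A = pull F η := by
  ext v
  exact congrArg η (funext fun a => (h (v a)).symm)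

lemma pull_symm_eq {n : ℕ} {F G : R7 ≃L[ℝ] R7} {A : R7 →L[ℝ] R7}
    (h : ∀ w, A (F.symm w) = G.symm w) (β : R7 [⋀^Fin n]→L[ℝ] ℝ) :
    pull G.symm β = pull F.symm (β.compContinuousLinearMap A) := by
  ext v
  exact congrArg β (funext fun a => (h (v a)).symm)

section Charts

variable {M : Type*} [TopologicalSpace M] [ChartedSpace R7 M]

namespace G2Structure

variable (Ω : G2Structure M)

/-- The adapted frame on the model space. -/
def modelFrame (x : M) : R7 ≃L[ℝ] R7 := Ω.frame x

lemma form_val (x : M) : Ω.form.val x = pull (Ω.modelFrame x) phi0 :=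
  Classical.choose_spec (Ω.positive x)

lemma star_val {k l : ℕ} (h : k + l = 7) (α : Form M k) (x : M) :
    (Ω.star h α).val x = frameStar (Ω.modelFrame x) h (α.val x) := by
  unfold Form.val star modelFrame
  rfl

/-- `F` is the frame of the `G₂` structure, read in the chart at `x₀`. -/
def IsChartFrame (x₀ : M) (F : R7 → R7 ≃L[ℝ] R7) : Prop :=
  ∀ y ∈ (extChartAt (𝓡 7) x₀).target,
      (∀ v, F y v = Ω.modelFrame ((extChartAt (𝓡 7) x₀).symm y) (chartInv x₀ y v)) ∧
      ∀ w, chartInv x₀ y ((F y).symm w) =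
        (Ω.modelFrame ((extChartAt (𝓡 7) x₀).symm y)).symm w

variable {Ω} {x₀ : M} {F : R7 → R7 ≃L[ℝ] R7}

lemma IsChartFrame.form_inChart (hF : Ω.IsChartFrame x₀ F) {y : R7}
    (hy : y ∈ (extChartAt (𝓡 7) x₀).target) : Ω.form.inChart x₀ y = pull (F y) phi0 := by
  rw [Form.inChart_eq, form_val, pull_comp_eq (hF y hy).1]

lemma IsChartFrame.star_inChart (hF : Ω.IsChartFrame x₀ F) {y : R7}
    (hy : y ∈ (extChartAt (𝓡 7) x₀).target) {k l : ℕ} (h : k + l = 7) (α : Form M k) :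
    (Ω.star h α).inChart x₀ y = frameStar (F y) h (α.inChart x₀ y) := by
  rw [Form.inChart_eq, star_val, frameStar, pull_comp_eq (hF y hy).1, pull_symm_eq (hF y hy).2,
    Form.inChart_eq]

lemma IsChartFrame.star_form_inChart (hF : Ω.IsChartFrame x₀ F) {y : R7}
    (hy : y ∈ (extChartAt (𝓡 7) x₀).target) :
    (Ω.star (k := 3) (l := 4) rfl Ω.form).inChart x₀ y =
      pull (F y) (starR7 (k := 3) (l := 4) rfl phi0) := by
  rw [hF.star_inChart hy, hF.form_inChart hy, frameStar_pull]

variable [IsManifold (𝓡 7) ∞ M]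

variable (Ω) in
lemma exists_chartFrame (x₀ : M) : ∃ F, Ω.IsChartFrame x₀ F := by
  classical
  refine ⟨fun y => if hy : y ∈ (extChartAt (𝓡 7) x₀).target then
    (ContinuousLinearEquiv.equivOfInverse (chartInv x₀ y)
      (chartDeriv x₀ ((extChartAt (𝓡 7) x₀).symm y))
      (fun v => congrArg (fun L : R7 →L[ℝ] R7 => L v) (chartDeriv_comp_chartInv hy))
      (fun v => congrArg (fun L : R7 →L[ℝ] R7 => L v) (chartInv_comp_chartDeriv hy))).trans
      (Ω.modelFrame ((extChartAt (𝓡 7) x₀).symm y)) else ContinuousLinearEquiv.refl ℝ R7,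
    fun y hy => ?_⟩
  simp only [hy, dif_pos]
  refine ⟨fun v => rfl, fun w => ?_⟩
  exact congrArg (fun L : R7 →L[ℝ] R7 => L ((Ω.modelFrame ((extChartAt (𝓡 7) x₀).symm y)).symm w))
    (chartInv_comp_chartDeriv hy)

variable (Ω) in
lemma smooth_star {k l : ℕ} (h : k + l = 7) {α : Form M k} (hα : α.Smooth) :
    (Ω.star h α).Smooth := by
  intro x₀
  obtain ⟨F, hF⟩ := Ω.exists_chartFrame x₀
  exact (contDiffOn_frameStar h (Ω.smooth x₀)
    (fun y hy => IsChartFrame.form_inChart hF hy) (hα x₀)).congr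
    fun y hy => IsChartFrame.star_inChart hF hy h α

end G2Structure

/-! ### The twisted exterior derivative in charts -/

lemma Form.inChart_zero {k : ℕ} {α : Form M k} (h : α = 0) (x₀ : M) (y : R7) :
    α.inChart x₀ y = 0 := by
  subst h
  ext v
  rfl

lemma Form.inChart_add_smul {k : ℕ} (α β : Form M k) (c : ℝ) (x₀ : M) (y : R7) (v : Fin k → R7) :
    (α + c • β : Form M k).inChart x₀ y v = α.inChart x₀ y v + c * β.inChart x₀ y v := rfl

/-- The differential of a function, as a linear form on the model space. -/
def mderiv (φ : M → ℝ) (x : M) : R7 →L[ℝ] ℝ := mfderiv (𝓡 7) 𝓘(ℝ, ℝ) φ x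

lemma differential_val (φ : M → ℝ) (x : M) : (differential φ).val x =
    ContinuousAlternatingMap.ofSubsingleton ℝ R7 ℝ (0 : Fin 1) (mderiv φ x) := rfl

lemma wedge_val {k l : ℕ} (α : Form M k) (β : Form M l) (x : M) :
    (α.wedge β).val x = wedge (α.val x) (β.val x) := rfl

variable [IsManifold (𝓡 7) ∞ M]

lemma alternatizeUncurryFin_comp {n : ℕ} (lam : R7 →L[ℝ] ℝ) (α : R7 [⋀^Fin n]→L[ℝ] ℝ)
    (A : R7 →L[ℝ] R7) (v : Fin (n + 1) → R7) :
    ContinuousAlternatingMap.alternatizeUncurryFin (lam.smulRight α) (fun a => A (v a)) =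
      ContinuousAlternatingMap.alternatizeUncurryFin
        ((lam.comp A).smulRight (α.compContinuousLinearMap A)) v := by
  rw [ContinuousAlternatingMap.alternatizeUncurryFin_apply,
    ContinuousAlternatingMap.alternatizeUncurryFin_apply]
  rfl

lemma contDiffOn_chart {φ : M → ℝ} (hφ : ContMDiff (𝓡 7) 𝓘(ℝ, ℝ) ∞ φ) (x₀ : M) :
    ContDiffOn ℝ ∞ (fun y => φ ((extChartAt (𝓡 7) x₀).symm y)) (extChartAt (𝓡 7) x₀).target := by
  rw [← contMDiffOn_iff_contDiffOn]
  exact hφ.comp_contMDiffOn (contMDiffOn_extChartAt_symm x₀)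

lemma fderiv_chart {φ : M → ℝ} (hφ : ContMDiff (𝓡 7) 𝓘(ℝ, ℝ) ∞ φ) {x₀ : M} {y : R7}
    (hy : y ∈ (extChartAt (𝓡 7) x₀).target) :
    fderiv ℝ (fun y => φ ((extChartAt (𝓡 7) x₀).symm y)) y =
      (mderiv φ ((extChartAt (𝓡 7) x₀).symm y)).comp (chartInv x₀ y) := by
  have h := mfderiv_comp y (hφ.mdifferentiableAt (x := (extChartAt (𝓡 7) x₀).symm y) (by simp))
    ((contMDiffAt_chartInv hy).mdifferentiableAt (by simp))
  rw [mfderiv_eq_fderiv] at h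
  exact h

lemma wedge_differential_inChart {φ : M → ℝ} (hφ : ContMDiff (𝓡 7) 𝓘(ℝ, ℝ) ∞ φ) {k : ℕ}
    (α : Form M k) {x₀ : M} {y : R7} (hy : y ∈ (extChartAt (𝓡 7) x₀).target)
    (v : Fin (k + 1) → R7) :
    ((differential φ).wedge α).inChart x₀ y (fun a => v (Fin.cast (add_comm 1 k) a)) =
      ContinuousAlternatingMap.alternatizeUncurryFin ((fderiv ℝ (fun y =>
        φ ((extChartAt (𝓡 7) x₀).symm y)) y).smulRight (α.inChart x₀ y)) v := by
  rw [fderiv_chart hφ hy, Form.inChart_eq, Form.inChart_eq, wedge_val, differential_val,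
    ← alternatizeUncurryFin_comp, ← wedge_ofSubsingleton]
  rfl

lemma twisted_alternatize {n : ℕ} (φ : R7 → ℝ) (α : R7 → R7 [⋀^Fin n]→L[ℝ] ℝ) (y : R7)
    (v : Fin (n + 1) → R7) :
    ContinuousAlternatingMap.alternatizeUncurryFin (twisted φ α y) v =
      extDeriv α y v + 4 * ContinuousAlternatingMap.alternatizeUncurryFin
        ((fderiv ℝ φ y).smulRight (α y)) v := by
  rw [twisted, ContinuousAlternatingMap.alternatizeUncurryFin_add,
    ContinuousAlternatingMap.alternatizeUncurryFin_smul]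
  rfl

/-- The form `β` stands for dφ∧α with its degree written k + 1; for numerical k the two degrees
agree by computation. -/
lemma twisted_inChart {φ : M → ℝ} (hφ : ContMDiff (𝓡 7) 𝓘(ℝ, ℝ) ∞ φ) {k : ℕ} {α : Form M k}
    (hα : α.Smooth) {x₀ : M} {y : R7} (hy : y ∈ (extChartAt (𝓡 7) x₀).target)
    (β : Form M (k + 1)) (hβ : ∀ x (v : Fin (k + 1) → R7),
      β.val x v = ((differential φ).wedge α).val x (fun a => v (Fin.cast (add_comm 1 k) a))) :
    (α.d + (4 : ℝ) • β : Form M (k + 1)).inChart x₀ y =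
      ContinuousAlternatingMap.alternatizeUncurryFin (twisted (fun y =>
        φ ((extChartAt (𝓡 7) x₀).symm y)) (α.inChart x₀) y) := by
  ext v
  rw [twisted_alternatize, ← Form.inChart_d hα x₀ hy, ← wedge_differential_inChart hφ α hy v,
    Form.inChart_add_smul]
  exact congrArg (fun c : ℝ => α.d.inChart x₀ y v + 4 * c)
    (hβ ((extChartAt (𝓡 7) x₀).symm y) (fun a => chartInv x₀ y (v a)))

lemma twisted_three_inChart {φ : M → ℝ} (hφ : ContMDiff (𝓡 7) 𝓘(ℝ, ℝ) ∞ φ) {α : Form M 3}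
    (hα : α.Smooth) {x₀ : M} {y : R7} (hy : y ∈ (extChartAt (𝓡 7) x₀).target) :
    (α.d + (4 : ℝ) • (differential φ).wedge α : Form M 4).inChart x₀ y =
      ContinuousAlternatingMap.alternatizeUncurryFin (twisted (fun y =>
        φ ((extChartAt (𝓡 7) x₀).symm y)) (α.inChart x₀) y) :=
  twisted_inChart (k := 3) hφ hα hy ((differential φ).wedge α) fun x v =>
    congrArg (((differential φ).wedge α).val x) (funext fun _ => congrArg v (Fin.ext rfl))

lemma twisted_four_inChart {φ : M → ℝ} (hφ : ContMDiff (𝓡 7) 𝓘(ℝ, ℝ) ∞ φ) {α : Form M 4}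
    (hα : α.Smooth) {x₀ : M} {y : R7} (hy : y ∈ (extChartAt (𝓡 7) x₀).target)
    (h : α.d + (4 : ℝ) • (differential φ).wedge α = 0) :
    ContinuousAlternatingMap.alternatizeUncurryFin (twisted (fun y =>
        φ ((extChartAt (𝓡 7) x₀).symm y)) (α.inChart x₀) y) = 0 := by
  obtain ⟨β, hβ⟩ : ∃ β : Form M 5, β = (differential φ).wedge α := ⟨_, rfl⟩
  rw [← twisted_inChart (k := 4) hφ hα hy β fun x v => by
    rw [hβ]
    exact congrArg (((differential φ).wedge α).val x) (funext fun _ => congrArg v (Fin.ext rfl))]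
  exact Form.inChart_zero (by rw [hβ]; exact h) x₀ y

lemma contDiffOn_twisted {n : ℕ} {s : Set R7} (hs : IsOpen s) {φ : R7 → ℝ}
    (hφ : ContDiffOn ℝ ∞ φ s) {α : R7 → R7 [⋀^Fin n]→L[ℝ] ℝ} (hα : ContDiffOn ℝ ∞ α s) :
    ContDiffOn ℝ ∞ (fun y => ContinuousAlternatingMap.alternatizeUncurryFin (twisted φ α y)) s := by
  have h1 : ContDiffOn ℝ ∞ (twisted φ α) s :=
    (hα.fderiv_of_isOpen hs (by simp)).add
      (((hφ.fderiv_of_isOpen hs (by simp)).smulRight hα).const_smul (4 : ℝ))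
  exact (ContinuousAlternatingMap.alternatizeUncurryFinCLM ℝ R7 ℝ).contDiff.comp_contDiffOn h1

lemma smooth_twisted {φ : M → ℝ} (hφ : ContMDiff (𝓡 7) 𝓘(ℝ, ℝ) ∞ φ) {α : Form M 3}
    (hα : α.Smooth) : (α.d + (4 : ℝ) • (differential φ).wedge α : Form M 4).Smooth := fun x₀ =>
  (contDiffOn_twisted (isOpen_extChartAt_target x₀) (contDiffOn_chart hφ x₀) (hα x₀)).congr
    fun _ hy => twisted_three_inChart hφ hα hy

lemma Form.eq_zero_of_inChart {k : ℕ} {α : Form M k}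
    (h : ∀ x, α.inChart x (extChartAt (𝓡 7) x x) = 0) : α = 0 := by
  funext x
  have hy := mem_extChartAt_target (I := 𝓡 7) x
  have h1 := chartInv_comp_chartDeriv hy
  have h2 := h x
  rw [Form.inChart_eq] at h2
  rw [extChartAt_to_inv] at h1 h2
  change α.val x = 0
  ext v
  have h3 := congrArg (fun η : R7 [⋀^Fin k]→L[ℝ] ℝ => η fun a => chartDeriv x x (v a)) h2
  refine Eq.trans (congrArg (α.val x) (funext fun a => ?_)) h3
  exact (congrArg (fun L : R7 →L[ℝ] R7 => L (v a)) h1).symm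

end Charts

/-! ### The maximum principle in divergence form -/

lemma fderiv_divergence {P : Fin 7 → R7 → ℝ} {f : R7 → ℝ} {y : R7}
    (hP : ∀ k, DifferentiableAt ℝ (P k) y) (hf : DifferentiableAt ℝ (fderiv ℝ f) y) (u : R7) :
    fderiv ℝ (fun z => ∑ k, P k z * fderiv ℝ f z (bvec k)) y u =
      ∑ k, (P k y * fderiv ℝ (fderiv ℝ f) y u (bvec k) +
        fderiv ℝ f y (bvec k) * fderiv ℝ (P k) y u) := by
  have h1 : ∀ k, HasFDerivAt (fun z => fderiv ℝ f z (bvec k))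
      ((ContinuousLinearMap.apply ℝ ℝ (bvec k)).comp (fderiv ℝ (fderiv ℝ f) y)) y := fun k =>
    (ContinuousLinearMap.apply ℝ ℝ (bvec k)).hasFDerivAt.comp y hf.hasFDerivAt
  have h2 := HasFDerivAt.fun_sum (u := Finset.univ) fun k _ => (hP k).hasFDerivAt.fun_mul (h1 k)
  rw [h2.fderiv]
  simp

lemma bilinear_gram (G : R7 ≃L[ℝ] R7) (D : R7 →L[ℝ] R7 →L[ℝ] ℝ) :
    ∑ a, D (G (bvec a)) (G (bvec a)) = ∑ j, ∑ k, gram G j k * D (bvec j) (bvec k) := by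
  have h : ∀ u, D u u = ∑ j, ∑ k, u j * u k * D (bvec j) (bvec k) := by
    intro u
    rw [linear_eq_sum (D u) u, Finset.sum_comm]
    refine Finset.sum_congr rfl fun k _ => ?_
    have h1 := linear_eq_sum (D.flip (bvec k)) u
    simp only [ContinuousLinearMap.flip_apply] at h1
    rw [h1, Finset.mul_sum]
    exact Finset.sum_congr rfl fun j _ => by ring
  simp only [h, gram, Finset.sum_mul]
  rw [Finset.sum_comm]
  refine Finset.sum_congr rfl fun j _ => ?_
  rw [Finset.sum_comm]

lemma eq_zero_of_inner_frame (G : R7 ≃L[ℝ] R7) (v : R7) (h : ∀ a, inner ℝ v (G (bvec a)) = 0) :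
    v = 0 := by
  rw [← inner_self_eq_zero (𝕜 := ℝ)]
  have h1 : v = ∑ a, G.symm v a • G (bvec a) := by
    have h2 := congrArg G (sum_smul_bvec (G.symm v))
    rw [map_sum, G.apply_symm_apply] at h2
    simpa using h2.symm
  conv_lhs => rw [h1, inner_sum, ← h1]
  exact Finset.sum_eq_zero fun a _ => by rw [inner_smul_right, h, mul_zero]

/-- Expanding m⁻¹ ∂_j(m g^{jk} ∂_k f) gives g^{jk} ∂_j ∂_k f plus a first order term with continuous
coefficients, to which Hopf's principle applies. The division by m removes the dependence on the
orientation of the chart. -/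
lemma eventually_eq_of_divergence {U : Set R7} (hU : IsOpen U) {m f : R7 → ℝ}
    {G : R7 → R7 ≃L[ℝ] R7} (hm : ContDiffOn ℝ ∞ m U) (hm0 : ∀ y ∈ U, m y ≠ 0)
    (hG : ∀ i j, ContDiffOn ℝ ∞ (fun y => gram (G y) i j) U) (hf : ContDiffOn ℝ ∞ f U)
    (hdiv : ∀ y ∈ U, 0 ≤ (m y)⁻¹ * ∑ j, fderiv ℝ (fun z => m z * ∑ k, gram (G z) j k *
        fderiv ℝ f z (bvec k)) y (bvec j))
    {M : ℝ} (hM : ∀ y ∈ U, f y ≤ M) {y₀ : R7} (hy₀ : y₀ ∈ U) (h0 : f y₀ = M) :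
    ∀ᶠ y in nhds y₀, f y = M := by
  have hP : ∀ j k, ContDiffOn ℝ ∞ (fun y => m y * gram (G y) j k) U := fun j k => hm.mul (hG j k)
  set b : R7 → R7 := fun y => ∑ k, ((m y)⁻¹ *
    ∑ j, fderiv ℝ (fun z => m z * gram (G z) j k) y (bvec j)) • bvec k with hb
  refine eventually_eq_of_subsolution hU (hf.of_le (WithTop.coe_le_coe.2 (le_top : (2 : ℕ∞) ≤ ⊤)))
    (e := fun a y => G y (bvec a)) (b := b) (fun j k => (hG j k).continuousOn) ?_
    (fun y _ v hv => eq_zero_of_inner_frame (G y) v hv) (fun y hy => ?_) hM hy₀ h0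
  · refine continuousOn_finsetSum _ fun k _ => ContinuousOn.fun_smul ?_ continuousOn_const
    refine (hm.continuousOn.inv₀ hm0).mul (continuousOn_finsetSum _ fun j _ => ?_)
    exact ((hP j k).continuousOn_fderiv_of_isOpen hU (by simp)).clm_apply continuousOn_const
  · refine (hdiv y hy).trans_eq ?_
    have hUy := hU.mem_nhds hy
    have h1 : ∀ j, fderiv ℝ (fun z => m z * ∑ k, gram (G z) j k *
        fderiv ℝ f z (bvec k)) y (bvec j) =
        ∑ k, (m y * gram (G y) j k * fderiv ℝ (fderiv ℝ f) y (bvec j) (bvec k) +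
        fderiv ℝ f y (bvec k) * fderiv ℝ (fun z => m z * gram (G z) j k) y (bvec j)) := by
      intro j
      have h2 : (fun z => m z * ∑ k, gram (G z) j k * fderiv ℝ f z (bvec k)) =
          fun z => ∑ k, (m z * gram (G z) j k) * fderiv ℝ f z (bvec k) := by
        funext z
        rw [Finset.mul_sum]
        exact Finset.sum_congr rfl fun k _ => by ring
      rw [h2]
      exact fderiv_divergence (P := fun k z => m z * gram (G z) j k)
        (fun k => ((hP j k).contDiffAt hUy).differentiableAt (by simp))
        (((hf.fderiv_of_isOpen hU (m := ∞) (by simp)).contDiffAt hUy).differentiableAt (by simp)) _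
    simp only [h1, Finset.sum_add_distrib, mul_add]
    congr 1
    · rw [bilinear_gram]
      simp only [mul_assoc, ← Finset.mul_sum]
      rw [inv_mul_cancel_left₀ (hm0 y hy)]
    · rw [hb, map_sum, Finset.sum_comm, Finset.mul_sum]
      refine Finset.sum_congr rfl fun k _ => ?_
      rw [← Finset.mul_sum, map_smul, smul_eq_mul]
      ring

lemma eq_zero_of_frame {n : ℕ} (G : R7 ≃L[ℝ] R7) (β : R7 [⋀^Fin n]→L[ℝ] ℝ)
    (h : ∑ p : Fin n → Fin 7, β (fun a => G (bvec (p a))) ^ 2 = 0) : β = 0 := by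
  rw [Finset.sum_eq_zero_iff_of_nonneg fun p _ => sq_nonneg _] at h
  have h1 : pull G β = 0 := by
    ext v
    refine (map_eq_sum (pull G β).toMultilinearMap v).trans (Finset.sum_eq_zero fun p _ => ?_)
    have h2 := pow_eq_zero_iff (two_ne_zero) |>.1 (h p (Finset.mem_univ _))
    have h3 : (pull G β).toMultilinearMap (fun a => bvec (p a)) = 0 := h2
    rw [h3, mul_zero]
  ext v
  have h2 := congrArg (fun η : R7 [⋀^Fin n]→L[ℝ] ℝ => η fun a => G.symm (v a)) h1
  refine Eq.trans (congrArg β (funext fun a => ?_)) h2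
  exact (G.apply_symm_apply (v a)).symm

/-! ### Solutions of the system -/

section Solution

variable {M : Type*} [TopologicalSpace M] [ChartedSpace R7 M]

lemma Form.d_zero {k : ℕ} {α : Form M k} (h : α = 0) : α.d = 0 := by
  funext x
  have h1 : α.inChart x = fun _ => 0 := funext fun y => Form.inChart_zero h x y
  change α.d.val x = 0
  rw [Form.d_val, h1]
  have h2 : extDeriv (fun _ : R7 => (0 : R7 [⋀^Fin k]→L[ℝ] ℝ)) (extChartAt (𝓡 7) x x) = 0 := by
    unfold extDeriv
    rw [fderiv_const_apply, ← ContinuousAlternatingMap.alternatizeUncurryFinCLM_apply, map_zero]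
  rw [h2]
  rfl

lemma starR7_zero {k l : ℕ} (h : k + l = 7) : starR7 h 0 = 0 := by
  unfold starR7
  refine (congrArg _ (Finset.sum_eq_zero fun i _ => ?_)).trans (smul_zero _)
  exact zero_smul ℝ (insert h vol fun a => EuclideanSpace.single (i a) (1 : ℝ))

lemma pull_zero {n : ℕ} (F : R7 ≃L[ℝ] R7) : pull F (0 : R7 [⋀^Fin n]→L[ℝ] ℝ) = 0 := rfl

lemma G2Structure.star_zero (Ω : G2Structure M) {k l : ℕ} (h : k + l = 7) {α : Form M k}
    (hα : α = 0) : Ω.star h α = 0 := by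
  subst hα
  funext x
  change (Ω.star h (0 : Form M k)).val x = 0
  rw [star_val]
  have h1 : (0 : Form M k).val x = 0 := rfl
  rw [h1, frameStar, pull_zero, starR7_zero, pull_zero]

lemma G2Structure.eq_zero_of_star (Ω : G2Structure M) {k l : ℕ} (h : k + l = 7) {α : Form M k}
    (hα : Ω.star h α = 0) : α = 0 := by
  funext x
  change α.val x = 0
  have h1 : (Ω.star h α).val x = 0 := congrFun hα x
  rw [star_val] at h1
  have h2 := congrArg (pull (Ω.modelFrame x).symm) h1
  rw [frameStar, pull_symm_pull, pull_zero, ← starR7_zero h] at h2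
  have h3 := congrArg (pull (Ω.modelFrame x)) (starR7_injective h h2)
  rw [pull_zero] at h3
  rw [← h3]
  exact (pull_symm_pull (Ω.modelFrame x).symm (α.val x)).symm

lemma G2Structure.codiff_eq_zero_iff (Ω : G2Structure M) {k l : ℕ} (h : k + 1 + l = 7)
    (α : Form M (k + 1)) : Ω.codiff h α = 0 ↔ (Ω.star h α).d = 0 := by
  unfold codiff
  refine ⟨fun H => ?_, fun H => ?_⟩
  · exact Ω.eq_zero_of_star _ ((smul_eq_zero.1 H).resolve_left (pow_ne_zero _ (by norm_num)))
  · rw [Ω.star_zero _ H, smul_zero]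

lemma G2Structure.IsTorsionFree.d_star_form {Ω : G2Structure M} (h : Ω.IsTorsionFree) :
    (Ω.star (k := 3) (l := 4) rfl Ω.form).d = 0 :=
  (Ω.codiff_eq_zero_iff (k := 2) (l := 4) rfl Ω.form).1 h.2

lemma wedge_zero_left {k l : ℕ} {α : Form M k} (h : α = 0) (β : Form M l) : α.wedge β = 0 := by
  subst h
  funext x
  change wedge ((0 : Form M k).val x) (β.val x) = 0
  have h1 : tensor ((0 : Form M k).val x) (β.val x) = 0 := by
    ext v
    exact zero_mul _
  unfold wedge
  rw [h1, map_zero, smul_zero]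

lemma differential_eq_zero {φ : M → ℝ} {c : ℝ} (h : ∀ x, φ x = c) : differential φ = 0 := by
  obtain rfl : φ = fun _ => c := funext h
  funext x
  change (differential fun _ : M => c).val x = 0
  have h1 : mderiv (fun _ : M => c) x = 0 := mfderiv_const
  rw [differential_val, h1]
  rfl

lemma G2Structure.IsTorsionFree.isSolution {Ω : G2Structure M} {φ : M → ℝ}
    (h : Ω.IsTorsionFree) {c : ℝ} (hc : ∀ x, φ x = c) : Ω.IsSolution φ := by
  have h2 := differential_eq_zero hc
  refine ⟨wedge_zero_left h.1 _, ?_, ?_⟩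
  · rw [h.d_star_form, wedge_zero_left h2, smul_zero, add_zero]
  · rw [h.1, wedge_zero_left h2, smul_zero, add_zero, Form.d_zero (Ω.star_zero _ rfl), neg_zero]

lemma G2Structure.IsSolution.d_star_form {Ω : G2Structure M} {φ : M → ℝ}
    (h : Ω.IsSolution φ) {c : ℝ} (hc : ∀ x, φ x = c) :
    (Ω.star (k := 3) (l := 4) rfl Ω.form).d = 0 := by
  have h1 := h.lee
  rwa [wedge_zero_left (differential_eq_zero hc), smul_zero, add_zero] at h1

variable [IsManifold (𝓡 7) ∞ M] {Ω : G2Structure M} {φ : M → ℝ}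

/-- The divergence identity for a solution, in a chart. -/
lemma G2Structure.IsSolution.divergence_identity (h : Ω.IsSolution φ)
    (hφ : ContMDiff (𝓡 7) 𝓘(ℝ, ℝ) ∞ φ) {x₀ : M} {F : R7 → R7 ≃L[ℝ] R7}
    (hF : Ω.IsChartFrame x₀ F) {y : R7} (hy : y ∈ (extChartAt (𝓡 7) x₀).target) :
    ∑ j, fderiv ℝ (fun z => frameDet (F z) * ∑ k, gram (F z).symm j k *
        fderiv ℝ (fun x => Real.exp (4 * φ ((extChartAt (𝓡 7) x₀).symm x))) z (bvec k)) y (bvec j) =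
      Real.exp (4 * φ ((extChartAt (𝓡 7) x₀).symm y)) * frameDet (F y) / 24 *
        ∑ p : Fin 4 → Fin 7, (Ω.form.d + (4 : ℝ) • (differential φ).wedge Ω.form :
          Form M 4).inChart x₀ y (fun a => (F y).symm (bvec (p a))) ^ 2 := by
  have hsm := smooth_twisted hφ Ω.smooth
  have hsT := Ω.smooth_star (k := 4) (l := 3) rfl hsm
  have hT : (Ω.star (k := 4) (l := 3) rfl
      (Ω.form.d + (4 : ℝ) • (differential φ).wedge Ω.form)).d = 0 := neg_eq_zero.1 h.closed_torsion
  refine G2.divergence_identity (isOpen_extChartAt_target x₀) (Ω.smooth x₀)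
    (fun y hy => hF.form_inChart hy) (fun y hy => hF.star_form_inChart hy)
    (fun y hy => twisted_four_inChart hφ (Ω.smooth_star rfl Ω.smooth) hy h.lee)
    (fun y hy => twisted_three_inChart hφ Ω.smooth hy)
    (fun y hy => hF.star_inChart hy (k := 4) (l := 3) rfl _)
    ((contDiffOn_chart hφ x₀).differentiableOn (by simp)) ((hsT x₀).differentiableOn (by simp))
    (fun y hy => ?_) hy
  exact (Form.inChart_d hsT x₀ hy).symm.trans (Form.inChart_zero hT x₀ y)

lemma G2Structure.IsSolution.eventually_eq (h : Ω.IsSolution φ)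
    (hφ : ContMDiff (𝓡 7) 𝓘(ℝ, ℝ) ∞ φ) {x₀ : M} (hmax : ∀ x, φ x ≤ φ x₀) :
    ∀ᶠ x in nhds x₀, φ x = φ x₀ := by
  obtain ⟨F, hF⟩ := Ω.exists_chartFrame x₀
  have hsym : (extChartAt (𝓡 7) x₀).symm (extChartAt (𝓡 7) x₀ x₀) = x₀ := extChartAt_to_inv x₀
  have h1 := eventually_eq_of_divergence (isOpen_extChartAt_target (I := 𝓡 7) x₀)
    (f := fun y => Real.exp (4 * φ ((extChartAt (𝓡 7) x₀).symm y)))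
    (m := fun y => frameDet (F y)) (G := fun y => (F y).symm)
    (contDiffOn_frameDet (Ω.smooth x₀) fun y hy => IsChartFrame.form_inChart hF hy)
    (fun y _ => frameDet_ne_zero _)
    (fun i j => contDiffOn_gram (Ω.smooth x₀)
      (fun y hy => IsChartFrame.form_inChart hF hy) i j)
    ((contDiffOn_const.mul (contDiffOn_chart hφ x₀)).exp)
    (fun y hy => by
      rw [h.divergence_identity hφ hF hy]
      have h2 := frameDet_ne_zero (F y)
      have h3 : ∀ a b c : ℝ, c ≠ 0 → c⁻¹ * (a * c / 24 * b) = a / 24 * b := by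
        intro a b c hc
        field_simp
      rw [h3 _ _ _ h2]
      exact mul_nonneg (by positivity) (Finset.sum_nonneg fun p _ => sq_nonneg _))
    (M := Real.exp (4 * φ x₀)) (fun y _ => Real.exp_le_exp.2
      (mul_le_mul_of_nonneg_left (hmax _) (by norm_num))) (mem_extChartAt_target x₀) (by rw [hsym])
  filter_upwards [(continuousAt_extChartAt (I := 𝓡 7) x₀).eventually h1,
    (isOpen_extChartAt_source (I := 𝓡 7) x₀).mem_nhds (mem_extChartAt_source x₀)] with x hx hxs
  rw [(extChartAt (𝓡 7) x₀).left_inv hxs] at hx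
  have := Real.exp_injective hx
  linarith

/-- The set where φ attains its maximum is closed, nonempty by compactness, and open by the local
maximum principle. -/
lemma G2Structure.IsSolution.eq_const [CompactSpace M] [ConnectedSpace M]
    (h : Ω.IsSolution φ) (hφ : ContMDiff (𝓡 7) 𝓘(ℝ, ℝ) ∞ φ) : ∃ c : ℝ, ∀ x, φ x = c := by
  obtain ⟨x₀, -, hx₀⟩ := isCompact_univ.exists_isMaxOn Set.univ_nonempty
    hφ.continuous.continuousOn
  have hmax : ∀ x, φ x ≤ φ x₀ := fun x => hx₀ (Set.mem_univ x)
  have hclopen : IsClopen {x | φ x = φ x₀} := by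
    refine ⟨isClosed_eq hφ.continuous continuous_const, isOpen_iff_mem_nhds.2 fun x hx => ?_⟩
    have hx' : φ x = φ x₀ := hx
    have h1 := h.eventually_eq hφ (x₀ := x) fun z => hx' ▸ hmax z
    rw [hx'] at h1
    exact h1
  have huniv := hclopen.eq_univ ⟨x₀, rfl⟩
  exact ⟨φ x₀, fun x => (huniv ▸ Set.mem_univ x : x ∈ {x | φ x = φ x₀})⟩

/-- With φ constant the left side of the divergence identity vanishes, hence so does |β|², and β is
dω. -/
lemma G2Structure.IsSolution.form_d_eq_zero (h : Ω.IsSolution φ)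
    (hφ : ContMDiff (𝓡 7) 𝓘(ℝ, ℝ) ∞ φ) {c : ℝ} (hc : ∀ x, φ x = c) : Ω.form.d = 0 := by
  have h1 : (Ω.form.d + (4 : ℝ) • (differential φ).wedge Ω.form : Form M 4) = 0 := by
    refine Form.eq_zero_of_inChart fun x => ?_
    obtain ⟨F, hF⟩ := Ω.exists_chartFrame x
    have h2 := h.divergence_identity hφ hF (mem_extChartAt_target x)
    simp only [hc, fderiv_fun_const, Pi.zero_apply, _root_.zero_apply, mul_zero,
      Finset.sum_const_zero] at h2
    refine eq_zero_of_frame _ _ ((mul_eq_zero.1 h2.symm).resolve_left ?_)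
    have h3 := frameDet_ne_zero (F (extChartAt (𝓡 7) x x))
    positivity
  rwa [wedge_zero_left (differential_eq_zero hc), smul_zero, add_zero] at h1

end Solution

end G2

end

theorem proposition3p1 {M : Type*} [TopologicalSpace M] [ChartedSpace G2.R7 M]
    [IsManifold (𝓡 7) ∞ M] [T2Space M] [CompactSpace M] [ConnectedSpace M]
    (Ω : G2.G2Structure M) (φ : M → ℝ) (hφ : ContMDiff (𝓡 7) 𝓘(ℝ, ℝ) ∞ φ) :
    Ω.IsSolution φ ↔ (∃ c : ℝ, ∀ x, φ x = c) ∧ Ω.IsTorsionFree := by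
  constructor
  · intro h
    obtain ⟨c, hc⟩ := h.eq_const hφ
    exact ⟨⟨c, hc⟩, h.form_d_eq_zero hφ hc, 
      (Ω.codiff_eq_zero_iff (k := 2) (l := 4) rfl Ω.form).2 (h.d_star_form hc)⟩
  · rintro ⟨⟨c, hc⟩, h⟩
    exact h.isSolution hc
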